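/- \textbf{Integrals at infinity.} Let $\bar\Lambda=\mathbb C[p_0,p_1,p_2,\dots]$ be freely generated by $p_0,p_1,\dots$, put $p_{j}:=p_{|j|}$ for $j\in\mathbb Z$, $\partial_a=a\,\partial/\partial p_a$, and let $k,p,q\in\mathbb C$. On $\bar\Lambda[x,x^{-1}]$ let $\partial$ be the derivation over $\mathbb C$ with $\partial x=x$, $\partial p_l=l(x^l-x^{-l})$; let $t$ be the $\bar\Lambda$-linear automorphism $x\mapsto x^{-1}$; let $\Delta$ be the $\bar\Lambda$-linear map with $\Delta(1)=0$ and, for $l>0$, $$\Delta(x^l)=(p_0-2l-1)x^l-2\sum_{j=1}^{l-1}x^{l-2j}-x^{-l}+2\sum_{j=1}^{l-1}p_jx^{l-j}+p_l,\qquad \Delta(x^{-l})=-t(\Delta(x^l)).$$ Define the $BC$ Dunkl--Heckman operator at infinity $$D=\partial-\tfrac k2\Delta-\tfrac p2\,\frac{x+1}{x-1}(1-t)-q\,\frac{x^2+1}{x^2-1}(1-t),$$ the $\bar\Lambda$-linear map $E:\bar\Lambda[x,x^{-1}]\to\bar\Lambda$, $E(x^j)=p_{|j|}$, and $\mathcal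 L^{(2r)}=E\circ D^{2r}|_{\bar\Lambda}$ for $r\ge 0$. Let $N\ge 0$ and, in the variables $x_1,\dots,x_N$, put $\partial_i=x_i\partial/\partial x_i$ and $$D_{i,N}=\partial_i-\tfrac k2\sum_{j\ne i}\Big(\frac{x_i+x_j}{x_i-x_j}(1-s_{ij}^+)+\frac{x_ix_j+1}{x_ix_j-1}(1-s_{ij}^-)\Big)-\tfrac p2\frac{x_i+1}{x_i-1}(1-t_i)-q\frac{x_i^2+1}{x_i^2-1}(1-t_i),$$ where $s_{ij}^{\pm}(x_i,x_j)=(x_j^{\pm1},x_i^{\pm1})$, $t_i(x_i)=x_i^{-1}$; let $\Lambda_N^W$ be the algebra of Laurent polynomials invariant under all $s_{ij}^\pm$, $t_i$. Let $\varphi_N$ be the algebra homomorphism on $\bar\Lambda$ with $\varphi_N(p_l)=\sum_i(x_i^l+x_i^{-l})$, $l\ge0$, and $\varphi_{i,N}$ its extension to $\bar\Lambda[x,x^{-1}]$ with $\varphi_{i,N}(x)=x_i$. Then: (1) $\varphi_{i,N}\circ D=D_{i,N}\circ\varphi_{i,N}$. (2) $\varphi_N(\bar\Lambda)\subset\Lambda_N^W$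 and $\varphi_N\circ\mathcal L^{(2r)}=2\,\mathcal L^{(2r)}_N\circ\varphi_N$, where $\mathcal L_N^{(2r)}=\sum_iD_{i,N}^{2r}|_{\Lambda_N^W}$ are Heckman's integrals; moreover $\mathcal L_N^{(2)}$ is the $BC_N$ CMS operator $$\sum_i\partial_i^2-k\sum_{i<j}\frac{x_i+x_j}{x_i-x_j}(\partial_i-\partial_j)-k\sum_{i<j}\frac{x_ix_j+1}{x_ix_j-1}(\partial_i+\partial_j)-\sum_i\Big(p\frac{x_i+1}{x_i-1}+2q\frac{x_i^2+1}{x_i^2-1}\Big)\partial_i .$$ (3) $[\mathcal L^{(2r)},\mathcal L^{(2s)}]=0$ for all $r,s\ge 0$. (4) With $h=-kp_0-p-2q$, $$\mathcal L^{(2)}=2\sum_{a,b\ge1}(p_{a+b}-p_{a-b})\partial_a\partial_b+2\sum_{a\ge1}(ak+a+k+h)p_a\partial_a+2(k-2q)\sum_{a\ge2}\Big(\sum_{j=1}^{a-1}p_{a-2j}\Big)\partial_a-2p\sum_{a\ge1}\Big(\sum_{j=1}^{2a-1}p_{a-j}\Big)\partial_a-2k\sum_{a\ge2}\Big(\sum_{j=1}^{a-1}p_jp_{a-j}\Big)\partial_a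 .$$ \textbf{Deformed case.} Let $n,m\ge0$ and let $k,p,q,r,s\in\mathbb C$ satisfy $k\neq0$, $p=kr$, $2q+1=k(2s+1)$. Use variables $x_1,\dots,x_n$ and $y_j=x_{n+j}$ ($1\le j\le m$), $\partial_i=x_i\partial/\partial x_i$; put $p(i)=0,\ \mu(i)=p,\ \nu(i)=q$ for $i\le n$ and $p(i)=1,\ \mu(i)=r,\ \nu(i)=s$ for $i>n$. Let $$H_{n,m}=\sum_{i=1}^n\Big(x_i\frac{\partial}{\partial x_i}\Big)^2+k\sum_{j=1}^m\Big(y_j\frac{\partial}{\partial y_j}\Big)^2-2k(k+1)\sum_{i<j}^n\Big(\frac{x_ix_j}{(x_i-x_j)^2}+\frac{x_ix_j}{(x_ix_j-1)^2}\Big)-2(k^{-1}+1)\sum_{i<j}^m\Big(\frac{y_iy_j}{(y_i-y_j)^2}+\frac{y_iy_j}{(y_iy_j-1)^2}\Big)$$ $$-2(k+1)\sum_{i=1}^n\sum_{j=1}^m\Big(\frac{x_iy_j}{(x_i-y_j)^2}+\frac{x_iy_j}{(x_iy_j-1)^2}\Big)-\sum_{i=1}^n\Big(\frac{p(p+2q+1)x_i}{(x_i-1)^2}+\frac{4q(q+1)x_i^2}{(x_i^2-1)^2}\Big)-\sum_{j=1}^m\Big(\frac{kr(r+2s+1)y_j}{(y_j-1)^2}+\frac{4ks(s+1)y_j^2}{(y_j^2-1)^2}\Big),$$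 and let $L=\begin{pmatrix}A&B\\-B&-A\end{pmatrix}$ be the matrix of differential operators with $$A_{ii}=k^{p(i)}\partial_i,\quad A_{ij}=\frac{k^{1-p(j)}(x_i+x_j)}{2(x_i-x_j)},\quad B_{ii}=\frac{k^{p(i)}\mu(i)(x_i+1)}{2(x_i-1)}+\frac{k^{p(i)}\nu(i)(x_i^2+1)}{x_i^2-1},\quad B_{ij}=\frac{k^{1-p(j)}(x_ix_j+1)}{2(x_ix_j-1)}\quad(i\ne j).$$ Let $e=(1,\dots,1)^T$ and $e^*_i=e^*_{n+m+i}=k^{-p(i)}$. Then the operators $L^{(2l)}_{n,m}=e^*L^{2l}e$, $l\ge0$, are commuting quantum integrals of the deformed $BC_{n,m}$ system: $[L^{(2l)}_{n,m},H_{n,m}]=0$ and $[L^{(2l)}_{n,m},L^{(2l')}_{n,m}]=0$ for all $l,l'$. -/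

import Mathlib

open scoped LaurentPolynomial

noncomputable section

namespace BCCMS

/-! ### The algebra at infinity -/

/-- The polynomial algebra `Λ̄` freely generated over `ℂ` by `p₀, p₁, p₂, …`. -/
abbrev LambdaBar : Type := MvPolynomial ℕ ℂ

/-- The algebra `Λ̄[x, x⁻¹]`; here `x ^ l` is `T l`. -/
abbrev LambdaBarX : Type := LaurentPolynomial LambdaBar

/-- The generator `p_j` with the convention `p_j = p_{|j|}` for integer `j`. -/
def pgen (j : ℤ) : LambdaBar := MvPolynomial.X j.natAbs

/-- `∂_a = a ∂/∂p_a` on `Λ̄`. -/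
def partialP (a : ℕ) (f : LambdaBar) : LambdaBar := (a : ℂ) • MvPolynomial.pderiv a f

/-- The derivation `Λ̄ → Λ̄[x, x⁻¹]` over `ℂ` with `p_l ↦ l (x ^ l - x ^ (-l))`. -/
def derivP : Derivation ℂ LambdaBar LambdaBarX :=
  MvPolynomial.mkDerivation ℂ fun l : ℕ =>
    (l : ℂ) • (LaurentPolynomial.T (l : ℤ) - LaurentPolynomial.T (-(l : ℤ)))

/-- The linear map underlying `∂`: `c x ^ l ↦ (derivP c + l c) x ^ l` for `c ∈ Λ̄`. -/
def derivLin : LambdaBarX →ₗ[ℂ] LambdaBarX :=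
  (Finsupp.lsum ℂ fun l : ℤ =>
    (LinearMap.mulRight ℂ (LaurentPolynomial.T l : LambdaBarX)).comp
      (derivP.toLinearMap + (l : ℂ) • (Algebra.linearMap LambdaBar LambdaBarX).restrictScalars ℂ)).comp
    (AddMonoidAlgebra.coeffLinearEquiv ℂ).toLinearMap

theorem derivLin_single (l : ℤ) (c : LambdaBar) :
    derivLin (AddMonoidAlgebra.single l c) =
      (derivP c + (l : ℂ) • LaurentPolynomial.C c) * LaurentPolynomial.T l := by
  have h : AddMonoidAlgebra.coeffLinearEquiv ℂ (AddMonoidAlgebra.single l c) =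
      (Finsupp.single l c : ℤ →₀ LambdaBar) := rfl
  rw [derivLin, LinearMap.comp_apply, LinearEquiv.coe_coe, h, Finsupp.lsum_single]
  rfl

theorem derivLin_mul (F G : LambdaBarX) :
    derivLin (F * G) = F • derivLin G + G • derivLin F := by
  induction F using AddMonoidAlgebra.induction_linear with
  | zero => simp
  | add F F' h h' => rw [add_mul, map_add, h, h', map_add]; simp only [smul_eq_mul]; ring
  | single l c =>
    induction G using AddMonoidAlgebra.induction_linear with
    | zero => simp
    | add G G' h h' => rw [mul_add, map_add, h, h', map_add]; simp only [smul_eq_mul]; ring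
    | single l' c' =>
      rw [AddMonoidAlgebra.single_mul_single, derivLin_single, derivLin_single, derivLin_single,
        Derivation.leibniz, LaurentPolynomial.T_add, LaurentPolynomial.single_eq_C_mul_T,
        LaurentPolynomial.single_eq_C_mul_T, map_mul]
      have e : ∀ u : LambdaBar, algebraMap LambdaBar LambdaBarX u = LaurentPolynomial.C u :=
        fun _ => rfl
      simp only [smul_eq_mul, Int.cast_add, map_add, Algebra.smul_def, e]
      ring

/-- The derivation `∂` of `Λ̄[x, x⁻¹]` with `∂ x = x` and `∂ p_l = l (x ^ l - x ^ (-l))`. -/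
def derivInf : Derivation ℂ LambdaBarX LambdaBarX := Derivation.mk' derivLin derivLin_mul

theorem derivInf_x : derivInf (LaurentPolynomial.T 1) = LaurentPolynomial.T 1 := by
  change derivLin (AddMonoidAlgebra.single 1 1) = _
  rw [derivLin_single]; simp

theorem derivInf_p (l : ℕ) :
    derivInf (LaurentPolynomial.C (MvPolynomial.X l)) =
      (l : ℂ) • (LaurentPolynomial.T (l : ℤ) - LaurentPolynomial.T (-(l : ℤ))) := by
  change derivLin (AddMonoidAlgebra.single 0 (MvPolynomial.X l)) = _
  rw [derivLin_single]; simp [derivP]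

/-- The homomorphism of `Λ̄`-modules with `x ^ l ↦ g l`. -/
def onPowers {M : Type} [AddCommGroup M] [Module LambdaBar M] (g : ℤ → M) :
    LambdaBarX →ₗ[LambdaBar] M :=
  (Finsupp.linearCombination LambdaBar g).comp
    (AddMonoidAlgebra.coeffLinearEquiv LambdaBar).toLinearMap

theorem onPowers_single {M : Type} [AddCommGroup M] [Module LambdaBar M] (g : ℤ → M) (l : ℤ)
    (c : LambdaBar) : onPowers g (AddMonoidAlgebra.single l c) = c • g l := by
  have h : AddMonoidAlgebra.coeffLinearEquiv LambdaBar (AddMonoidAlgebra.single l c) =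
      (Finsupp.single l c : ℤ →₀ LambdaBar) := rfl
  rw [onPowers, LinearMap.comp_apply, LinearEquiv.coe_coe, h, Finsupp.linearCombination_single]

/-- `Δ(x ^ l)` for `l > 0`. -/
def deltaPos (l : ℕ) : LambdaBarX :=
  LaurentPolynomial.C (pgen 0 - 2 * (l : LambdaBar) - 1) * LaurentPolynomial.T (l : ℤ)
    - 2 * ∑ j ∈ Finset.Ico 1 l, LaurentPolynomial.T ((l : ℤ) - 2 * j)
    - LaurentPolynomial.T (-(l : ℤ))
    + 2 * ∑ j ∈ Finset.Ico 1 l,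
        LaurentPolynomial.C (pgen j) * LaurentPolynomial.T ((l : ℤ) - j)
    + LaurentPolynomial.C (pgen l)

/-- `Δ(x ^ (-l))` for `l > 0`. -/
def deltaNeg (l : ℕ) : LambdaBarX :=
  -(LaurentPolynomial.C (pgen 0 - 2 * (l : LambdaBar) - 1) * LaurentPolynomial.T (-(l : ℤ)))
    + 2 * ∑ j ∈ Finset.Ico 1 l, LaurentPolynomial.T ((l : ℤ) - 2 * j)
    + LaurentPolynomial.T (l : ℤ)
    - 2 * ∑ j ∈ Finset.Ico 1 l,
        LaurentPolynomial.C (pgen j) * LaurentPolynomial.T (-(l : ℤ) + j)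
    - LaurentPolynomial.C (pgen l)

/-- The homomorphism of `Λ̄`-modules `Δ` on `Λ̄[x, x⁻¹]`. -/
def Delta : LambdaBarX →ₗ[LambdaBar] LambdaBarX :=
  onPowers fun l =>
    if 0 < l then deltaPos l.natAbs else if l < 0 then deltaNeg l.natAbs else 0

/-- The operator `(x + 1) / (x - 1) (1 - t)` on `Λ̄[x, x⁻¹]`, where `t (x ^ l) = x ^ (-l)`;
see `reflOne_spec`. -/
def reflOne : LambdaBarX →ₗ[LambdaBar] LambdaBarX :=
  onPowers fun l => (l.sign : LambdaBarX) *
    (LaurentPolynomial.T l + LaurentPolynomial.T (-l)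
      + 2 * ∑ j ∈ Finset.Ico 1 (2 * l.natAbs), LaurentPolynomial.T ((l.natAbs : ℤ) - j))

/-- The operator `(x ^ 2 + 1) / (x ^ 2 - 1) (1 - t)` on `Λ̄[x, x⁻¹]`; see `reflTwo_spec`. -/
def reflTwo : LambdaBarX →ₗ[LambdaBar] LambdaBarX :=
  onPowers fun l => (l.sign : LambdaBarX) *
    (LaurentPolynomial.T l + LaurentPolynomial.T (-l)
      + 2 * ∑ j ∈ Finset.Ico 1 l.natAbs, LaurentPolynomial.T ((l.natAbs : ℤ) - 2 * j))

/-- The telescoping identity behind the two divisions below. -/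
theorem telescope (s : ℤ) (N : ℕ) (hN : 0 < N) (a : ℤ) :
    ((LaurentPolynomial.T s : LambdaBarX) - 1) *
      (LaurentPolynomial.T a + LaurentPolynomial.T (a - N * s)
        + 2 * ∑ j ∈ Finset.Ico 1 N, LaurentPolynomial.T (a - j * s)) =
      (LaurentPolynomial.T s + 1) * (LaurentPolynomial.T a - LaurentPolynomial.T (a - N * s)) := by
  induction N, hN using Nat.le_induction with
  | base =>
    have h : (LaurentPolynomial.T a : LambdaBarX) =
        LaurentPolynomial.T (a - s) * LaurentPolynomial.T s := by
      rw [← LaurentPolynomial.T_add]; congr 1; ring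
    simp only [Nat.cast_one, one_mul, Finset.Ico_self,
      Finset.sum_empty, mul_zero, add_zero]
    rw [h]; ring
  | succ N hN ih =>
    rw [Finset.sum_Ico_succ_top hN]
    have h : (LaurentPolynomial.T (a - N * s) : LambdaBarX) =
        LaurentPolynomial.T (a - (N + 1 : ℕ) * s) * LaurentPolynomial.T s := by
      rw [← LaurentPolynomial.T_add]; congr 1; push_cast; ring
    rw [h] at ih ⊢
    linear_combination ih

theorem reflOne_spec (F : LambdaBarX) :
    (LaurentPolynomial.T 1 - 1) * reflOne F =
      (LaurentPolynomial.T 1 + 1) * (F - LaurentPolynomial.invert F) := by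
  induction F using AddMonoidAlgebra.induction_linear with
  | zero => simp
  | add F G hF hG => rw [map_add, map_add, mul_add, hF, hG]; ring
  | single l c =>
    rw [reflOne, onPowers_single, LaurentPolynomial.single_eq_C_mul_T, map_mul,
      LaurentPolynomial.invert_C, LaurentPolynomial.invert_T, LaurentPolynomial.smul_eq_C_mul]
    rcases lt_trichotomy l 0 with h | rfl | h
    · have key := telescope 1 (2 * l.natAbs) (by omega) (l.natAbs : ℤ)
      have e1 : (l.natAbs : ℤ) = -l := by omega
      have e2 : (l.natAbs : ℤ) - ((2 * l.natAbs : ℕ) : ℤ) * 1 = l := by omega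
      rw [e2] at key
      simp only [mul_one] at key
      rw [Int.sign_eq_neg_one_of_neg h]
      rw [e1] at key ⊢
      push_cast
      linear_combination (-LaurentPolynomial.C c) * key
    · simp
    · have key := telescope 1 (2 * l.natAbs) (by omega) (l.natAbs : ℤ)
      have e1 : (l.natAbs : ℤ) = l := by omega
      have e2 : (l.natAbs : ℤ) - ((2 * l.natAbs : ℕ) : ℤ) * 1 = -l := by omega
      rw [e2] at key
      simp only [mul_one] at key
      rw [Int.sign_eq_one_of_pos h]
      rw [e1] at key ⊢
      push_cast
      linear_combination (LaurentPolynomial.C c) * key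

theorem reflTwo_spec (F : LambdaBarX) :
    (LaurentPolynomial.T 2 - 1) * reflTwo F =
      (LaurentPolynomial.T 2 + 1) * (F - LaurentPolynomial.invert F) := by
  induction F using AddMonoidAlgebra.induction_linear with
  | zero => simp
  | add F G hF hG => rw [map_add, map_add, mul_add, hF, hG]; ring
  | single l c =>
    rw [reflTwo, onPowers_single, LaurentPolynomial.single_eq_C_mul_T, map_mul,
      LaurentPolynomial.invert_C, LaurentPolynomial.invert_T, LaurentPolynomial.smul_eq_C_mul]
    rcases lt_trichotomy l 0 with h | rfl | h
    · have key := telescope 2 l.natAbs (by omega) (l.natAbs : ℤ)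
      have e1 : (l.natAbs : ℤ) = -l := by omega
      have e2 : (l.natAbs : ℤ) - (l.natAbs : ℤ) * 2 = l := by omega
      rw [e2] at key
      simp only [mul_comm _ (2 : ℤ)] at key
      rw [Int.sign_eq_neg_one_of_neg h]
      rw [e1] at key ⊢
      push_cast
      linear_combination (-LaurentPolynomial.C c) * key
    · simp
    · have key := telescope 2 l.natAbs (by omega) (l.natAbs : ℤ)
      have e1 : (l.natAbs : ℤ) = l := by omega
      have e2 : (l.natAbs : ℤ) - (l.natAbs : ℤ) * 2 = -l := by omega
      rw [e2] at key
      simp only [mul_comm _ (2 : ℤ)] at key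
      rw [Int.sign_eq_one_of_pos h]
      rw [e1] at key ⊢
      push_cast
      linear_combination (LaurentPolynomial.C c) * key

/-- The infinite-dimensional `BC` Dunkl–Heckman operator
`D = ∂ - (k/2) Δ - (p/2) (x+1)/(x-1) (1-t) - q (x²+1)/(x²-1) (1-t)` on `Λ̄[x, x⁻¹]`. -/
def dunklInf (k p q : ℂ) : Module.End ℂ LambdaBarX :=
  derivInf.toLinearMap - (k / 2) • Delta.restrictScalars ℂ
    - (p / 2) • reflOne.restrictScalars ℂ - q • reflTwo.restrictScalars ℂ

/-- The homomorphism of `Λ̄`-modules `E` with `E (x ^ j) = p_{|j|}`. -/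
def traceE : LambdaBarX →ₗ[LambdaBar] LambdaBar := onPowers pgen

/-- `𝓛^(2r) = E ∘ D ^ (2r)`, restricted to `Λ̄`. -/
def cmsInf (k p q : ℂ) (r : ℕ) : Module.End ℂ LambdaBar :=
  traceE.restrictScalars ℂ ∘ₗ (dunklInf k p q ^ (2 * r)) ∘ₗ
    (Algebra.linearMap LambdaBar LambdaBarX).restrictScalars ℂ

/-! ### Extension of derivations to fraction fields -/

section Extension

variable {A K : Type} [CommRing A] [Algebra ℂ A] [Field K] [Algebra A K]

/-- The ring homomorphism `a ↦ a + ε d a` into the dual numbers. -/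
def dualHom (d : Derivation ℂ A A) :
    A →+* TrivSqZeroExt K K where
  toFun a := TrivSqZeroExt.inl (algebraMap A K a) + TrivSqZeroExt.inr (algebraMap A K (d a))
  map_one' := by ext <;> simp
  map_mul' a b := by
    ext
    · simp
    · simp only [Derivation.leibniz, smul_eq_mul, map_add, map_mul, TrivSqZeroExt.snd_add,
        TrivSqZeroExt.snd_inl, TrivSqZeroExt.snd_inr, TrivSqZeroExt.snd_mul,
        TrivSqZeroExt.fst_add, TrivSqZeroExt.fst_inl, TrivSqZeroExt.fst_inr,
        MulOpposite.smul_eq_mul_unop, MulOpposite.unop_op]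
      ring
  map_zero' := by ext <;> simp
  map_add' a b := by
    ext
    · simp
    · simp only [map_add, TrivSqZeroExt.snd_add, TrivSqZeroExt.snd_inl, TrivSqZeroExt.snd_inr]
      ring

theorem dualHom_fst (d : Derivation ℂ A A) (a : A) :
    (dualHom (K := K) d a).fst = algebraMap A K a := by
  change (TrivSqZeroExt.inl (algebraMap A K a) + TrivSqZeroExt.inr (algebraMap A K (d a))).fst = _
  rw [TrivSqZeroExt.fst_add, TrivSqZeroExt.fst_inl, TrivSqZeroExt.fst_inr, add_zero]

theorem dualHom_snd (d : Derivation ℂ A A) (a : A) :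
    (dualHom (K := K) d a).snd = algebraMap A K (d a) := by
  change (TrivSqZeroExt.inl (algebraMap A K a) + TrivSqZeroExt.inr (algebraMap A K (d a))).snd = _
  rw [TrivSqZeroExt.snd_add, TrivSqZeroExt.snd_inl, TrivSqZeroExt.snd_inr, zero_add]

/-- The extension of `dualHom` to the fraction field. -/
def dualLift [IsFractionRing A K] (d : Derivation ℂ A A) :
    K →+* TrivSqZeroExt K K :=
  IsLocalization.lift (M := nonZeroDivisors A) (g := dualHom (K := K) d) fun y => by
    rw [TrivSqZeroExt.isUnit_iff_isUnit_fst, dualHom_fst]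
    exact IsLocalization.map_units K y

theorem dualLift_algebraMap [IsFractionRing A K] (d : Derivation ℂ A A) (a : A) :
    dualLift d (algebraMap A K a) = dualHom d a :=
  IsLocalization.lift_eq _ a

theorem dualLift_fst [IsFractionRing A K] (d : Derivation ℂ A A) (f : K) : (dualLift d f).fst = f := by
  have h : ((TrivSqZeroExt.fstHom K K K : TrivSqZeroExt K K →ₐ[K] K) :
      TrivSqZeroExt K K →+* K).comp (dualLift d) = RingHom.id K := by
    apply IsLocalization.ringHom_ext (nonZeroDivisors A)
    refine RingHom.ext fun a => ?_
    change (dualLift d (algebraMap A K a)).fst = algebraMap A K a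
    rw [dualLift_algebraMap, dualHom_fst]
  exact congrArg (fun g : K →+* K => g f) h

/-- The extension of a derivation from a domain to its fraction field (the quotient rule);
see `ratDeriv_algebraMap`. -/
def ratDeriv [IsFractionRing A K] [Algebra ℂ K] [IsScalarTower ℂ A K] (d : Derivation ℂ A A) :
    Derivation ℂ K K :=
  Derivation.mk'
    { toFun := fun f => (dualLift d f).snd
      map_add' := fun f g => by rw [map_add, TrivSqZeroExt.snd_add]
      map_smul' := fun c f => by
        have h1 : (dualLift d (algebraMap ℂ K c)).snd = 0 := by
          rw [IsScalarTower.algebraMap_apply ℂ A K, dualLift_algebraMap, dualHom_snd,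
            Derivation.map_algebraMap, map_zero]
        rw [Algebra.smul_def, map_mul, TrivSqZeroExt.snd_mul, h1, dualLift_fst]
        simp [Algebra.smul_def] }
    fun f g => by
      change (dualLift d (f * g)).snd = f • (dualLift d g).snd + g • (dualLift d f).snd
      rw [map_mul, TrivSqZeroExt.snd_mul, dualLift_fst, dualLift_fst]
      simp [mul_comm]

theorem ratDeriv_algebraMap [IsFractionRing A K] [Algebra ℂ K] [IsScalarTower ℂ A K]
    (d : Derivation ℂ A A) (a : A) : (ratDeriv d : Derivation ℂ K K) (algebraMap A K a) =
      algebraMap A K (d a) := by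
  change (dualLift d (algebraMap A K a)).snd = _
  rw [dualLift_algebraMap, dualHom_snd]

end Extension

/-! ### Rational functions in finitely many variables -/

section Rational

variable {ι : Type} [DecidableEq ι]

/-- Laurent polynomials over `ℂ` in the variables `x_i`, `i ∈ ι`. -/
abbrev LaurentRing (ι : Type) : Type := AddMonoidAlgebra ℂ (ι →₀ ℤ)

/-- The field of rational functions over `ℂ` in the variables `x_i`, `i ∈ ι`. -/
def RatField (ι : Type) : Type := FractionRing (LaurentRing ι)

instance (ι : Type) : Field (RatField ι) := inferInstanceAs (Field (FractionRing (LaurentRing ι)))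

instance (ι : Type) : Algebra (LaurentRing ι) (RatField ι) :=
  inferInstanceAs (Algebra (LaurentRing ι) (FractionRing (LaurentRing ι)))

instance (ι : Type) : IsFractionRing (LaurentRing ι) (RatField ι) :=
  inferInstanceAs (IsFractionRing (LaurentRing ι) (FractionRing (LaurentRing ι)))

instance (ι : Type) : Algebra ℂ (RatField ι) :=
  inferInstanceAs (Algebra ℂ (FractionRing (LaurentRing ι)))

instance (ι : Type) : IsScalarTower ℂ (LaurentRing ι) (RatField ι) :=
  inferInstanceAs (IsScalarTower ℂ (LaurentRing ι) (FractionRing (LaurentRing ι)))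

/-- The variable `x_i` as a Laurent polynomial. -/
def laurentVar (i : ι) : LaurentRing ι := AddMonoidAlgebra.single (Finsupp.single i 1) 1

/-- The variable `x_i` as a rational function. -/
def var (i : ι) : RatField ι := algebraMap (LaurentRing ι) (RatField ι) (laurentVar i)

theorem laurentVar_ne_zero {ι : Type} (i : ι) : laurentVar i ≠ 0 := by
  intro h
  have := congrArg (fun f : LaurentRing ι => f.coeff (Finsupp.single i 1)) h
  simp [laurentVar] at this

theorem var_ne_zero {ι : Type} (i : ι) : var i ≠ 0 := fun h =>
  laurentVar_ne_zero i ((IsFractionRing.to_map_eq_zero_iff (K := RatField ι)).1 h)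

/-- The linear map `x ^ m ↦ m_i x ^ m` on Laurent polynomials. -/
def eulerLin {ι : Type} (i : ι) : LaurentRing ι →ₗ[ℂ] LaurentRing ι :=
  (Finsupp.lsum ℂ fun m : ι →₀ ℤ =>
    (m i : ℂ) • (AddMonoidAlgebra.coeffLinearEquiv ℂ).symm.toLinearMap ∘ₗ Finsupp.lsingle m).comp
    (AddMonoidAlgebra.coeffLinearEquiv ℂ).toLinearMap

theorem eulerLin_single {ι : Type} (i : ι) (m : ι →₀ ℤ) (c : ℂ) :
    eulerLin i (AddMonoidAlgebra.single m c) = (m i : ℂ) • AddMonoidAlgebra.single m c := by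
  have h : AddMonoidAlgebra.coeffLinearEquiv ℂ (AddMonoidAlgebra.single m c) =
      (Finsupp.single m c : (ι →₀ ℤ) →₀ ℂ) := rfl
  rw [eulerLin, LinearMap.comp_apply, LinearEquiv.coe_coe, h, Finsupp.lsum_single]
  rfl

/-- The derivation `x_i ∂/∂x_i` of Laurent polynomials. -/
def euler {ι : Type} (i : ι) : Derivation ℂ (LaurentRing ι) (LaurentRing ι) :=
  Derivation.mk' (eulerLin i) fun F G => by
    induction F using AddMonoidAlgebra.induction_linear with
    | zero => simp
    | add F F' h h' => rw [add_mul, map_add, h, h', map_add]; simp only [smul_eq_mul]; ring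
    | single m c =>
      induction G using AddMonoidAlgebra.induction_linear with
      | zero => simp
      | add G G' h h' => rw [mul_add, map_add, h, h', map_add]; simp only [smul_eq_mul]; ring
      | single m' c' =>
        rw [AddMonoidAlgebra.single_mul_single, eulerLin_single, eulerLin_single, eulerLin_single,
          smul_eq_mul, smul_eq_mul, mul_smul_comm, mul_smul_comm,
          AddMonoidAlgebra.single_mul_single, AddMonoidAlgebra.single_mul_single,
          Finsupp.add_apply, Int.cast_add, add_smul, add_comm m' m, mul_comm c' c, add_comm]

/-- The derivation `∂_i = x_i ∂/∂x_i` of the field of rational functions. -/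
def theta {ι : Type} (i : ι) : Derivation ℂ (RatField ι) (RatField ι) := ratDeriv (euler i)

theorem theta_var (i j : ι) : theta i (var j) = if i = j then var j else 0 := by
  have h : euler i (laurentVar j) = if i = j then laurentVar j else 0 := by
    change eulerLin i (AddMonoidAlgebra.single (Finsupp.single j 1) 1) = _
    rw [eulerLin_single]
    by_cases hij : i = j
    · subst hij; simp [laurentVar]
    · simp [hij]
  rw [theta, var, ratDeriv_algebraMap, h]
  split_ifs <;> simp

/-- The automorphism of the field of rational functions induced by an automorphism of the lattice
of exponents. -/
def ratAut {ι : Type} (e : (ι →₀ ℤ) ≃+ (ι →₀ ℤ)) : RatField ι ≃ₐ[ℂ] RatField ι :=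
  IsFractionRing.algEquivOfAlgEquiv (AddMonoidAlgebra.domCongr ℂ ℂ e)

theorem ratAut_var {ι : Type} (e : (ι →₀ ℤ) ≃+ (ι →₀ ℤ)) (i : ι) :
    ratAut e (var i) =
      algebraMap (LaurentRing ι) (RatField ι)
        (AddMonoidAlgebra.single (e (Finsupp.single i 1)) 1) := by
  rw [ratAut, var, IsFractionRing.algEquivOfAlgEquiv_algebraMap, laurentVar]
  simp

/-- `s_{ij}^+`: the exchange of `x_i` and `x_j`. -/
def sPlus (i j : ι) : RatField ι ≃ₐ[ℂ] RatField ι :=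
  ratAut (Finsupp.domCongr (Equiv.swap i j))

/-- The change of sign of the `i`-th exponent. -/
def negExponent {ι : Type} (i : ι) : (ι →₀ ℤ) ≃+ (ι →₀ ℤ) where
  toFun m := m - Finsupp.single i (2 * m i)
  invFun m := m - Finsupp.single i (2 * m i)
  left_inv m := by
    ext j
    by_cases h : i = j
    · subst h; simp; ring
    · simp [h]
  right_inv m := by
    ext j
    by_cases h : i = j
    · subst h; simp; ring
    · simp [h]
  map_add' m m' := by
    ext j
    by_cases h : i = j
    · subst h; simp; ring
    · simp [h]

/-- `t_i`: the inversion `x_i ↦ x_i⁻¹`. -/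
def tInv {ι : Type} (i : ι) : RatField ι ≃ₐ[ℂ] RatField ι := ratAut (negExponent i)

/-- `s_{ij}^-`: the map `x_i ↦ x_j⁻¹`, `x_j ↦ x_i⁻¹` (for `i ≠ j`). -/
def sMinus (i j : ι) : RatField ι ≃ₐ[ℂ] RatField ι :=
  (sPlus i j).trans ((tInv i).trans (tInv j))

theorem sPlus_var (i j l : ι) : sPlus i j (var l) = var (Equiv.swap i j l) := by
  rw [sPlus, ratAut_var, var, laurentVar]
  simp

theorem tInv_var (i l : ι) : tInv i (var l) = if i = l then (var l)⁻¹ else var l := by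
  rw [tInv, ratAut_var]
  by_cases h : i = l
  · subst h
    rw [if_pos rfl]
    apply eq_inv_of_mul_eq_one_left
    rw [var, ← map_mul, laurentVar,
      AddMonoidAlgebra.single_mul_single]
    rw [show negExponent i (Finsupp.single i 1) + Finsupp.single i 1 = 0 by
      ext j
      by_cases h : i = j
      · subst h; simp [negExponent]
      · simp [negExponent, h]]
    rw [mul_one, ← AddMonoidAlgebra.one_def, map_one]
  · rw [if_neg h, var, laurentVar]
    rw [show negExponent i (Finsupp.single l 1) = Finsupp.single l 1 by
      simp [negExponent, Ne.symm h]]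

theorem sMinus_var_left (i j : ι) (h : i ≠ j) : sMinus i j (var i) = (var j)⁻¹ := by
  simp [sMinus, sPlus_var, tInv_var, h]

theorem sMinus_var_right (i j : ι) (h : i ≠ j) : sMinus i j (var j) = (var i)⁻¹ := by
  simp [sMinus, sPlus_var, tInv_var, h.symm]

/-- The operator of multiplication by a rational function. -/
def mulOp {ι : Type} (f : RatField ι) : Module.End ℂ (RatField ι) := LinearMap.mulLeft ℂ f

/-- `∂_i` as a linear operator. -/
def thetaOp {ι : Type} (i : ι) : Module.End ℂ (RatField ι) := (theta i).toLinearMap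

end Rational

/-! ### The `BC_N` system -/

/-- The `BC_N` Dunkl–Heckman operator `D_{i,N}`, as an operator on rational functions. -/
def dunkl (N : ℕ) (k p q : ℂ) (i : Fin N) : Module.End ℂ (RatField (Fin N)) :=
  thetaOp i
    - (k / 2) • ∑ j ∈ Finset.univ.erase i,
        (mulOp ((var i + var j) / (var i - var j)) * (1 - (sPlus i j).toLinearMap)
          + mulOp ((var i * var j + 1) / (var i * var j - 1)) * (1 - (sMinus i j).toLinearMap))
    - (p / 2) • (mulOp ((var i + 1) / (var i - 1)) * (1 - (tInv i).toLinearMap))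
    - q • (mulOp ((var i ^ 2 + 1) / (var i ^ 2 - 1)) * (1 - (tInv i).toLinearMap))

/-- The `BC_N` CMS operator `𝓗_N` in the gauged form. -/
def gaugedCMS (N : ℕ) (k p q : ℂ) : Module.End ℂ (RatField (Fin N)) :=
  ∑ i, thetaOp i ^ 2
    - k • ∑ i, ∑ j ∈ Finset.Ioi i,
        mulOp ((var i + var j) / (var i - var j)) * (thetaOp i - thetaOp j)
    - k • ∑ i, ∑ j ∈ Finset.Ioi i,
        mulOp ((var i * var j + 1) / (var i * var j - 1)) * (thetaOp i + thetaOp j)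
    - ∑ i, (p • mulOp ((var i + 1) / (var i - 1))
        + (2 * q) • mulOp ((var i ^ 2 + 1) / (var i ^ 2 - 1))) * thetaOp i

/-- `Λ_N^W`: the Laurent polynomials invariant under the Weyl group generated by
the `s_{ij}^±` and the `t_i`. -/
def invariants (N : ℕ) : Set (RatField (Fin N)) :=
  {g | g ∈ Set.range (algebraMap (LaurentRing (Fin N)) (RatField (Fin N))) ∧
    (∀ i j, i ≠ j → sPlus i j g = g ∧ sMinus i j g = g) ∧ ∀ i, tInv i g = g}

/-- Heckman's integral `𝓛_N^(2r) = ∑_i D_{i,N} ^ (2r)` (to be restricted to `Λ_N^W`). -/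
def heckman (N : ℕ) (k p q : ℂ) (r : ℕ) : Module.End ℂ (RatField (Fin N)) :=
  ∑ i, dunkl N k p q i ^ (2 * r)

/-- The homomorphism `φ_N` with `p_l ↦ ∑_i (x_i ^ l + x_i ^ (-l))`. -/
def phi (N : ℕ) : LambdaBar →ₐ[ℂ] RatField (Fin N) :=
  MvPolynomial.aeval fun l : ℕ => ∑ i : Fin N, (var i ^ l + (var i)⁻¹ ^ l)

/-- The homomorphism `φ_{i,N}` on `Λ̄[x, x⁻¹]` which extends `φ_N` by `x ↦ x_i`. -/
def phiX (N : ℕ) (i : Fin N) : LambdaBarX →+* RatField (Fin N) :=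
  LaurentPolynomial.eval₂ (phi N).toRingHom (Units.mk0 (var i) (var_ne_zero i))

/-! ### The deformed `BC_{n,m}` system -/

section Deformed

/-- The index set of the variables `x_1, …, x_n, x_{n+1} = y_1, …, x_{n+m} = y_m`. -/
abbrev Idx (n m : ℕ) : Type := Fin n ⊕ Fin m

/-- The parity function: `0` on the first `n` indices, `1` on the last `m` ones. -/
def parity {n m : ℕ} : Idx n m → ℕ := Sum.elim (fun _ => 0) (fun _ => 1)

/-- The deformed `BC_{n,m}` CMS operator `H_{n,m}` in exponential coordinates. -/
def deformedCMS (n m : ℕ) (k p q r s : ℂ) : Module.End ℂ (RatField (Idx n m)) :=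
  let x : Fin n → RatField (Idx n m) := fun i => var (Sum.inl i)
  let y : Fin m → RatField (Idx n m) := fun j => var (Sum.inr j)
  ∑ i : Fin n, thetaOp (Sum.inl i) ^ 2 + k • ∑ j : Fin m, thetaOp (Sum.inr j) ^ 2
    - (2 * k * (k + 1)) • ∑ i : Fin n, ∑ j ∈ Finset.Ioi i,
        mulOp (x i * x j / (x i - x j) ^ 2 + x i * x j / (x i * x j - 1) ^ 2)
    - (2 * (k⁻¹ + 1)) • ∑ i : Fin m, ∑ j ∈ Finset.Ioi i,
        mulOp (y i * y j / (y i - y j) ^ 2 + y i * y j / (y i * y j - 1) ^ 2)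
    - (2 * (k + 1)) • ∑ i : Fin n, ∑ j : Fin m,
        mulOp (x i * y j / (x i - y j) ^ 2 + x i * y j / (x i * y j - 1) ^ 2)
    - ∑ i : Fin n, ((p * (p + 2 * q + 1)) • mulOp (x i / (x i - 1) ^ 2)
        + (4 * q * (q + 1)) • mulOp (x i ^ 2 / (x i ^ 2 - 1) ^ 2))
    - ∑ j : Fin m, ((k * r * (r + 2 * s + 1)) • mulOp (y j / (y j - 1) ^ 2)
        + (4 * k * s * (s + 1)) • mulOp (y j ^ 2 / (y j ^ 2 - 1) ^ 2))

/-- The block `A` of the quantum Moser matrix. -/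
def moserA (n m : ℕ) (k : ℂ) : Matrix (Idx n m) (Idx n m) (Module.End ℂ (RatField (Idx n m))) :=
  Matrix.of fun i j =>
    if i = j then k ^ parity i • thetaOp i
    else (k ^ (1 - parity j) / 2) • mulOp ((var i + var j) / (var i - var j))

/-- The block `B` of the quantum Moser matrix, with the multiplicity functions
`μ = p, r` and `ν = q, s` on the two groups of indices. -/
def moserB (n m : ℕ) (k p q r s : ℂ) :
    Matrix (Idx n m) (Idx n m) (Module.End ℂ (RatField (Idx n m))) :=
  let μ : Idx n m → ℂ := Sum.elim (fun _ => p) (fun _ => r)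
  let ν : Idx n m → ℂ := Sum.elim (fun _ => q) (fun _ => s)
  Matrix.of fun i j =>
    if i = j then
      (k ^ parity i * μ i / 2) • mulOp ((var i + 1) / (var i - 1))
        + (k ^ parity i * ν i) • mulOp ((var i ^ 2 + 1) / (var i ^ 2 - 1))
    else (k ^ (1 - parity j) / 2) • mulOp ((var i * var j + 1) / (var i * var j - 1))

/-- The quantum Moser matrix, with entries in the algebra of operators on rational functions. -/
def moser (n m : ℕ) (k p q r s : ℂ) :
    Matrix (Idx n m ⊕ Idx n m) (Idx n m ⊕ Idx n m) (Module.End ℂ (RatField (Idx n m))) :=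
  Matrix.fromBlocks (moserA n m k) (moserB n m k p q r s)
    (-moserB n m k p q r s) (-moserA n m k)

/-- The row vector `e^*`: its entries are `k ^ (-p(i))` in both halves. -/
def eStar (n m : ℕ) (k : ℂ) : Idx n m ⊕ Idx n m → ℂ :=
  Sum.elim (fun i => (k ^ parity i)⁻¹) (fun i => (k ^ parity i)⁻¹)

/-- `L_{n,m}^(2l) = e^* L^(2l) e` with `e = (1, …, 1)ᵀ`. -/
def deformedIntegral (n m : ℕ) (k p q r s : ℂ) (l : ℕ) : Module.End ℂ (RatField (Idx n m)) :=
  ∑ a, ∑ b, eStar n m k a • (moser n m k p q r s ^ (2 * l)) a b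

end Deformed

end BCCMS

end

/-!
Write `u_a` for the signed variables `x_i`, `x_i⁻¹`, let `D_a = ± ∂_i` be the derivations attached
to them, and weight the variables by `κ_i ∈ {1, k}`. A matrix `L` with diagonal entries `κ_a D_a`
and off-diagonal entries proportional to `(u_a + u_b) / (u_a - u_b)` is part of a quantum Lax pair:
`[L, H] = [L, M]` for the Schrödinger operator `H` and a matrix `M` with `M e = 0` and `e^* M = 0`.
Hence every `e^* L ^ n e` commutes with `H`. In the region at infinity all coefficients have limits,
and an operator which commutes with `H` and whose limit at infinity is zero vanishes: the leading
monomial of its coefficients would have to be killed by the limit of `ad H`. The commutator of two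
integrals has limit zero, since the limits have constant coefficients, and it commutes with `H` by
the Jacobi identity, so it is zero. For the weights `k ^ p(i)` this is the deformed case.

The operator `D` becomes the Dunkl–Heckman operator under `p_l ↦ ∑ (x_i ^ l + x_i ^ (-l))` because
`Δ` restricts to the sum of the divided differences over the signed variables. On the tuple
of all `φ_a F`, where `φ_a` sends `x` to `u_a`, the operator `D` acts as `L` with all weights `1`,
conjugated by the ground state; so `φ_N` carries `𝓛^(2r)` to an integral `e^* L ^ (2r) e`, and the
specializations of the integrals commute. An element of `Λ̄` killed by all `φ_N` is zero: the
functions `ξ ↦ ξ ^ l + ξ ^ (-l)` are linearly independent, so complex linear combinations of the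
vectors `(ξ ^ l + ξ ^ (-l))_l` take arbitrary values at finitely many generators, and a polynomial
which vanishes on the combinations with natural coefficients vanishes on all of them.
-/

noncomputable section

namespace BCCMS

/-! ### Laurent monomials -/

section Monomials

theorem derivation_ext_isFractionRing {R A K M : Type*} [CommRing R] [CommRing A] [Field K]
    [Algebra A K] [IsFractionRing A K] [Algebra R K] [AddCommGroup M] [Module K M] [Module R M]
    {d d' : Derivation R K M} (h : ∀ a : A, d (algebraMap A K a) = d' (algebraMap A K a)) :
    d = d' := by
  ext f
  obtain ⟨a, b, -, rfl⟩ := IsFractionRing.div_surjective (A := A) f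
  simp only [div_eq_mul_inv, Derivation.leibniz, Derivation.leibniz_inv, h]

variable {ι : Type}

/-- The Laurent monomial `x ^ γ` as a rational function. -/
def xpow (γ : ι →₀ ℤ) : RatField ι :=
  algebraMap (LaurentRing ι) (RatField ι) (AddMonoidAlgebra.single γ 1)

theorem xpow_add (γ δ : ι →₀ ℤ) : xpow (γ + δ) = xpow γ * xpow δ := by
  rw [xpow, xpow, xpow, ← map_mul, AddMonoidAlgebra.single_mul_single, mul_one]

theorem xpow_zero : xpow (0 : ι →₀ ℤ) = 1 := by
  rw [xpow, ← AddMonoidAlgebra.one_def, map_one]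

theorem xpow_mul_xpow_neg (γ : ι →₀ ℤ) : xpow γ * xpow (-γ) = 1 := by
  rw [← xpow_add, add_neg_cancel, xpow_zero]

theorem xpow_ne_zero (γ : ι →₀ ℤ) : xpow γ ≠ 0 :=
  left_ne_zero_of_mul_eq_one (xpow_mul_xpow_neg γ)

theorem xpow_neg (γ : ι →₀ ℤ) : xpow (-γ) = (xpow γ)⁻¹ :=
  eq_inv_of_mul_eq_one_right (xpow_mul_xpow_neg γ)

theorem xpow_injective : Function.Injective (xpow (ι := ι)) :=
  (IsFractionRing.injective (LaurentRing ι) (RatField ι)).comp fun γ δ h => by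
    simpa [Finsupp.single_left_inj one_ne_zero] using congrArg AddMonoidAlgebra.coeff h

theorem var_eq_xpow (i : ι) : var i = xpow (Finsupp.single i 1) := rfl

theorem algebraMap_smul_laurent (c : ℂ) (a : LaurentRing ι) :
    algebraMap (LaurentRing ι) (RatField ι) (c • a) = c • algebraMap _ _ a :=
  map_smul (IsScalarTower.toAlgHom ℂ (LaurentRing ι) (RatField ι)) c a

theorem algebraMap_single (γ : ι →₀ ℤ) (c : ℂ) :
    algebraMap (LaurentRing ι) (RatField ι) (AddMonoidAlgebra.single γ c) = c • xpow γ := by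
  rw [xpow, ← algebraMap_smul_laurent, AddMonoidAlgebra.smul_single, smul_eq_mul, mul_one]

theorem derivation_ext_xpow {M : Type*} [AddCommGroup M] [Module (RatField ι) M] [Module ℂ M]
    {d d' : Derivation ℂ (RatField ι) M} (h : ∀ γ, d (xpow γ) = d' (xpow γ)) : d = d' := by
  refine derivation_ext_isFractionRing (A := LaurentRing ι) fun a => ?_
  induction a using AddMonoidAlgebra.induction_linear with
  | zero => simp
  | add a b ha hb => simp only [map_add, ha, hb]
  | single γ c => rw [algebraMap_single, d.map_smul, d'.map_smul, h]

theorem theta_xpow (i : ι) (γ : ι →₀ ℤ) : theta i (xpow γ) = (γ i : ℂ) • xpow γ := by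
  rw [theta, xpow, ratDeriv_algebraMap]
  change algebraMap _ _ (eulerLin i _) = _
  rw [eulerLin_single, algebraMap_smul_laurent]

theorem theta_comm (i j : ι) (f : RatField ι) : theta i (theta j f) = theta j (theta i f) := by
  have commutator_eq_zero : ⁅theta (ι := ι) i, theta j⁆ = 0 := derivation_ext_xpow fun γ => by
    rw [Derivation.commutator_apply]
    simp only [theta_xpow, Derivation.map_smul, smul_comm (γ j : ℂ), sub_self,
      Derivation.coe_zero, Pi.zero_apply]
  rw [← sub_eq_zero, ← Derivation.commutator_apply, commutator_eq_zero, Derivation.zero_apply]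

end Monomials

/-! ### Signed variables -/

section SignedVariables

theorem derivation_inv_of_eq_smul {R K : Type*} [CommRing R] [Field K] [Algebra R K]
    (d : Derivation R K K) {f : K} {c : R} (h : d f = c • f) : d f⁻¹ = (-c) • f⁻¹ := by
  obtain rfl | hf := eq_or_ne f 0
  · simp
  · rw [Derivation.leibniz_inv, h]
    simp only [smul_eq_mul, Algebra.smul_def, map_neg]
    field_simp

theorem derivation_add_div_sub {K : Type*} [Field K] [Algebra ℂ K] (d : Derivation ℂ K K)
    {f g : K} {α β : ℂ} (hf : d f = α • f) (hg : d g = β • g) (h : f - g ≠ 0) :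
    d ((f + g) / (f - g)) = ((α - β) / 2) • (1 - ((f + g) / (f - g)) ^ 2) := by
  have : CharZero K := charZero_of_injective_algebraMap (algebraMap ℂ K).injective
  rw [Derivation.leibniz_div, map_add, map_sub, hf, hg]
  simp only [smul_eq_mul, Algebra.smul_def, map_sub, map_div₀, map_ofNat]
  field_simp
  ring

theorem sum_swap_ne {α : Type*} (a : α ⊕ α) : a.swap ≠ a := by cases a <;> simp

theorem swap_eq_iff_eq_swap {α : Type*} {a b : α ⊕ α} : a.swap = b ↔ a = b.swap :=
  ⟨fun h => by rw [← h, Sum.swap_swap], fun h => by rw [h, Sum.swap_swap]⟩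

theorem sum_comp_swap {α M : Type*} [Fintype α] [AddCommMonoid M] (f : α ⊕ α → M) :
    ∑ a : α ⊕ α, f a.swap = ∑ a, f a :=
  Equiv.sum_comp (Equiv.sumComm α α) f

variable {ι : Type}

instance : CharZero (RatField ι) :=
  charZero_of_injective_algebraMap (algebraMap ℂ (RatField ι)).injective

/-- The variables `x_i` and their inverses. The second copy of `ι` carries the inverses, so that
`Sum.swap` is the involution `x ↦ x⁻¹`; the elements of `ι ⊕ ι` are called signed indices. -/
def svar : ι ⊕ ι → RatField ι := Sum.elim var fun i => (var i)⁻¹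

/-- The derivations `∂_i` and `-∂_i` attached to the signed indices. -/
def stheta : ι ⊕ ι → Derivation ℂ (RatField ι) (RatField ι) := Sum.elim theta fun i => -theta i

/-- The exponents of the signed variables. -/
def svarExp : ι ⊕ ι → ι →₀ ℤ :=
  Sum.elim (fun i => Finsupp.single i 1) fun i => -Finsupp.single i 1

theorem svar_eq_xpow (a : ι ⊕ ι) : svar a = xpow (svarExp a) := by
  cases a
  · rfl
  · rw [svarExp, Sum.elim_inr, xpow_neg, ← var_eq_xpow]; rfl

theorem svarExp_injective : Function.Injective (svarExp (ι := ι)) := by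
  have single_ne_neg (i j : ι) : Finsupp.single i (1 : ℤ) ≠ -Finsupp.single j 1 := fun h => by
    classical
    have := DFunLike.congr_fun h i
    by_cases hij : j = i <;> simp [hij] at this
  rintro (i | i) (j | j) h
  · simpa [svarExp, Finsupp.single_left_inj] using h
  · exact absurd h (single_ne_neg i j)
  · exact absurd h.symm (single_ne_neg j i)
  · simpa [svarExp, Finsupp.single_left_inj] using h

theorem svarExp_ne_zero (a : ι ⊕ ι) : svarExp a ≠ 0 := by
  cases a <;> simp [svarExp]

theorem svar_injective : Function.Injective (svar (ι := ι)) := fun a b h =>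
  svarExp_injective (xpow_injective (by rwa [← svar_eq_xpow, ← svar_eq_xpow]))

theorem svar_ne_zero (a : ι ⊕ ι) : svar a ≠ 0 := by
  rw [svar_eq_xpow]; exact xpow_ne_zero _

theorem svar_swap (a : ι ⊕ ι) : svar a.swap = (svar a)⁻¹ := by
  cases a <;> simp [svar]

theorem stheta_swap (a : ι ⊕ ι) : stheta a.swap = -stheta a := by
  cases a <;> simp [stheta]

theorem stheta_comm (a b : ι ⊕ ι) (f : RatField ι) :
    stheta a (stheta b f) = stheta b (stheta a f) := by
  cases a <;> cases b <;> simp [stheta, theta_comm]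

theorem svar_sub_ne_zero {a b : ι ⊕ ι} (h : a ≠ b) : svar a - svar b ≠ 0 :=
  sub_ne_zero.2 (svar_injective.ne h)

theorem svar_sub_one_ne_zero (a : ι ⊕ ι) : svar a - 1 ≠ 0 := by
  rw [svar_eq_xpow, ← xpow_zero]
  exact sub_ne_zero.2 (xpow_injective.ne (svarExp_ne_zero a))

theorem svar_mul_sub_one_ne_zero {a b : ι ⊕ ι} (h : a ≠ b.swap) : svar a * svar b - 1 ≠ 0 := by
  have key := mul_ne_zero (svar_sub_ne_zero h) (svar_ne_zero b)
  rwa [svar_swap, sub_mul, inv_mul_cancel₀ (svar_ne_zero b)] at key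

theorem svar_sq_sub_one_ne_zero (a : ι ⊕ ι) : svar a ^ 2 - 1 ≠ 0 := by
  rw [sq]; exact svar_mul_sub_one_ne_zero (sum_swap_ne a).symm

section Pairing

variable [DecidableEq ι]

/-- The weight of `svar b` under `stheta a`: `1` if `b = a`, `-1` if `b` is the inverse of `a`, and
`0` otherwise. -/
def spair (a b : ι ⊕ ι) : ℂ := if b = a then 1 else if b = a.swap then -1 else 0

theorem spair_self (a : ι ⊕ ι) : spair a a = 1 := by simp [spair]

theorem spair_swap_self (a : ι ⊕ ι) : spair a a.swap = -1 := by simp [spair, sum_swap_ne]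

theorem spair_swap_right (a b : ι ⊕ ι) : spair a b.swap = -spair a b := by
  rcases a with a | a <;> rcases b with b | b <;> by_cases h : b = a <;> simp [spair, h]

theorem spair_eq_zero {a b : ι ⊕ ι} (h : b ≠ a) (h' : b ≠ a.swap) : spair a b = 0 := by
  simp [spair, h, h']

theorem sum_spair_smul [Fintype ι] {M : Type*} [AddCommGroup M] [Module ℂ M] (a : ι ⊕ ι)
    (f : ι ⊕ ι → M) : ∑ b, spair a b • f b = f a - f a.swap := by
  have spair_smul (b : ι ⊕ ι) :
      spair a b • f b = (if b = a then f b else 0) - if b = a.swap then f b else 0 := by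
    by_cases h : b = a
    · simp [spair, h, (sum_swap_ne a).symm]
    · by_cases h' : b = a.swap <;> simp [spair, h, h', sum_swap_ne]
  simp only [spair_smul, Finset.sum_sub_distrib, Finset.sum_ite_eq', Finset.mem_univ, if_true]

theorem stheta_svar (a b : ι ⊕ ι) : stheta a (svar b) = spair a b • svar b := by
  have theta_var_smul (i j : ι) : theta i (var j) = (if j = i then (1 : ℂ) else 0) • var j := by
    by_cases h : j = i <;> simp [theta_var, h, Ne.symm]
  have theta_var_inv (i j : ι) :
      theta i (var j)⁻¹ = (-(if j = i then (1 : ℂ) else 0)) • (var j)⁻¹ :=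
    derivation_inv_of_eq_smul _ (theta_var_smul i j)
  rcases a with a | a <;> rcases b with b | b <;>
    simp only [svar, stheta, spair, Sum.elim_inl, Sum.elim_inr, Derivation.neg_apply,
      theta_var_smul, theta_var_inv] <;>
    by_cases h : b = a <;> simp [h]

end Pairing

/-- `(x + y) / (x - y)` for two signed variables, a hyperbolic cotangent in exponential
coordinates. By the convention `z / 0 = 0` it vanishes when they coincide. -/
def coth (a b : ι ⊕ ι) : RatField ι := (svar a + svar b) / (svar a - svar b)

/-- `(x + 1) / (x - 1)` for a signed variable. -/
def cothOne (a : ι ⊕ ι) : RatField ι := (svar a + 1) / (svar a - 1)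

theorem coth_self (a : ι ⊕ ι) : coth a a = 0 := by simp [coth]

theorem coth_comm (a b : ι ⊕ ι) : coth b a = -coth a b := by
  rw [coth, coth, add_comm, ← neg_sub (svar a), div_neg]

theorem coth_swap_right_eq (a b : ι ⊕ ι) :
    coth a b.swap = (svar a * svar b + 1) / (svar a * svar b - 1) := by
  have hb := svar_ne_zero b
  rw [coth, svar_swap, ← mul_div_mul_right _ _ hb, add_mul, sub_mul, inv_mul_cancel₀ hb]

theorem coth_swap_self (a : ι ⊕ ι) : coth a a.swap = (svar a ^ 2 + 1) / (svar a ^ 2 - 1) := by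
  rw [coth_swap_right_eq, sq]

theorem coth_swap_right_comm (a b : ι ⊕ ι) : coth a b.swap = coth b a.swap := by
  rw [coth_swap_right_eq, coth_swap_right_eq, mul_comm]

theorem coth_swap_left (a b : ι ⊕ ι) : coth a.swap b = -coth a b.swap := by
  rw [coth_comm, coth_swap_right_comm]

theorem coth_swap_swap (a b : ι ⊕ ι) : coth a.swap b.swap = -coth a b := by
  rw [coth_swap_left, Sum.swap_swap]

theorem cothOne_swap (a : ι ⊕ ι) : cothOne a.swap = -cothOne a := by
  have ha := svar_ne_zero a
  rw [cothOne, cothOne, svar_swap, ← mul_div_mul_right _ _ ha, add_mul, sub_mul, inv_mul_cancel₀ ha,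
    one_mul, ← neg_sub (svar a), div_neg, add_comm]

theorem coth_addition_formula {a b c : ι ⊕ ι} (hab : a ≠ b) (hac : a ≠ c) (hcb : c ≠ b) :
    coth a b * (coth a c + coth c b) = coth a c * coth c b + 1 := by
  have := svar_sub_ne_zero hab
  have := svar_sub_ne_zero hac
  have := svar_sub_ne_zero hcb
  rw [coth, coth, coth]
  field_simp
  ring

theorem coth_duplication_formula (a : ι ⊕ ι) :
    2 * cothOne a * coth a a.swap = 1 + cothOne a ^ 2 := by
  have := svar_sub_one_ne_zero a
  have := svar_sq_sub_one_ne_zero a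
  rw [coth_swap_self, cothOne]
  field_simp
  ring

theorem cothOne_addition_formula {a b : ι ⊕ ι} (h : a ≠ b) (h' : a ≠ b.swap) :
    cothOne a * (coth a b.swap + coth a b) + cothOne b * (coth a b.swap - coth a b) = 2 := by
  have := svar_sub_ne_zero h
  have := svar_mul_sub_one_ne_zero h'
  have := svar_sub_one_ne_zero a
  have := svar_sub_one_ne_zero b
  rw [coth_swap_right_eq, coth, cothOne, cothOne]
  field_simp
  ring

variable [DecidableEq ι]

theorem stheta_coth (c : ι ⊕ ι) {a b : ι ⊕ ι} (h : a ≠ b) :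
    stheta c (coth a b) = ((spair c a - spair c b) / 2) • (1 - coth a b ^ 2) :=
  derivation_add_div_sub _ (stheta_svar c a) (stheta_svar c b) (svar_sub_ne_zero h)

theorem stheta_cothOne (c a : ι ⊕ ι) :
    stheta c (cothOne a) = (spair c a / 2) • (1 - cothOne a ^ 2) := by
  have hone : stheta c (1 : RatField ι) = (0 : ℂ) • 1 := by simp
  have key := derivation_add_div_sub _ (stheta_svar c a) hone (svar_sub_one_ne_zero a)
  rwa [sub_zero] at key

end SignedVariables

/-! ### The entries of the Lax pair -/

section LaxFunctions

variable {ι : Type}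

local notation "𝔠" => algebraMap ℂ (RatField ι)

theorem derivation_algebraMap_mul {R A : Type*} [CommSemiring R] [CommSemiring A] [Algebra R A]
    (d : Derivation R A A) (c : R) (f : A) : d (algebraMap R A c * f) = algebraMap R A c * d f := by
  rw [← Algebra.smul_def, Derivation.map_smul, Algebra.smul_def]

theorem derivation_one_sub_sq {R A : Type*} [CommSemiring R] [CommRing A] [Algebra R A]
    (d : Derivation R A A) (f : A) : d (1 - f ^ 2) = -(2 * f * d f) := by
  rw [map_sub, Derivation.map_one_eq_zero, Derivation.leibniz_pow]
  simp only [smul_eq_mul, nsmul_eq_mul]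
  push_cast
  ring

/-- The weight of a signed index: both signs of an index have the same weight. -/
def sweight (κ : ι → ℂ) : ι ⊕ ι → ℂ := Sum.elim κ κ

theorem sweight_swap (κ : ι → ℂ) (a : ι ⊕ ι) : sweight κ a.swap = sweight κ a := by
  cases a <;> rfl

/-- Admissible weights of the deformed root system: every `κ i` is `1` (an undeformed variable) or
`k` (a deformed one), and none vanishes. -/
structure IsWeight (k : ℂ) (κ : ι → ℂ) : Prop where
  eq_or : ∀ i, κ i = 1 ∨ κ i = k
  ne_zero : ∀ i, κ i ≠ 0

theorem IsWeight.sweight_eq_or {k : ℂ} {κ : ι → ℂ} (h : IsWeight k κ) (a : ι ⊕ ι) :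
    sweight κ a = 1 ∨ sweight κ a = k := by
  cases a <;> exact h.eq_or _

theorem IsWeight.sweight_ne_zero {k : ℂ} {κ : ι → ℂ} (h : IsWeight k κ) (a : ι ⊕ ι) :
    sweight κ a ≠ 0 := by
  cases a <;> exact h.ne_zero _

theorem IsWeight.div_sub_div {k : ℂ} {κ : ι → ℂ} (h : IsWeight k κ) (a b : ι ⊕ ι) :
    k / (2 * sweight κ b) - k / (2 * sweight κ a) = (sweight κ a - sweight κ b) / 2 := by
  have ha := h.sweight_ne_zero a
  have hb := h.sweight_ne_zero b
  field_simp
  rcases h.sweight_eq_or a with ha' | ha' <;> rcases h.sweight_eq_or b with hb' | hb' <;>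
    rw [ha', hb'] <;> ring

theorem IsWeight.pair_coupling_comm {k : ℂ} {κ : ι → ℂ} (h : IsWeight k κ) (a b : ι ⊕ ι) :
    k / (2 * sweight κ a) * (1 + k / sweight κ b ^ 2) =
      k / (2 * sweight κ b) * (1 + k / sweight κ a ^ 2) := by
  have ha := h.sweight_ne_zero a
  have hb := h.sweight_ne_zero b
  field_simp
  rcases h.sweight_eq_or a with ha' | ha' <;> rcases h.sweight_eq_or b with hb' | hb' <;>
    rw [ha', hb'] <;> ring

section Univariate

variable [DecidableEq ι]

theorem sum_weight_mul_spair_sq [Fintype ι] (κ : ι → ℂ) (a : ι ⊕ ι) :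
    ∑ i, κ i * spair (Sum.inl i) a ^ 2 = sweight κ a := by
  rcases a with a | a <;> simp [spair, sweight, apply_ite (fun z : ℂ => z ^ 2)]

theorem spair_mul_spair_eq_zero {a b : ι ⊕ ι} (h : b ≠ a) (h' : b ≠ a.swap) (c : ι ⊕ ι) :
    spair c a * spair c b = 0 := by
  by_cases hac : a = c
  · subst hac
    rw [spair_eq_zero h h', mul_zero]
  by_cases hac' : a = c.swap
  · subst hac'
    rw [spair_eq_zero (by rwa [Sum.swap_swap] at h') h, mul_zero]
  · rw [spair_eq_zero hac hac', zero_mul]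

theorem sum_weight_mul_spair_sub_sq [Fintype ι] (κ : ι → ℂ) {a b : ι ⊕ ι} (h : b ≠ a)
    (h' : b ≠ a.swap) :
    ∑ i, κ i * (spair (Sum.inl i) a - spair (Sum.inl i) b) ^ 2 = sweight κ a + sweight κ b := by
  rw [← sum_weight_mul_spair_sq κ a, ← sum_weight_mul_spair_sq κ b, ← Finset.sum_add_distrib]
  refine Finset.sum_congr rfl fun i _ => ?_
  linear_combination (-2 * κ i) * spair_mul_spair_eq_zero h h' (Sum.inl i)

theorem sum_weight_mul_spair_sub_swap_sq [Fintype ι] (κ : ι → ℂ) (a : ι ⊕ ι) :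
    ∑ i, κ i * (spair (Sum.inl i) a - spair (Sum.inl i) a.swap) ^ 2 = 4 * sweight κ a := by
  rw [← sum_weight_mul_spair_sq, Finset.mul_sum]
  refine Finset.sum_congr rfl fun i _ => ?_
  rw [spair_swap_right]; ring

/-- `f` is a function of the signed variable `svar a` alone, expressed through its derivatives. -/
def IsFunctionOf (a : ι ⊕ ι) (f : RatField ι) : Prop :=
  ∀ c, stheta c f = spair c a • stheta a f

namespace IsFunctionOf

variable {a : ι ⊕ ι} {f g : RatField ι}

theorem add (hf : IsFunctionOf a f) (hg : IsFunctionOf a g) : IsFunctionOf a (f + g) := fun c => by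
  rw [map_add, map_add, hf c, hg c, smul_add]

theorem sub (hf : IsFunctionOf a f) (hg : IsFunctionOf a g) : IsFunctionOf a (f - g) := fun c => by
  rw [map_sub, map_sub, hf c, hg c, smul_sub]

theorem mul (hf : IsFunctionOf a f) (hg : IsFunctionOf a g) : IsFunctionOf a (f * g) := fun c => by
  rw [Derivation.leibniz, Derivation.leibniz, hf c, hg c, smul_add, smul_comm f, smul_comm g]

theorem algebraMap_mul (z : ℂ) (hf : IsFunctionOf a f) : IsFunctionOf a (𝔠 z * f) := fun c => by
  rw [← Algebra.smul_def, Derivation.map_smul, Derivation.map_smul, hf c, smul_comm]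

theorem stheta (hf : IsFunctionOf a f) : IsFunctionOf a (stheta a f) := fun c => by
  rw [stheta_comm, hf c, Derivation.map_smul]

end IsFunctionOf

theorem isFunctionOf_cothOne (a : ι ⊕ ι) : IsFunctionOf a (cothOne a) := fun c => by
  rw [stheta_cothOne, stheta_cothOne, spair_self, smul_smul, mul_one_div]

theorem isFunctionOf_coth_swap (a : ι ⊕ ι) : IsFunctionOf a (coth a a.swap) := fun c => by
  rw [stheta_coth c (sum_swap_ne a).symm, stheta_coth a (sum_swap_ne a).symm, spair_swap_right,
    spair_swap_right, spair_self, smul_smul]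
  congr 1
  ring

end Univariate

/-- The entry of the Lax matrix at the pair of opposite signed indices `a` and `a.swap`. -/
def laxZ (p q : ℂ) (κ : ι → ℂ) (a : ι ⊕ ι) : RatField ι :=
  𝔠 (p / 2) * cothOne a + 𝔠 (q + (1 - sweight κ a) / 2) * coth a a.swap

/-- The derivative of `laxZ` in its own variable. -/
def laxZDeriv (p q : ℂ) (κ : ι → ℂ) (a : ι ⊕ ι) : RatField ι := stheta a (laxZ p q κ a)

/-- The potential of a single signed variable in the Schrödinger operator. -/
def laxS (p q : ℂ) (κ : ι → ℂ) (a : ι ⊕ ι) : RatField ι :=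
  𝔠 (sweight κ a)⁻¹ * laxZ p q κ a ^ 2 - laxZDeriv p q κ a

variable {k p q : ℂ} {κ : ι → ℂ}

theorem laxZ_swap (a : ι ⊕ ι) : laxZ p q κ a.swap = -laxZ p q κ a := by
  rw [laxZ, laxZ, cothOne_swap, coth_swap_swap, sweight_swap]; ring

theorem laxZDeriv_swap (a : ι ⊕ ι) : laxZDeriv p q κ a.swap = laxZDeriv p q κ a := by
  rw [laxZDeriv, laxZDeriv, laxZ_swap, stheta_swap, Derivation.neg_apply, map_neg, neg_neg]

theorem laxS_swap (a : ι ⊕ ι) : laxS p q κ a.swap = laxS p q κ a := by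
  rw [laxS, laxS, laxZ_swap, laxZDeriv_swap, sweight_swap, neg_sq]

theorem laxZDeriv_eq (p q : ℂ) (κ : ι → ℂ) (a : ι ⊕ ι) :
    laxZDeriv p q κ a = 𝔠 (p / 2) * ((1 - cothOne a ^ 2) / 2)
      + 𝔠 (q + (1 - sweight κ a) / 2) * (1 - coth a a.swap ^ 2) := by
  classical
  rw [laxZDeriv, laxZ, map_add, derivation_algebraMap_mul, derivation_algebraMap_mul,
    stheta_cothOne, stheta_coth _ (sum_swap_ne a).symm, spair_swap_right, spair_self]
  simp only [Algebra.smul_def, map_div₀, map_ofNat, map_sub, map_neg, map_one]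
  ring

theorem stheta_laxS (a : ι ⊕ ι) :
    stheta a (laxS p q κ a) = 𝔠 (sweight κ a)⁻¹ * (2 * laxZ p q κ a * laxZDeriv p q κ a)
      - stheta a (laxZDeriv p q κ a) := by
  rw [laxS, map_sub, derivation_algebraMap_mul, Derivation.leibniz_pow, ← laxZDeriv]
  simp only [smul_eq_mul, nsmul_eq_mul]
  push_cast
  ring

variable [DecidableEq ι]

theorem isFunctionOf_laxZ (a : ι ⊕ ι) : IsFunctionOf a (laxZ p q κ a) :=
  ((isFunctionOf_cothOne a).algebraMap_mul _).add ((isFunctionOf_coth_swap a).algebraMap_mul _)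

theorem isFunctionOf_laxS (a : ι ⊕ ι) : IsFunctionOf a (laxS p q κ a) := by
  rw [laxS, sq]
  exact (((isFunctionOf_laxZ a).mul (isFunctionOf_laxZ a)).algebraMap_mul _).sub
    (isFunctionOf_laxZ a).stheta

theorem stheta_one_sub_coth_sq (c : ι ⊕ ι) {a b : ι ⊕ ι} (h : a ≠ b) :
    stheta c (1 - coth a b ^ 2) =
      -((spair c a - spair c b) • (coth a b * (1 - coth a b ^ 2))) := by
  rw [derivation_one_sub_sq, stheta_coth c h]
  simp only [Algebra.smul_def, map_div₀, map_ofNat, map_sub]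
  ring

variable (k p q κ)

/-- The functional part of the Lax matrix. -/
def laxX (a b : ι ⊕ ι) : RatField ι :=
  if b = a then 0 else if b = a.swap then laxZ p q κ a else 𝔠 (k / (2 * sweight κ b)) * coth a b

/-- The off-diagonal entries of the second matrix of the Lax pair. -/
def laxM (a b : ι ⊕ ι) : RatField ι :=
  if b = a then 0 else if b = a.swap then -laxZDeriv p q κ a
  else 𝔠 (k / (2 * sweight κ b)) * (coth a b ^ 2 - 1)

/-- The derivative of `laxM` along the difference of its two indices. -/
def laxMDeriv (a b : ι ⊕ ι) : RatField ι :=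
  if b = a then 0 else if b = a.swap then -((1 / 2 : ℂ) • stheta a (laxZDeriv p q κ a))
  else 𝔠 (k / (2 * sweight κ b)) * (coth a b * (1 - coth a b ^ 2))

variable {k p q κ}

theorem stheta_laxX (c a b : ι ⊕ ι) :
    stheta c (laxX k p q κ a b) = -((spair c a - spair c b) / 2) • laxM k p q κ a b := by
  unfold laxX laxM
  split_ifs with h h'
  · simp
  · rw [isFunctionOf_laxZ a c, laxZDeriv, h', spair_swap_right, smul_neg, ← neg_smul]
    congr 1
    ring
  · rw [derivation_algebraMap_mul, stheta_coth c (Ne.symm h)]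
    simp only [Algebra.smul_def, map_neg]
    ring

theorem stheta_laxM (c a b : ι ⊕ ι) :
    stheta c (laxM k p q κ a b) = (spair c a - spair c b) • laxMDeriv k p q κ a b := by
  unfold laxM laxMDeriv
  split_ifs with h h'
  · simp
  · rw [map_neg, laxZDeriv, (isFunctionOf_laxZ a).stheta c, h', spair_swap_right, smul_neg,
      smul_smul]
    congr 2
    ring
  · rw [derivation_algebraMap_mul, ← neg_sub, map_neg, stheta_one_sub_coth_sq c (Ne.symm h)]
    simp only [Algebra.smul_def]
    ring

/-! ### The functional equations behind the Lax equation -/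

variable (k p q κ) in
/-- The summand with index `c` of the functional part of the `(a, b)` entry of the commutator of
the Lax pair. -/
def laxBracket (a b c : ι ⊕ ι) : RatField ι :=
  laxX k p q κ a c * laxM k p q κ c b - laxM k p q κ a c * laxX k p q κ c b
    + laxX k p q κ a b * (laxM k p q κ a c - laxM k p q κ b c)

theorem laxBracket_eq_zero {a b c : ι ⊕ ι} (hb : b ≠ a) (hb' : b ≠ a.swap) (hca : c ≠ a)
    (hca' : c ≠ a.swap) (hcb : c ≠ b) (hcb' : c ≠ b.swap) : laxBracket k p q κ a b c = 0 := by
  have hbc' : b ≠ c.swap := fun e => hcb' (swap_eq_iff_eq_swap.1 e.symm)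
  simp only [laxBracket, laxX, laxM, hb, hb', hca, hca', hcb, hcb', hcb.symm, hbc', if_false]
  have addition := coth_addition_formula hb.symm hca.symm hcb
  rw [coth_comm c b] at *
  linear_combination (𝔠 (k / (2 * sweight κ b)) * 𝔠 (k / (2 * sweight κ c))) *
    (coth a c - coth c b) * addition

theorem laxBracket_self_add (h : IsWeight k κ) {a b : ι ⊕ ι} (hb : b ≠ a) (hb' : b ≠ a.swap) :
    laxBracket k p q κ a b a + laxBracket k p q κ a b b =
      𝔠 ((sweight κ b - sweight κ a) / 2 * (k / (2 * sweight κ b))) *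
        (coth a b * (1 - coth a b ^ 2)) := by
  have ha' : a ≠ b.swap := fun e => hb' (swap_eq_iff_eq_swap.1 e.symm)
  simp only [laxBracket, laxX, laxM, hb, hb', hb.symm, ha', if_false, if_true]
  have weights := congrArg 𝔠 (h.div_sub_div a b)
  rw [map_sub] at weights
  rw [coth_comm a b, map_mul, ← neg_sub (sweight κ a), neg_div, map_neg]
  linear_combination (𝔠 (k / (2 * sweight κ b))) * (coth a b ^ 3 - coth a b) * weights

theorem laxBracket_swap_add (h : IsWeight k κ) {a b : ι ⊕ ι} (hb : b ≠ a) (hb' : b ≠ a.swap) :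
    laxBracket k p q κ a b a.swap + laxBracket k p q κ a b b.swap = 0 := by
  have ha' : a ≠ b.swap := fun e => hb' (swap_eq_iff_eq_swap.1 e.symm)
  have hab : a.swap ≠ b.swap := fun e => hb (Sum.swap_leftInverse.injective e).symm
  simp only [laxBracket, laxX, laxM, hb, hb', hb'.symm, ha'.symm, hab, hab.symm, sum_swap_ne,
    Sum.swap_swap, if_false, if_true, (sum_swap_ne b).symm, laxZ_swap, laxZDeriv_swap, sweight_swap]
  rw [coth_swap_left a b, coth_swap_right_comm b a, laxZ, laxZ, laxZDeriv_eq, laxZDeriv_eq]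
  have weights := congrArg 𝔠 (h.div_sub_div a b)
  have addition_a := coth_addition_formula (sum_swap_ne a).symm hb.symm hb'
  have addition_b := coth_addition_formula (sum_swap_ne b).symm hb ha'
  rw [coth_swap_right_comm b a] at addition_a
  rw [coth_comm a b] at addition_b
  simp only [map_add, map_sub, map_one, map_div₀ _ (_ - _ : ℂ), map_ofNat] at weights ⊢
  linear_combination 𝔠 (k / (2 * sweight κ b)) * (𝔠 (p / 2) * (
        coth a b.swap * cothOne_addition_formula hb.symm ha'
      + cothOne a * addition_a + cothOne b * addition_b
      - 1 / 2 * (coth a b.swap + coth a b) * coth_duplication_formula a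
      - 1 / 2 * (coth a b.swap - coth a b) * coth_duplication_formula b)
    + (𝔠 q + (1 - 𝔠 (sweight κ a)) / 2) * (coth a b.swap + coth a a.swap) * addition_a
    + (𝔠 q + (1 - 𝔠 (sweight κ b)) / 2) * (coth a b.swap + coth b b.swap) * addition_b
    + coth a b * (coth a b.swap ^ 2 - 1) * weights)

theorem sum_laxBracket [Fintype ι] (h : IsWeight k κ) {a b : ι ⊕ ι} (hb : b ≠ a)
    (hb' : b ≠ a.swap) :
    ∑ c, laxBracket k p q κ a b c =
      𝔠 ((sweight κ b - sweight κ a) / 2 * (k / (2 * sweight κ b))) *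
        (coth a b * (1 - coth a b ^ 2)) := by
  have ha' : a ≠ b.swap := fun e => hb' (swap_eq_iff_eq_swap.1 e.symm)
  have hab : a.swap ≠ b.swap := fun e => hb (Sum.swap_leftInverse.injective e).symm
  rw [← Finset.sum_subset (Finset.subset_univ {a, b, a.swap, b.swap})]
  · rw [Finset.sum_insert (by simp [hb.symm, ha', (sum_swap_ne a).symm]),
      Finset.sum_insert (by simp [hb', (sum_swap_ne b).symm]), Finset.sum_pair hab, ← add_assoc,
      laxBracket_self_add h hb hb', laxBracket_swap_add h hb hb', add_zero]
  · intro c _ hc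
    simp only [Finset.mem_insert, Finset.mem_singleton, not_or] at hc
    exact laxBracket_eq_zero hb hb' hc.1 hc.2.2.1 hc.2.1 hc.2.2.2

theorem laxBracket_swap_swap (a c : ι ⊕ ι) :
    laxBracket k p q κ a a.swap c.swap = -laxBracket k p q κ a a.swap c := by
  by_cases hca : c = a
  · subst hca
    simp only [laxBracket, laxX, laxM, Sum.swap_swap, if_true, sum_swap_ne, (sum_swap_ne c).symm,
      if_false, laxZ_swap, laxZDeriv_swap]
    ring
  by_cases hca' : c = a.swap
  · subst hca'
    simp only [laxBracket, laxX, laxM, Sum.swap_swap, if_true, sum_swap_ne, (sum_swap_ne a).symm,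
      if_false, laxZ_swap, laxZDeriv_swap]
    ring
  have hac' : a ≠ c.swap := fun e => hca' (swap_eq_iff_eq_swap.1 e.symm)
  have hac : a.swap ≠ c.swap := fun e => hca (Sum.swap_leftInverse.injective e).symm
  simp only [laxBracket, laxX, laxM, sum_swap_ne, Sum.swap_swap, if_true, if_false, sweight_swap,
    hca, hca', hac'.symm, hac.symm, Ne.symm hca', hac, coth_swap_left c, coth_comm a c,
    coth_swap_left a, coth_swap_right_comm c a]
  ring

theorem sum_laxBracket_swap [Fintype ι] (a : ι ⊕ ι) : ∑ c, laxBracket k p q κ a a.swap c = 0 := by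
  have odd := sum_comp_swap (laxBracket k p q κ a a.swap)
  simp only [laxBracket_swap_swap, Finset.sum_neg_distrib] at odd
  exact self_eq_neg.1 odd.symm

theorem lax_off_diagonal [Fintype ι] (h : IsWeight k κ) {a b : ι ⊕ ι} (hb : b ≠ a) :
    𝔠 ((∑ i, κ i * (spair (Sum.inl i) a - spair (Sum.inl i) b) ^ 2) / 2) * laxMDeriv k p q κ a b =
      𝔠 (sweight κ a) * stheta a (laxM k p q κ a b) + ∑ c, laxBracket k p q κ a b c := by
  by_cases hb' : b = a.swap
  · subst hb'
    rw [sum_laxBracket_swap, sum_weight_mul_spair_sub_swap_sq, stheta_laxM, spair_swap_right,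
      spair_self, Algebra.smul_def]
    simp only [map_div₀, map_mul, map_ofNat, sub_neg_eq_add, map_add, map_one]
    ring
  · rw [sum_laxBracket h hb hb', sum_weight_mul_spair_sub_sq κ hb hb', stheta_laxM, spair_self,
      spair_eq_zero hb hb', laxMDeriv, if_neg hb, if_neg hb', Algebra.smul_def]
    simp only [map_div₀, map_mul, map_ofNat, map_sub, map_add, map_one, map_zero]
    ring

variable (k κ) in
/-- The potential of a pair of signed variables in the Schrödinger operator. -/
def laxW (a c : ι ⊕ ι) : RatField ι :=
  if c = a then 0 else if c = a.swap then 0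
  else 𝔠 (k / (2 * sweight κ c) * (1 + k / sweight κ a ^ 2)) * (coth a c ^ 2 - 1)

variable (k κ) in
/-- The derivative of `laxW` along the difference of its two indices. -/
def laxWDeriv (a c : ι ⊕ ι) : RatField ι :=
  if c = a then 0 else if c = a.swap then 0
  else 𝔠 (k / (2 * sweight κ c) * (1 + k / sweight κ a ^ 2)) * (coth a c * (1 - coth a c ^ 2))

variable (k p q κ) in
/-- The potential of the Schrödinger operator. The factors compensate for every variable occurring
with both signs. -/
def laxV [Fintype ι] : RatField ι :=
  𝔠 (1 / 4) * ∑ a, ∑ c, laxW k κ a c + 𝔠 (1 / 2) * ∑ a, laxS p q κ a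

theorem stheta_laxW (c a b : ι ⊕ ι) :
    stheta c (laxW k κ a b) = (spair c a - spair c b) • laxWDeriv k κ a b := by
  unfold laxW laxWDeriv
  split_ifs with h h'
  · simp
  · simp
  · rw [derivation_algebraMap_mul, ← neg_sub, map_neg, stheta_one_sub_coth_sq c (Ne.symm h)]
    simp only [Algebra.smul_def]
    ring

theorem laxW_swap_swap (a c : ι ⊕ ι) : laxW k κ a.swap c.swap = laxW k κ a c := by
  simp only [laxW, Sum.swap_leftInverse.injective.eq_iff, Sum.swap_swap, swap_eq_iff_eq_swap,
    sweight_swap, coth_swap_swap, neg_sq]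

theorem laxWDeriv_swap_swap (a c : ι ⊕ ι) :
    laxWDeriv k κ a.swap c.swap = -laxWDeriv k κ a c := by
  simp only [laxWDeriv, Sum.swap_leftInverse.injective.eq_iff, Sum.swap_swap, swap_eq_iff_eq_swap,
    sweight_swap, coth_swap_swap, neg_sq]
  split_ifs <;> ring

theorem laxWDeriv_comm (h : IsWeight k κ) (a c : ι ⊕ ι) :
    laxWDeriv k κ c a = -laxWDeriv k κ a c := by
  have swap_iff : a = c.swap ↔ c = a.swap := by rw [← swap_eq_iff_eq_swap, eq_comm]
  simp only [laxWDeriv, @eq_comm _ a c, swap_iff, coth_comm a c, neg_sq, h.pair_coupling_comm a c]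
  split_ifs <;> ring

theorem lax_diagonal_summand (h : IsWeight k κ) (a c : ι ⊕ ι) :
    laxX k p q κ a c * laxM k p q κ c a - laxM k p q κ a c * laxX k p q κ c a
        - 𝔠 (sweight κ a) * stheta a (laxM k p q κ a c) =
      -(𝔠 (sweight κ a) * (laxWDeriv k κ a c
        + if c = a.swap then stheta a (laxS p q κ a) else 0)) := by
  have weight_ne_zero : 𝔠 (sweight κ a) ≠ 0 := by simpa using h.sweight_ne_zero a
  rw [stheta_laxM, spair_self]
  by_cases hca : c = a
  · subst hca; simp [laxX, laxM, laxMDeriv, laxWDeriv, (sum_swap_ne c).symm]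
  by_cases hca' : c = a.swap
  · subst hca'
    simp only [laxX, laxM, laxMDeriv, laxWDeriv, if_neg (sum_swap_ne a),
      if_neg (sum_swap_ne a).symm, if_true, Sum.swap_swap, laxZ_swap, laxZDeriv_swap, stheta_laxS,
      spair_swap_self, Algebra.smul_def, map_inv₀, map_sub, map_neg, map_div₀, map_one, map_ofNat]
    field_simp
    ring
  · have hac' : a ≠ c.swap := fun e => hca' (swap_eq_iff_eq_swap.1 e.symm)
    simp only [laxX, laxM, laxMDeriv, laxWDeriv, if_neg hca, if_neg (Ne.symm hca), if_neg hca',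
      if_neg hac', spair_eq_zero hca hca', sub_zero, one_smul, coth_comm a c, map_mul, map_div₀,
      map_add, map_pow, map_one, map_ofNat]
    field_simp
    ring

variable [Fintype ι]

theorem sum_sum_stheta_laxW (h : IsWeight k κ) (l : ι ⊕ ι) :
    ∑ a, ∑ c, stheta l (laxW k κ a c) = 4 * ∑ c, laxWDeriv k κ l c := by
  have swap_left : ∑ c, laxWDeriv k κ l.swap c = -∑ c, laxWDeriv k κ l c := by
    rw [← sum_comp_swap]
    simp only [laxWDeriv_swap_swap, Finset.sum_neg_distrib]
  have first_index : ∑ a, ∑ c, spair l a • laxWDeriv k κ a c = 2 * ∑ c, laxWDeriv k κ l c := by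
    simp only [← Finset.smul_sum]
    rw [sum_spair_smul, swap_left]
    ring
  have second_index : ∑ a, ∑ c, spair l c • laxWDeriv k κ a c = -(2 * ∑ c, laxWDeriv k κ l c) := by
    rw [Finset.sum_comm, ← first_index]
    simp only [← Finset.sum_neg_distrib, ← smul_neg, ← laxWDeriv_comm h]
  simp only [stheta_laxW, sub_smul, Finset.sum_sub_distrib, first_index, second_index]
  ring

theorem stheta_laxV (h : IsWeight k κ) (l : ι ⊕ ι) :
    stheta l (laxV k p q κ) = ∑ c, laxWDeriv k κ l c + stheta l (laxS p q κ l) := by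
  have single : ∑ a, stheta l (laxS p q κ a) = 2 * stheta l (laxS p q κ l) := by
    rw [Finset.sum_congr rfl fun a _ => isFunctionOf_laxS a l, sum_spair_smul, laxS_swap,
      stheta_swap, Derivation.neg_apply]
    ring
  rw [laxV, map_add, derivation_algebraMap_mul, derivation_algebraMap_mul, map_sum, map_sum, single]
  simp only [map_sum, sum_sum_stheta_laxW h, map_div₀, map_one, map_ofNat]
  ring

theorem lax_diagonal (h : IsWeight k κ) (a : ι ⊕ ι) :
    ∑ c, (laxX k p q κ a c * laxM k p q κ c a - laxM k p q κ a c * laxX k p q κ c a)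
      - 𝔠 (sweight κ a) * ∑ c, stheta a (laxM k p q κ a c) =
      -(𝔠 (sweight κ a) * stheta a (laxV k p q κ)) := by
  rw [stheta_laxV h, Finset.mul_sum, ← Finset.sum_sub_distrib,
    Finset.sum_congr rfl fun c _ => lax_diagonal_summand h a c, Finset.sum_neg_distrib,
    ← Finset.mul_sum, Finset.sum_add_distrib, Finset.sum_ite_eq', if_pos (Finset.mem_univ _)]

end LaxFunctions

/-! ### The Lax equation -/

section LaxPair

theorem pow_commutator_eq {A : Type*} [Ring A] {x y z : A} (h : x * y - y * x = x * z - z * x)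
    (n : ℕ) : x ^ n * y - y * x ^ n = x ^ n * z - z * x ^ n := by
  have commute : Commute x (y - z) := by
    rw [Commute, SemiconjBy, mul_sub, sub_mul, sub_eq_sub_iff_sub_eq_sub]
    exact h
  have commute_pow := (commute.pow_left n).eq
  rwa [mul_sub, sub_mul, sub_eq_sub_iff_sub_eq_sub] at commute_pow

theorem sum_mul_apply_of_row_sum_eq_zero {α A : Type*} [Fintype α] [NonUnitalNonAssocSemiring A]
    {M : Matrix α α A} (hM : ∀ a, ∑ b, M a b = 0) (L : Matrix α α A) (a : α) :
    ∑ b, (L * M) a b = 0 := by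
  simp only [Matrix.mul_apply]
  rw [Finset.sum_comm]
  simp only [← Finset.mul_sum, hM, mul_zero, Finset.sum_const_zero]

theorem sum_smul_mul_apply_of_column_sum_eq_zero {α 𝕜 A : Type*} [Fintype α]
    [NonUnitalNonAssocSemiring A] [DistribSMul 𝕜 A] [IsScalarTower 𝕜 A A] {w : α → 𝕜}
    {M : Matrix α α A} (hM : ∀ b, ∑ a, w a • M a b = 0) (L : Matrix α α A) (b : α) :
    ∑ a, w a • (M * L) a b = 0 := by
  simp only [Matrix.mul_apply, Finset.smul_sum]
  rw [Finset.sum_comm]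
  simp only [← smul_mul_assoc, ← Finset.sum_mul, hM, zero_mul, Finset.sum_const_zero]

variable {ι : Type} {R : Type} [Ring R]

/-- The operators attached to signed indices. -/
def signedOp (D : ι → R) : ι ⊕ ι → R := Sum.elim D fun i => -D i

theorem signedOp_mul_comm {D : ι → R} (hD : ∀ i j, D i * D j = D j * D i) (a : ι ⊕ ι) (i : ι) :
    signedOp D a * D i = D i * signedOp D a := by
  rcases a with a | a <;> simp [signedOp, hD a i]

variable [Algebra ℂ R]

/-- Operators `D i` which commute with each other and satisfy the Leibniz rule with respect to a
representation `m` of the rational functions. -/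
structure IsConnection (m : RatField ι →ₐ[ℂ] R) (D : ι → R) : Prop where
  comm : ∀ i j, D i * D j = D j * D i
  leibniz : ∀ i f, D i * m f = m f * D i + m (theta i f)

namespace IsConnection

variable {m : RatField ι →ₐ[ℂ] R} {D : ι → R}

theorem signed_leibniz (hD : IsConnection m D) (a : ι ⊕ ι) (f : RatField ι) :
    signedOp D a * m f = m f * signedOp D a + m (stheta a f) := by
  rcases a with a | a
  · exact hD.leibniz a f
  · simp only [signedOp, stheta, Sum.elim_inr, neg_mul, hD.leibniz, mul_neg, Derivation.neg_apply,
      map_neg]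
    abel

theorem mul_sq_sub_sq_mul (hD : IsConnection m D) (i : ι) (f : RatField ι) :
    m f * D i ^ 2 - D i ^ 2 * m f = -(2 * m (theta i f) * D i + m (theta i (theta i f))) := by
  rw [sq, mul_assoc (D i), hD.leibniz, mul_add, ← mul_assoc (D i), hD.leibniz, hD.leibniz]
  noncomm_ring

theorem semiconjBy_xpow (hD : IsConnection m D) (γ : ι →₀ ℤ) (i : ι) :
    SemiconjBy (m (xpow γ)) (D i + algebraMap ℂ R (γ i)) (D i) := by
  rw [SemiconjBy, hD.leibniz, theta_xpow, map_smul, mul_add, ← Algebra.commutes, Algebra.smul_def]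

end IsConnection

variable [DecidableEq ι] (m : RatField ι →ₐ[ℂ] R) (D : ι → R) (k p q : ℂ) (κ : ι → ℂ)

/-- The first matrix of the Lax pair. -/
def laxL : Matrix (ι ⊕ ι) (ι ⊕ ι) R := Matrix.of fun a b =>
  (if a = b then sweight κ a • signedOp D a else 0) + m (laxX k p q κ a b)

variable {m D k p q κ}

theorem inv_sweight_smul_laxM_comm (a b : ι ⊕ ι) :
    (sweight κ a)⁻¹ • laxM k p q κ a b = (sweight κ b)⁻¹ • laxM k p q κ b a := by
  have eq_swap_comm : a = b.swap ↔ b = a.swap := by rw [← swap_eq_iff_eq_swap, eq_comm]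
  simp only [laxM, @eq_comm _ a b, eq_swap_comm]
  split_ifs with same opposite
  · simp only [smul_zero]
  · rw [opposite, sweight_swap, laxZDeriv_swap]
  · rw [coth_comm a b, neg_sq, ← Algebra.smul_def, ← Algebra.smul_def, smul_smul, smul_smul]
    congr 1
    rw [div_eq_mul_inv, div_eq_mul_inv, mul_inv, mul_inv]
    ring

theorem laxX_mul_sq_sub_sq_mul (hD : IsConnection m D) (a b : ι ⊕ ι) (i : ι) :
    m (laxX k p q κ a b) * (κ i • D i ^ 2) - (κ i • D i ^ 2) * m (laxX k p q κ a b) =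
      m (laxM k p q κ a b) *
        ((κ i * spair (Sum.inl i) a) • D i - (κ i * spair (Sum.inl i) b) • D i)
      + (κ i * (spair (Sum.inl i) a - spair (Sum.inl i) b) ^ 2) • (1 / 2 : ℂ) •
        m (laxMDeriv k p q κ a b) := by
  have theta_laxX : theta i (laxX k p q κ a b) = _ := stheta_laxX (Sum.inl i) a b
  have theta_laxM : theta i (laxM k p q κ a b) = _ := stheta_laxM (Sum.inl i) a b
  rw [mul_smul_comm, smul_mul_assoc, ← smul_sub, hD.mul_sq_sub_sq_mul, theta_laxX,
    Derivation.map_smul, theta_laxM, ← sub_smul, mul_smul_comm, map_smul, map_smul, map_smul,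
    two_mul]
  simp only [add_mul, smul_mul_assoc]
  module

variable (m D k p q κ) [Fintype ι]

/-- The second matrix of the Lax pair. Its diagonal entries make all row sums vanish. -/
def laxMat : Matrix (ι ⊕ ι) (ι ⊕ ι) R := Matrix.of fun a b =>
  m (laxM k p q κ a b) - if a = b then ∑ c, m (laxM k p q κ a c) else 0

/-- The Schrödinger operator. -/
def laxH : R := ∑ i, κ i • D i ^ 2 - m (laxV k p q κ)

/-- The integrals `e^* L ^ n e`. -/
def laxIntegral (n : ℕ) : R := ∑ a, ∑ b, (sweight κ a)⁻¹ • (laxL m D k p q κ ^ n) a b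

variable {m D k p q κ}

theorem sum_weight_mul_spair_smul (a : ι ⊕ ι) :
    ∑ i, (κ i * spair (Sum.inl i) a) • D i = sweight κ a • signedOp D a := by
  rcases a with a | a <;> simp [spair, sweight, signedOp, ite_smul]

theorem laxX_mul_laxH_sub (hD : IsConnection m D) (a b : ι ⊕ ι) :
    m (laxX k p q κ a b) * laxH m D k p q κ - laxH m D k p q κ * m (laxX k p q κ a b) =
      m (laxM k p q κ a b) * (sweight κ a • signedOp D a - sweight κ b • signedOp D b)
      + m (algebraMap ℂ _ ((∑ i, κ i * (spair (Sum.inl i) a - spair (Sum.inl i) b) ^ 2) / 2) *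
          laxMDeriv k p q κ a b) := by
  have functions_commute :
      m (laxX k p q κ a b) * m (laxV k p q κ) = m (laxV k p q κ) * m (laxX k p q κ a b) := by
    rw [← map_mul, mul_comm, map_mul]
  rw [laxH, mul_sub, sub_mul, functions_commute, sub_sub_sub_cancel_right, Finset.mul_sum,
    Finset.sum_mul, ← Finset.sum_sub_distrib,
    Finset.sum_congr rfl fun i _ => laxX_mul_sq_sub_sq_mul hD a b i, Finset.sum_add_distrib,
    ← Finset.mul_sum, Finset.sum_sub_distrib, sum_weight_mul_spair_smul, sum_weight_mul_spair_smul,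
    ← Finset.sum_smul, ← Algebra.smul_def, map_smul, smul_smul]
  congr 2
  ring

theorem signedOp_mul_laxH_sub (hD : IsConnection m D) (a : ι ⊕ ι) :
    signedOp D a * laxH m D k p q κ - laxH m D k p q κ * signedOp D a =
      -m (stheta a (laxV k p q κ)) := by
  have kinetic : signedOp D a * ∑ i, κ i • D i ^ 2 = (∑ i, κ i • D i ^ 2) * signedOp D a := by
    rw [Finset.mul_sum, Finset.sum_mul]
    refine Finset.sum_congr rfl fun i _ => ?_
    rw [mul_smul_comm, smul_mul_assoc, sq, ← mul_assoc, signedOp_mul_comm hD.comm, mul_assoc,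
      signedOp_mul_comm hD.comm, mul_assoc]
  rw [laxH, mul_sub, sub_mul, kinetic, hD.signed_leibniz]
  noncomm_ring

theorem laxL_mul_laxMat_apply (a b : ι ⊕ ι) :
    (laxL m D k p q κ * laxMat m k p q κ) a b =
      (sweight κ a • signedOp D a) * m (laxM k p q κ a b)
      - (if a = b then (sweight κ a • signedOp D a) * m (∑ c, laxM k p q κ a c) else 0)
      + m (∑ c, laxX k p q κ a c * laxM k p q κ c b
        - laxX k p q κ a b * ∑ c, laxM k p q κ b c) := by
  simp only [Matrix.mul_apply, laxL, laxMat, Matrix.of_apply, add_mul, mul_sub,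
    Finset.sum_add_distrib, Finset.sum_sub_distrib, ite_mul, zero_mul, mul_ite, mul_zero,
    Finset.sum_ite_eq, Finset.sum_ite_eq', Finset.mem_univ, if_true, map_sub, map_sum, map_mul]
  by_cases hab : a = b
  · subst hab; simp only [if_true]; abel
  · simp only [if_neg hab]; abel

theorem laxMat_mul_laxL_apply (a b : ι ⊕ ι) :
    (laxMat m k p q κ * laxL m D k p q κ) a b =
      m (laxM k p q κ a b) * (sweight κ b • signedOp D b)
      - (if a = b then m (∑ c, laxM k p q κ a c) * (sweight κ a • signedOp D a) else 0)
      + m (∑ c, laxM k p q κ a c * laxX k p q κ c b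
        - laxX k p q κ a b * ∑ c, laxM k p q κ a c) := by
  have functions_commute : (∑ c, m (laxM k p q κ a c)) * m (laxX k p q κ a b) =
      m (laxX k p q κ a b) * ∑ c, m (laxM k p q κ a c) := by
    rw [← map_sum, ← map_mul, mul_comm, map_mul]
  simp only [Matrix.mul_apply, laxL, laxMat, Matrix.of_apply, mul_add, sub_mul,
    Finset.sum_add_distrib, Finset.sum_sub_distrib, ite_mul, zero_mul, mul_ite, mul_zero,
    Finset.sum_ite_eq, Finset.sum_ite_eq', Finset.mem_univ, if_true, map_sub, map_mul, map_sum,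
    functions_commute]
  by_cases hab : a = b
  · subst hab; simp only [if_true]
  · simp only [if_neg hab]

theorem laxL_laxMat_commutator_apply (hD : IsConnection m D) (a b : ι ⊕ ι) :
    (laxL m D k p q κ * laxMat m k p q κ - laxMat m k p q κ * laxL m D k p q κ) a b =
      m (laxM k p q κ a b) * (sweight κ a • signedOp D a - sweight κ b • signedOp D b)
      + sweight κ a • m (stheta a (laxM k p q κ a b))
      - (if a = b then sweight κ a • m (∑ c, stheta a (laxM k p q κ a c)) else 0)
      + m (∑ c, (laxX k p q κ a c * laxM k p q κ c b - laxM k p q κ a c * laxX k p q κ c b)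
        + laxX k p q κ a b * (∑ c, laxM k p q κ a c - ∑ c, laxM k p q κ b c)) := by
  rw [Matrix.sub_apply, laxL_mul_laxMat_apply, laxMat_mul_laxL_apply]
  by_cases hab : a = b
  · subst hab
    simp only [if_true, ← map_sum (stheta a), smul_mul_assoc, mul_smul_comm, hD.signed_leibniz a,
      mul_sub, Finset.sum_sub_distrib, map_sub, map_add, smul_add]
    abel
  · simp only [if_neg hab, smul_mul_assoc, mul_smul_comm, hD.signed_leibniz a, mul_sub,
      Finset.sum_sub_distrib, map_sub, map_add, smul_add]
    abel

theorem laxL_laxH_commutator_apply (hD : IsConnection m D) (a b : ι ⊕ ι) :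
    (laxL m D k p q κ * Matrix.scalar (ι ⊕ ι) (laxH m D k p q κ)
      - Matrix.scalar (ι ⊕ ι) (laxH m D k p q κ) * laxL m D k p q κ) a b =
    (if a = b then -(sweight κ a • m (stheta a (laxV k p q κ))) else 0)
      + (m (laxM k p q κ a b) * (sweight κ a • signedOp D a - sweight κ b • signedOp D b)
      + m (algebraMap ℂ _ ((∑ i, κ i * (spair (Sum.inl i) a - spair (Sum.inl i) b) ^ 2) / 2) *
          laxMDeriv k p q κ a b)) := by
  rw [Matrix.sub_apply, Matrix.scalar_apply, Matrix.mul_diagonal, Matrix.diagonal_mul,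
    ← laxX_mul_laxH_sub hD, ← smul_neg, ← signedOp_mul_laxH_sub hD]
  simp only [laxL, Matrix.of_apply]
  split_ifs
  · simp only [add_mul, mul_add, smul_mul_assoc, mul_smul_comm, smul_sub]; abel
  · simp only [zero_add]

theorem lax_equation (h : IsWeight k κ) (hD : IsConnection m D) :
    laxL m D k p q κ * Matrix.scalar (ι ⊕ ι) (laxH m D k p q κ)
      - Matrix.scalar (ι ⊕ ι) (laxH m D k p q κ) * laxL m D k p q κ =
    laxL m D k p q κ * laxMat m k p q κ - laxMat m k p q κ * laxL m D k p q κ := by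
  ext a b
  rw [laxL_laxMat_commutator_apply hD, laxL_laxH_commutator_apply hD]
  by_cases hab : a = b
  · subst hab
    have laxM_self : laxM k p q κ a a = 0 := if_pos rfl
    have laxMDeriv_self : laxMDeriv k p q κ a a = 0 := if_pos rfl
    have diagonal := congrArg m (lax_diagonal (p := p) (q := q) h a)
    simp only [← Algebra.smul_def, map_sub, map_neg, map_smul] at diagonal
    simp only [if_true, laxM_self, laxMDeriv_self, sub_self, mul_zero, add_zero, map_zero,
      smul_zero, zero_sub]
    rw [← diagonal]
    abel
  · have off_diagonal := congrArg m (lax_off_diagonal (p := p) (q := q) h (Ne.symm hab))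
    rw [if_neg hab, if_neg hab, off_diagonal, ← Algebra.smul_def, map_add, map_smul, zero_add,
      sub_zero, add_assoc]
    simp only [laxBracket, Finset.sum_add_distrib, Finset.mul_sum, mul_sub, Finset.sum_sub_distrib]

theorem laxMat_row_sum (a : ι ⊕ ι) : ∑ b, laxMat m k p q κ a b = 0 := by
  simp [laxMat]

theorem laxMat_column_sum (b : ι ⊕ ι) : ∑ a, (sweight κ a)⁻¹ • laxMat m k p q κ a b = 0 := by
  simp only [laxMat, Matrix.of_apply, smul_sub, smul_ite, smul_zero, Finset.sum_sub_distrib,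
    ← map_smul, inv_sweight_smul_laxM_comm _ b, Finset.sum_ite_eq', Finset.mem_univ, if_true,
    ← map_sum, Finset.smul_sum, sub_self]

theorem commute_laxIntegral_laxH (h : IsWeight k κ) (hD : IsConnection m D) (n : ℕ) :
    Commute (laxIntegral m D k p q κ n) (laxH m D k p q κ) := by
  have total : ∑ a, ∑ b, (sweight κ a)⁻¹ •
      (laxL m D k p q κ ^ n * laxMat m k p q κ - laxMat m k p q κ * laxL m D k p q κ ^ n) a b
        = 0 := by
    simp only [Matrix.sub_apply, smul_sub, Finset.sum_sub_distrib]
    rw [Finset.sum_eq_zero fun a _ => ?rows, zero_sub, neg_eq_zero, Finset.sum_comm]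
    case rows => rw [← Finset.smul_sum, sum_mul_apply_of_row_sum_eq_zero laxMat_row_sum, smul_zero]
    exact Finset.sum_eq_zero fun b _ =>
      sum_smul_mul_apply_of_column_sum_eq_zero laxMat_column_sum _ b
  rw [← pow_commutator_eq (lax_equation h hD) n] at total
  simp only [Matrix.sub_apply, Matrix.scalar_apply, Matrix.mul_diagonal, Matrix.diagonal_mul,
    smul_sub, Finset.sum_sub_distrib] at total
  simp only [commute_iff_eq, laxIntegral, Finset.sum_mul, Finset.mul_sum, smul_mul_assoc,
    mul_smul_comm]
  exact sub_eq_zero.1 total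

end LaxPair

/-! ### Normal ordering and the universal connection -/

section Normal

variable {ι R R' : Type} [Ring R] [Algebra ℂ R] [Ring R'] [Algebra ℂ R']

section LaxIntegral

variable [DecidableEq ι] [Fintype ι] {m : RatField ι →ₐ[ℂ] R} {D : ι → R} {k p q : ℂ} {κ : ι → ℂ}

theorem laxIntegral_mem {S : Subalgebra ℂ R} (hm : ∀ a b, m (laxX k p q κ a b) ∈ S)
    (hD : ∀ i, D i ∈ S) (n : ℕ) : laxIntegral m D k p q κ n ∈ S := by
  have signedOp_mem : ∀ a, signedOp D a ∈ S := by
    rintro (a | a)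
    · exact hD a
    · exact neg_mem (hD a)
  have laxL_mem : laxL m D k p q κ ∈ S.matrix (n := ι ⊕ ι) := by
    intro a b
    refine add_mem ?_ (hm a b)
    split_ifs
    · exact S.smul_mem (signedOp_mem a) _
    · exact S.zero_mem
  exact sum_mem fun a _ => sum_mem fun b _ => S.smul_mem (pow_mem laxL_mem n a b) _

theorem map_laxIntegral (f : R →ₐ[ℂ] R') (n : ℕ) :
    f (laxIntegral m D k p q κ n) = laxIntegral (f.comp m) (f ∘ D) k p q κ n := by
  have map_signedOp : ∀ a, f (signedOp D a) = signedOp (f ∘ D) a := by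
    rintro (a | a) <;> simp [signedOp]
  have map_laxL : f.mapMatrix (laxL m D k p q κ) = laxL (f.comp m) (f ∘ D) k p q κ := by
    ext a b
    simp only [AlgHom.mapMatrix_apply, Matrix.map_apply, laxL, Matrix.of_apply, map_add,
      AlgHom.comp_apply, apply_ite f, map_smul, map_zero, map_signedOp]
  rw [laxIntegral, laxIntegral, ← map_laxL, ← map_pow]
  simp only [map_sum, map_smul, AlgHom.mapMatrix_apply, Matrix.map_apply]

end LaxIntegral

variable {m : RatField ι →ₐ[ℂ] R} {D : ι → R}

namespace IsConnection

/-- Evaluation of constant coefficient polynomials at the operators of a connection. -/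
def eval (hD : IsConnection m D) : MvPolynomial ι ℂ →ₐ[ℂ] R :=
  letI : CommRing (Algebra.adjoin ℂ (Set.range D)) :=
    { (Algebra.adjoin ℂ (Set.range D)).toRing with
      mul_comm := (Algebra.isMulCommutative_adjoin ℂ (by
        rintro _ ⟨i, rfl⟩ _ ⟨j, rfl⟩; exact hD.comm i j)).is_comm.comm }
  (Algebra.adjoin ℂ (Set.range D)).val.comp
    (MvPolynomial.aeval fun i => ⟨D i, Algebra.subset_adjoin ⟨i, rfl⟩⟩)

theorem eval_X (hD : IsConnection m D) (i : ι) : hD.eval (MvPolynomial.X i) = D i := by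
  simp [eval]

/-- Normal ordering: the linear map with `f λ ^ β ↦ m f * D ^ β`. -/
def normal (hD : IsConnection m D) : MvPolynomial ι (RatField ι) →ₗ[ℂ] R :=
  (Finsupp.lsum ℂ fun β : ι →₀ ℕ =>
    (LinearMap.mulRight ℂ (hD.eval (MvPolynomial.monomial β 1))).comp m.toLinearMap).comp
    (AddMonoidAlgebra.coeffLinearEquiv ℂ).toLinearMap

theorem normal_monomial (hD : IsConnection m D) (β : ι →₀ ℕ) (f : RatField ι) :
    hD.normal (MvPolynomial.monomial β f) = m f * hD.eval (MvPolynomial.monomial β 1) :=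
  Finsupp.lsum_single ℂ _ β f

theorem normal_one (hD : IsConnection m D) : hD.normal 1 = 1 := by
  simpa using hD.normal_monomial 0 1

theorem normal_C_mul (hD : IsConnection m D) (f : RatField ι)
    (u : MvPolynomial ι (RatField ι)) : hD.normal (MvPolynomial.C f * u) = m f * hD.normal u := by
  induction u using MvPolynomial.induction_on' with
  | monomial β g =>
    rw [MvPolynomial.C_mul_monomial, hD.normal_monomial, hD.normal_monomial, map_mul, mul_assoc]
  | add u v hu hv => rw [mul_add, map_add, hu, hv, map_add, mul_add]

theorem normal_map (hD : IsConnection m D) (v : MvPolynomial ι ℂ) :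
    hD.normal (MvPolynomial.map (algebraMap ℂ (RatField ι)) v) = hD.eval v := by
  induction v using MvPolynomial.induction_on' with
  | monomial β c =>
    rw [MvPolynomial.map_monomial, hD.normal_monomial, AlgHom.commutes, ← Algebra.smul_def,
      ← map_smul, MvPolynomial.smul_monomial, smul_eq_mul, mul_one]
  | add u v hu hv => rw [map_add, map_add, hu, hv, map_add]

end IsConnection

/-- The derivation `∂_i` applied to the coefficients of a polynomial. -/
def coeffDeriv (i : ι) : Module.End ℂ (MvPolynomial ι (RatField ι)) :=
  (AddMonoidAlgebra.coeffLinearEquiv ℂ).symm.toLinearMap ∘ₗ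
    Finsupp.mapRange.linearMap (theta i).toLinearMap ∘ₗ
      (AddMonoidAlgebra.coeffLinearEquiv ℂ).toLinearMap

theorem coeff_coeffDeriv (i : ι) (u : MvPolynomial ι (RatField ι)) (β : ι →₀ ℕ) :
    (coeffDeriv i u).coeff β = theta i (u.coeff β) := rfl

theorem coeffDeriv_monomial (i : ι) (β : ι →₀ ℕ) (f : RatField ι) :
    coeffDeriv i (MvPolynomial.monomial β f) = MvPolynomial.monomial β (theta i f) := by
  classical
  ext δ
  rw [coeff_coeffDeriv, MvPolynomial.coeff_monomial, MvPolynomial.coeff_monomial,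
    apply_ite (theta i), map_zero]

theorem coeffDeriv_mul (i : ι) (u v : MvPolynomial ι (RatField ι)) :
    coeffDeriv i (u * v) = coeffDeriv i u * v + u * coeffDeriv i v := by
  classical
  ext β
  simp only [coeff_coeffDeriv, MvPolynomial.coeff_add, MvPolynomial.coeff_mul, map_sum,
    Derivation.leibniz, smul_eq_mul, ← Finset.sum_add_distrib]
  refine Finset.sum_congr rfl fun x _ => ?_
  ring

theorem coeffDeriv_map (i : ι) (v : MvPolynomial ι ℂ) :
    coeffDeriv i (MvPolynomial.map (algebraMap ℂ (RatField ι)) v) = 0 := by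
  ext β
  rw [coeff_coeffDeriv, MvPolynomial.coeff_map, Derivation.map_algebraMap, MvPolynomial.coeff_zero]

theorem coeffDeriv_X (i j : ι) : coeffDeriv i (MvPolynomial.X j) = 0 := by
  rw [← MvPolynomial.map_X (algebraMap ℂ (RatField ι)), coeffDeriv_map]

theorem coeffDeriv_C (i : ι) (f : RatField ι) :
    coeffDeriv i (MvPolynomial.C f) = MvPolynomial.C (theta i f) := coeffDeriv_monomial i 0 f

theorem coeffDeriv_comm (i j : ι) (u : MvPolynomial ι (RatField ι)) :
    coeffDeriv i (coeffDeriv j u) = coeffDeriv j (coeffDeriv i u) := by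
  ext β
  simp only [coeff_coeffDeriv, theta_comm i j]

/-- The operator `∂_i + λ_i` on polynomials in the spectral variables `λ`. -/
def univD (i : ι) : Module.End ℂ (MvPolynomial ι (RatField ι)) :=
  coeffDeriv i + LinearMap.mulLeft ℂ (MvPolynomial.X i)

theorem univD_apply (i : ι) (u : MvPolynomial ι (RatField ι)) :
    univD i u = coeffDeriv i u + MvPolynomial.X i * u := rfl

variable (ι) in
/-- Multiplication by rational functions on polynomials in the spectral variables. -/
def univM : RatField ι →ₐ[ℂ] Module.End ℂ (MvPolynomial ι (RatField ι)) :=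
  (Algebra.lmul ℂ (MvPolynomial ι (RatField ι))).comp
    (IsScalarTower.toAlgHom ℂ (RatField ι) (MvPolynomial ι (RatField ι)))

theorem univM_apply (f : RatField ι) (u : MvPolynomial ι (RatField ι)) :
    univM ι f u = MvPolynomial.C f * u := rfl

variable (ι) in
theorem isConnection_univ : IsConnection (univM ι) univD where
  comm i j := by
    refine LinearMap.ext fun u => ?_
    simp only [Module.End.mul_apply, univD_apply, map_add, coeffDeriv_mul, coeffDeriv_X,
      coeffDeriv_comm i j]
    ring
  leibniz i f := by
    refine LinearMap.ext fun u => ?_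
    simp only [Module.End.mul_apply, univD_apply, univM_apply, LinearMap.add_apply, coeffDeriv_mul,
      coeffDeriv_C]
    ring

namespace IsConnection

theorem normal_univD (hD : IsConnection m D) (i : ι) (u : MvPolynomial ι (RatField ι)) :
    hD.normal (univD i u) = D i * hD.normal u := by
  induction u using MvPolynomial.induction_on' with
  | monomial β g =>
    have X_mul_monomial : (MvPolynomial.monomial (Finsupp.single i 1 + β) 1 : MvPolynomial ι ℂ) =
        MvPolynomial.X i * MvPolynomial.monomial β 1 := by
      rw [MvPolynomial.X, MvPolynomial.monomial_mul, one_mul]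
    rw [univD_apply, coeffDeriv_monomial, map_add, hD.normal_monomial, MvPolynomial.X,
      MvPolynomial.monomial_mul, one_mul, hD.normal_monomial, hD.normal_monomial, ← mul_assoc,
      hD.leibniz, X_mul_monomial, map_mul, hD.eval_X, add_mul, add_comm, mul_assoc]
  | add u v hu hv => rw [map_add, map_add, hu, hv, map_add, mul_add]

/-- The pairs of operators which are intertwined by normal ordering. -/
def intertwined (hD : IsConnection m D) :
    Subalgebra ℂ (Module.End ℂ (MvPolynomial ι (RatField ι)) × R) where
  carrier := {P | ∀ u, hD.normal (P.1 u) = P.2 * hD.normal u}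
  mul_mem' {P Q} hP hQ u := by
    change hD.normal (P.1 (Q.1 u)) = P.2 * Q.2 * _
    rw [hP, hQ, mul_assoc]
  add_mem' {P Q} hP hQ u := by
    change hD.normal (P.1 u + Q.1 u) = (P.2 + Q.2) * _
    rw [map_add, hP, hQ, add_mul]
  algebraMap_mem' c u := by
    change hD.normal (algebraMap ℂ (Module.End ℂ _) c u) = algebraMap ℂ R c * _
    rw [Module.algebraMap_end_apply, map_smul, Algebra.smul_def]

theorem normal_laxIntegral [DecidableEq ι] [Fintype ι] (hD : IsConnection m D) (k p q : ℂ)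
    (κ : ι → ℂ) (n : ℕ) (u : MvPolynomial ι (RatField ι)) :
    hD.normal (laxIntegral (univM ι) univD k p q κ n u) =
      laxIntegral m D k p q κ n * hD.normal u := by
  let D' : ι → Module.End ℂ (MvPolynomial ι (RatField ι)) × R := fun i => (univD i, D i)
  have mem : laxIntegral ((univM ι).prod m) D' k p q κ n ∈ hD.intertwined :=
    laxIntegral_mem (m := (univM ι).prod m) (fun _ _ => by exact hD.normal_C_mul _)
      (by exact hD.normal_univD) n
  have fst := map_laxIntegral (m := (univM ι).prod m) (D := D') (k := k) (p := p) (q := q) (κ := κ)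
    (AlgHom.fst ℂ _ _) n
  have snd := map_laxIntegral (m := (univM ι).prod m) (D := D') (k := k) (p := p) (q := q) (κ := κ)
    (AlgHom.snd ℂ _ _) n
  rw [AlgHom.fst_prod] at fst
  rw [AlgHom.snd_prod] at snd
  have intertwines := mem u
  rw [← AlgHom.fst_apply ℂ, ← AlgHom.snd_apply ℂ, fst, snd] at intertwines
  exact intertwines

end IsConnection

end Normal

/-! ### Asymptotics at infinity -/

section Asymptotics

theorem coeff_euler {ι : Type} (i : ι) (a : LaurentRing ι) (γ : ι →₀ ℤ) :
    (euler i a).coeff γ = (γ i : ℂ) * a.coeff γ := by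
  classical
  change (eulerLin i a).coeff γ = _
  induction a using AddMonoidAlgebra.induction_linear with
  | zero => simp
  | add F G hF hG =>
    rw [map_add, AddMonoidAlgebra.coeff_add, Finsupp.add_apply, hF, hG, AddMonoidAlgebra.coeff_add,
      Finsupp.add_apply, mul_add]
  | single δ c =>
    rw [eulerLin_single, AddMonoidAlgebra.coeff_smul, AddMonoidAlgebra.coeff_single,
      Finsupp.smul_apply, smul_eq_mul, Finsupp.single_apply]
    split_ifs with h
    · rw [h]
    · simp only [mul_zero]

variable {ι : Type} [Fintype ι]

/-- A total order on the lattice of exponents, given by an embedding into a lexicographically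
ordered group. A monomial is infinitesimal when its exponent is positive. -/
def lexExp : (ι →₀ ℤ) →+ Lex (Fin (Fintype.card ι) →₀ ℤ) where
  toFun γ := toLex (Finsupp.domCongr (M := ℤ) (Fintype.equivFin ι) γ)
  map_zero' := by rw [map_zero]; rfl
  map_add' γ δ := by rw [map_add]; rfl

theorem lexExp_injective : Function.Injective (lexExp (ι := ι)) :=
  toLex.injective.comp (Finsupp.domCongr (M := ℤ) (Fintype.equivFin ι)).injective

variable (ι) in
/-- Laurent polynomials all of whose exponents are positive. -/
def positivePart : Submodule ℂ (LaurentRing ι) where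
  carrier := {a | ∀ γ, a.coeff γ ≠ 0 → 0 < lexExp γ}
  zero_mem' γ h := by simp at h
  add_mem' {a b} ha hb γ h := by
    by_cases h_left : a.coeff γ = 0
    · refine hb γ fun h_right => h ?_
      simp [h_left, h_right]
    · exact ha γ h_left
  smul_mem' c a ha γ h := ha γ fun h_zero => h (by simp [h_zero])

theorem mul_mem_positivePart {a b : LaurentRing ι} (ha : a ∈ positivePart ι)
    (hb : b ∈ positivePart ι) : a * b ∈ positivePart ι := by
  intro γ h
  rw [AddMonoidAlgebra.coeff_mul] at h
  obtain ⟨γ₁, hγ₁, h⟩ := Finset.exists_ne_zero_of_sum_ne_zero h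
  obtain ⟨γ₂, hγ₂, h⟩ := Finset.exists_ne_zero_of_sum_ne_zero h
  have add_eq : γ₁ + γ₂ = γ := by
    by_contra hne
    simp [hne] at h
  rw [← add_eq, map_add]
  exact add_pos (ha γ₁ (Finsupp.mem_support_iff.1 hγ₁)) (hb γ₂ (Finsupp.mem_support_iff.1 hγ₂))

theorem euler_mem_positivePart (i : ι) {a : LaurentRing ι} (ha : a ∈ positivePart ι) :
    euler i a ∈ positivePart ι := fun γ h =>
  ha γ fun h_zero => h (by rw [coeff_euler, h_zero, mul_zero])

theorem coeff_zero_of_mem_positivePart {a : LaurentRing ι} (ha : a ∈ positivePart ι) :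
    a.coeff 0 = 0 := by
  by_contra h
  exact (ha 0 h).ne' (map_zero lexExp)

theorem one_add_ne_zero {a : LaurentRing ι} (ha : a ∈ positivePart ι) :
    1 + algebraMap _ (RatField ι) a ≠ 0 := by
  rw [← map_one (algebraMap (LaurentRing ι) (RatField ι)), ← map_add, Ne,
    IsFractionRing.to_map_eq_zero_iff (K := RatField ι)]
  intro h
  have constant_term := congrArg (fun a : LaurentRing ι => a.coeff 0) h
  simp [coeff_zero_of_mem_positivePart ha, AddMonoidAlgebra.one_def] at constant_term

variable (ι) in
/-- The rational functions which vanish at infinity: quotients `a / (1 + b)` with `a` and `b`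
having positive exponents only. -/
def infinitesimal : Submodule ℂ (RatField ι) where
  carrier := {f | ∃ a ∈ positivePart ι, ∃ b ∈ positivePart ι,
    f * (1 + algebraMap _ (RatField ι) b) = algebraMap _ (RatField ι) a}
  zero_mem' := ⟨0, zero_mem _, 0, zero_mem _, by simp⟩
  add_mem' := by
    rintro f g ⟨a, ha, b, hb, h⟩ ⟨a', ha', b', hb', h'⟩
    refine ⟨a + a * b' + (a' + a' * b), add_mem (add_mem ha (mul_mem_positivePart ha hb'))
      (add_mem ha' (mul_mem_positivePart ha' hb)), b + b' + b * b',
      add_mem (add_mem hb hb') (mul_mem_positivePart hb hb'), ?_⟩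
    simp only [map_add, map_mul]
    linear_combination (1 + algebraMap _ (RatField ι) b') * h
      + (1 + algebraMap _ (RatField ι) b) * h'
  smul_mem' := by
    rintro c f ⟨a, ha, b, hb, h⟩
    refine ⟨c • a, Submodule.smul_mem _ _ ha, b, hb, ?_⟩
    rw [smul_mul_assoc, h, algebraMap_smul_laurent]

theorem mul_mem_infinitesimal {f g : RatField ι} (hf : f ∈ infinitesimal ι)
    (hg : g ∈ infinitesimal ι) : f * g ∈ infinitesimal ι := by
  obtain ⟨a, ha, b, hb, h⟩ := hf
  obtain ⟨a', ha', b', hb', h'⟩ := hg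
  refine ⟨a * a', mul_mem_positivePart ha ha', b + b' + b * b',
    add_mem (add_mem hb hb') (mul_mem_positivePart hb hb'), ?_⟩
  simp only [map_add, map_mul]
  rw [← h, ← h']
  ring

theorem theta_mem_infinitesimal (i : ι) {f : RatField ι} (hf : f ∈ infinitesimal ι) :
    theta i f ∈ infinitesimal ι := by
  obtain ⟨a, ha, b, hb, h⟩ := hf
  refine ⟨euler i a + (euler i a * b - a * euler i b),
    add_mem (euler_mem_positivePart i ha) (sub_mem
      (mul_mem_positivePart (euler_mem_positivePart i ha) hb)
      (mul_mem_positivePart ha (euler_mem_positivePart i hb))),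
    b + b + b * b, add_mem (add_mem hb hb) (mul_mem_positivePart hb hb), ?_⟩
  have derivative := congrArg (theta i) h
  rw [Derivation.leibniz, map_add, Derivation.map_one_eq_zero, theta, ratDeriv_algebraMap,
    ratDeriv_algebraMap] at derivative
  rw [theta]
  simp only [map_add, map_mul, map_sub, smul_eq_mul] at derivative ⊢
  linear_combination (1 + algebraMap _ (RatField ι) b) * derivative
    - algebraMap _ (RatField ι) (euler i b) * h

theorem eq_zero_of_algebraMap_mem_infinitesimal {c : ℂ}
    (h : algebraMap ℂ (RatField ι) c ∈ infinitesimal ι) : c = 0 := by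
  obtain ⟨a, ha, b, hb, h⟩ := h
  have laurent : c • (1 + b) = a := by
    apply IsFractionRing.injective (LaurentRing ι) (RatField ι)
    rw [algebraMap_smul_laurent, map_add, map_one, ← h, Algebra.smul_def]
  have constant_term := congrArg (fun a : LaurentRing ι => a.coeff 0) laurent
  simpa [coeff_zero_of_mem_positivePart ha, coeff_zero_of_mem_positivePart hb,
    AddMonoidAlgebra.one_def] using constant_term

theorem single_mem_positivePart {γ : ι →₀ ℤ} (h : 0 < lexExp γ) :
    (AddMonoidAlgebra.single γ 1 : LaurentRing ι) ∈ positivePart ι := by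
  intro δ hδ
  by_cases hγδ : γ = δ
  · rwa [← hγδ]
  · simp [hγδ] at hδ

theorem xpow_mem_infinitesimal {γ : ι →₀ ℤ} (h : 0 < lexExp γ) : xpow γ ∈ infinitesimal ι :=
  ⟨_, single_mem_positivePart h, 0, zero_mem _, by simp [xpow]⟩

theorem exists_leading_laurent {a : LaurentRing ι} (ha : a ≠ 0) : ∃ γ : ι →₀ ℤ, ∃ c : ℂ, c ≠ 0 ∧
    ∃ b ∈ positivePart ι, a = AddMonoidAlgebra.single γ c * (1 + b) := by
  have support_nonempty : a.coeff.support.Nonempty := by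
    rw [Finsupp.support_nonempty_iff]
    exact fun h => ha (AddMonoidAlgebra.ext h)
  obtain ⟨γ, hγ, hmin⟩ := Finset.exists_min_image _ lexExp support_nonempty
  have hc := Finsupp.mem_support_iff.1 hγ
  refine ⟨γ, a.coeff γ, hc, AddMonoidAlgebra.single (-γ) (a.coeff γ)⁻¹ * a - 1, ?_, ?_⟩
  · intro δ hδ
    have coeff_shift : (AddMonoidAlgebra.single (-γ) (a.coeff γ)⁻¹ * a : LaurentRing ι).coeff δ =
        (a.coeff γ)⁻¹ * a.coeff (γ + δ) :=
      AddMonoidAlgebra.coeff_single_mul_eq_mul_coeff _ fun m _ => by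
        rw [neg_add_eq_iff_eq_add]
    rw [AddMonoidAlgebra.coeff_sub, Finsupp.sub_apply, coeff_shift, AddMonoidAlgebra.one_def,
      AddMonoidAlgebra.coeff_single] at hδ
    have hδ_ne : δ ≠ 0 := by
      rintro rfl
      simp [hc] at hδ
    rw [Finsupp.single_eq_of_ne hδ_ne, sub_zero] at hδ
    have hle := hmin _ (Finsupp.mem_support_iff.2 (right_ne_zero_of_mul hδ))
    rw [map_add, le_add_iff_nonneg_right] at hle
    exact hle.lt_of_ne' ((map_ne_zero_iff lexExp lexExp_injective).2 hδ_ne)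
  · rw [add_sub_cancel, ← mul_assoc, AddMonoidAlgebra.single_mul_single, mul_inv_cancel₀ hc,
      add_neg_cancel, ← AddMonoidAlgebra.one_def, one_mul]

theorem exists_leading {f : RatField ι} (hf : f ≠ 0) : ∃ γ : ι →₀ ℤ, ∃ c : ℂ, c ≠ 0 ∧
    ∃ ε ∈ infinitesimal ι, f = xpow γ * (algebraMap ℂ _ c + ε) := by
  obtain ⟨a, b, hb, rfl⟩ := IsFractionRing.div_surjective (A := LaurentRing ι) f
  have ha : a ≠ 0 := by rintro rfl; simp at hf
  obtain ⟨γ, c, hc, a', ha', rfl⟩ := exists_leading_laurent ha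
  obtain ⟨δ, d, hd, b', hb', rfl⟩ := exists_leading_laurent (nonZeroDivisors.ne_zero hb)
  have denominator_ne_zero := one_add_ne_zero hb'
  refine ⟨γ + -δ, c / d, div_ne_zero hc hd, (c / d) • ((algebraMap _ (RatField ι) (a' - b'))
    / (1 + algebraMap _ (RatField ι) b')), Submodule.smul_mem _ _
    ⟨a' - b', sub_mem ha' hb', b', hb', div_mul_cancel₀ _ denominator_ne_zero⟩, ?_⟩
  have d_ne_zero : algebraMap ℂ (RatField ι) d ≠ 0 := by simpa using hd
  have monomial_ne_zero := xpow_ne_zero δ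
  rw [xpow_add, xpow_neg]
  simp only [map_mul, map_add, map_one, algebraMap_single, map_sub, map_div₀, Algebra.smul_def]
  field_simp
  ring

variable (ι) in
/-- The rational functions which have a limit at infinity. -/
def regular : Subalgebra ℂ (RatField ι) where
  carrier := {f | ∃ c : ℂ, f - algebraMap ℂ _ c ∈ infinitesimal ι}
  mul_mem' := by
    rintro f g ⟨c, hc⟩ ⟨d, hd⟩
    refine ⟨c * d, ?_⟩
    have expanded := add_mem (add_mem (mul_mem_infinitesimal hc hd)
      (Submodule.smul_mem (infinitesimal ι) c hd)) (Submodule.smul_mem (infinitesimal ι) d hc)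
    convert expanded using 1
    simp only [Algebra.smul_def, map_mul]
    ring
  add_mem' := by
    rintro f g ⟨c, hc⟩ ⟨d, hd⟩
    refine ⟨c + d, ?_⟩
    rw [map_add, add_sub_add_comm]
    exact add_mem hc hd
  algebraMap_mem' c := ⟨c, by simp⟩

theorem mem_regular_of_mem_infinitesimal {f : RatField ι} (hf : f ∈ infinitesimal ι) :
    f ∈ regular ι := ⟨0, by simpa using hf⟩

theorem mul_mem_infinitesimal_of_mem_regular {f g : RatField ι} (hf : f ∈ regular ι)
    (hg : g ∈ infinitesimal ι) : f * g ∈ infinitesimal ι := by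
  obtain ⟨c, hc⟩ := hf
  have expanded :=
    add_mem (mul_mem_infinitesimal hc hg) (Submodule.smul_mem (infinitesimal ι) c hg)
  rwa [Algebra.smul_def, sub_mul, sub_add_cancel] at expanded

theorem coth_xpow_mem_regular_of_pos {γ : ι →₀ ℤ} (h : 0 < lexExp γ) :
    (xpow γ + 1) / (xpow γ - 1) ∈ regular ι := by
  have hp := single_mem_positivePart h
  have sub_one_ne_zero : xpow γ - 1 ≠ 0 := by
    have ne_zero := one_add_ne_zero (neg_mem hp)
    rw [map_neg, ← xpow] at ne_zero
    exact fun h => ne_zero (by linear_combination -h)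
  refine ⟨-1, (-2 : ℂ) • AddMonoidAlgebra.single γ 1, Submodule.smul_mem _ _ hp,
    -AddMonoidAlgebra.single γ 1, neg_mem hp, ?_⟩
  rw [algebraMap_smul_laurent, Algebra.smul_def]
  simp only [map_neg, map_one, map_ofNat, algebraMap_single, one_smul]
  field_simp
  ring

theorem coth_xpow_mem_regular {γ : ι →₀ ℤ} (h : γ ≠ 0) :
    (xpow γ + 1) / (xpow γ - 1) ∈ regular ι := by
  rcases ((map_ne_zero_iff lexExp lexExp_injective).2 h).lt_or_gt with hneg | hpos
  · have reflected := coth_xpow_mem_regular_of_pos (γ := -γ) (by rwa [map_neg, neg_pos])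
    have odd : (xpow (-γ) + 1) / (xpow (-γ) - 1) = -((xpow γ + 1) / (xpow γ - 1)) := by
      rw [← mul_div_mul_left _ _ (xpow_ne_zero γ), mul_add, mul_sub, xpow_mul_xpow_neg, mul_one,
        add_comm, ← neg_sub, div_neg]
    rw [odd] at reflected
    exact neg_mem_iff.1 reflected
  · exact coth_xpow_mem_regular_of_pos hpos

end Asymptotics

/-! ### Commutativity of the integrals -/

section Commutativity

variable {ι : Type} [Fintype ι]

local notation "𝔠" => algebraMap ℂ (RatField ι)
local notation "const" => MvPolynomial.map (σ := ι) (algebraMap ℂ (RatField ι))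

section Regular

theorem coth_mem_regular (a b : ι ⊕ ι) : coth a b ∈ regular ι := by
  obtain rfl | hab := eq_or_ne a b
  · rw [coth_self]
    exact zero_mem _
  have ratio_regular := coth_xpow_mem_regular (sub_ne_zero.2 (svarExp_injective.ne hab))
  have hb := svar_ne_zero b
  rw [sub_eq_add_neg, xpow_add, xpow_neg, ← svar_eq_xpow, ← svar_eq_xpow,
    ← mul_div_mul_right _ _ hb] at ratio_regular
  simpa only [coth, add_mul, sub_mul, one_mul, inv_mul_cancel_right₀ hb] using ratio_regular

theorem cothOne_mem_regular (a : ι ⊕ ι) : cothOne a ∈ regular ι := by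
  rw [cothOne, svar_eq_xpow]
  exact coth_xpow_mem_regular (svarExp_ne_zero a)

variable (k p q : ℂ) (κ : ι → ℂ)

theorem laxZ_mem_regular (a : ι ⊕ ι) : laxZ p q κ a ∈ regular ι :=
  add_mem (mul_mem (algebraMap_mem _ _) (cothOne_mem_regular a))
    (mul_mem (algebraMap_mem _ _) (coth_mem_regular _ _))

theorem laxZDeriv_mem_regular (a : ι ⊕ ι) : laxZDeriv p q κ a ∈ regular ι := by
  have halve : 𝔠 (p / 2) * ((1 - cothOne a ^ 2) / 2) = 𝔠 (p / 4) * (1 - cothOne a ^ 2) := by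
    simp only [map_div₀, map_ofNat]
    ring
  rw [laxZDeriv_eq, halve]
  exact add_mem
    (mul_mem (algebraMap_mem _ _) (sub_mem (one_mem _) (pow_mem (cothOne_mem_regular a) 2)))
    (mul_mem (algebraMap_mem _ _) (sub_mem (one_mem _) (pow_mem (coth_mem_regular _ _) 2)))

variable [DecidableEq ι]

theorem laxX_mem_regular (a b : ι ⊕ ι) : laxX k p q κ a b ∈ regular ι := by
  unfold laxX
  split_ifs
  · exact zero_mem _
  · exact laxZ_mem_regular p q κ a
  · exact mul_mem (algebraMap_mem _ _) (coth_mem_regular _ _)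

theorem laxW_mem_regular (a b : ι ⊕ ι) : laxW k κ a b ∈ regular ι := by
  unfold laxW
  split_ifs
  · exact zero_mem _
  · exact zero_mem _
  · exact mul_mem (algebraMap_mem _ _) (sub_mem (pow_mem (coth_mem_regular _ _) 2) (one_mem _))

theorem laxV_mem_regular : laxV k p q κ ∈ regular ι :=
  add_mem
    (mul_mem (algebraMap_mem _ _) (sum_mem fun _ _ => sum_mem fun _ _ => laxW_mem_regular _ _ _ _))
    (mul_mem (algebraMap_mem _ _) (sum_mem fun a _ =>
      sub_mem (mul_mem (algebraMap_mem _ _) (pow_mem (laxZ_mem_regular p q κ a) 2))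
        (laxZDeriv_mem_regular p q κ a)))

end Regular

variable (ι) in
/-- The polynomials in the spectral variables whose coefficients vanish at infinity. -/
def infPoly : Submodule ℂ (MvPolynomial ι (RatField ι)) where
  carrier := {u | ∀ β, u.coeff β ∈ infinitesimal ι}
  zero_mem' β := by rw [MvPolynomial.coeff_zero]; exact zero_mem _
  add_mem' hu hv β := by rw [MvPolynomial.coeff_add]; exact add_mem (hu β) (hv β)
  smul_mem' c u hu β := by
    rw [MvPolynomial.coeff_smul]; exact Submodule.smul_mem _ _ (hu β)

theorem C_mul_mem_infPoly {f : RatField ι} (hf : f ∈ regular ι)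
    {u : MvPolynomial ι (RatField ι)} (hu : u ∈ infPoly ι) :
    MvPolynomial.C f * u ∈ infPoly ι := by
  intro β
  rw [MvPolynomial.coeff_C_mul]
  exact mul_mem_infinitesimal_of_mem_regular hf (hu β)

theorem X_mul_mem_infPoly (i : ι) {u : MvPolynomial ι (RatField ι)} (hu : u ∈ infPoly ι) :
    MvPolynomial.X i * u ∈ infPoly ι := by
  classical
  intro β
  rw [MvPolynomial.coeff_X_mul']
  split_ifs
  · exact hu _
  · exact zero_mem _

theorem C_mul_const_mem_infPoly {f : RatField ι} (hf : f ∈ infinitesimal ι)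
    (v : MvPolynomial ι ℂ) : MvPolynomial.C f * const v ∈ infPoly ι := by
  intro β
  rw [MvPolynomial.coeff_C_mul, MvPolynomial.coeff_map, mul_comm]
  exact mul_mem_infinitesimal_of_mem_regular (algebraMap_mem _ _) hf

theorem eq_zero_of_const_mem_infPoly {v : MvPolynomial ι ℂ} (h : const v ∈ infPoly ι) :
    v = 0 := by
  ext β
  have coeff_mem := h β
  rw [MvPolynomial.coeff_map] at coeff_mem
  rw [eq_zero_of_algebraMap_mem_infinitesimal coeff_mem, MvPolynomial.coeff_zero]

/-- The operator `Q` preserves the polynomials vanishing at infinity and acts at infinity as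
multiplication by `w`. -/
structure HasLimit (Q : Module.End ℂ (MvPolynomial ι (RatField ι))) (w : MvPolynomial ι ℂ) :
    Prop where
  apply_mem : ∀ u ∈ infPoly ι, Q u ∈ infPoly ι
  apply_const_sub_mem : ∀ v, Q (const v) - const (w * v) ∈ infPoly ι

namespace HasLimit

variable {P Q : Module.End ℂ (MvPolynomial ι (RatField ι))} {v w : MvPolynomial ι ℂ}

theorem apply_sub_mem (hQ : HasLimit Q w) {u : MvPolynomial ι (RatField ι)}
    (hu : u - const v ∈ infPoly ι) : Q u - const (w * v) ∈ infPoly ι := by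
  have := add_mem (hQ.apply_mem _ hu) (hQ.apply_const_sub_mem v)
  rwa [map_sub, sub_add_sub_cancel] at this

theorem eq_of_apply_eq (hP : HasLimit P v) (hQ : HasLimit Q w) {u₁ u₂ : MvPolynomial ι (RatField ι)}
    {v₁ v₂ : MvPolynomial ι ℂ} (h₁ : u₁ - const v₁ ∈ infPoly ι) (h₂ : u₂ - const v₂ ∈ infPoly ι)
    (h : P u₁ = Q u₂) : v * v₁ = w * v₂ := by
  have := sub_mem (hQ.apply_sub_mem h₂) (hP.apply_sub_mem h₁)
  rw [h, sub_sub_sub_cancel_left, ← map_sub] at this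
  exact sub_eq_zero.1 (eq_zero_of_const_mem_infPoly this)

theorem algebraMap (c : ℂ) : HasLimit (algebraMap ℂ (Module.End ℂ (MvPolynomial ι (RatField ι))) c)
    (MvPolynomial.C c) where
  apply_mem _ hu := Submodule.smul_mem _ c hu
  apply_const_sub_mem v := by
    rw [Module.algebraMap_end_apply, map_mul, MvPolynomial.map_C, Algebra.smul_def,
      MvPolynomial.algebraMap_apply, sub_self]
    exact zero_mem _

theorem add (hP : HasLimit P v) (hQ : HasLimit Q w) : HasLimit (P + Q) (v + w) where
  apply_mem u hu := add_mem (hP.apply_mem u hu) (hQ.apply_mem u hu)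
  apply_const_sub_mem x := by
    rw [add_mul, map_add, LinearMap.add_apply, add_sub_add_comm]
    exact add_mem (hP.apply_const_sub_mem x) (hQ.apply_const_sub_mem x)

theorem mul (hP : HasLimit P v) (hQ : HasLimit Q w) : HasLimit (P * Q) (v * w) where
  apply_mem u hu := hP.apply_mem _ (hQ.apply_mem u hu)
  apply_const_sub_mem x := by
    rw [mul_assoc]
    exact hP.apply_sub_mem (hQ.apply_const_sub_mem x)

theorem smul (c : ℂ) (hQ : HasLimit Q w) : HasLimit (c • Q) (MvPolynomial.C c * w) := by
  rw [Algebra.smul_def]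
  exact (algebraMap c).mul hQ

theorem sub (hP : HasLimit P v) (hQ : HasLimit Q w) : HasLimit (P - Q) (v - w) where
  apply_mem u hu := sub_mem (hP.apply_mem u hu) (hQ.apply_mem u hu)
  apply_const_sub_mem x := by
    rw [sub_mul, map_sub, LinearMap.sub_apply, sub_sub_sub_comm]
    exact sub_mem (hP.apply_const_sub_mem x) (hQ.apply_const_sub_mem x)

theorem sum {α : Type*} (s : Finset α) {P : α → Module.End ℂ (MvPolynomial ι (RatField ι))}
    {v : α → MvPolynomial ι ℂ} (h : ∀ a, HasLimit (P a) (v a)) :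
    HasLimit (∑ a ∈ s, P a) (∑ a ∈ s, v a) :=
  Finset.sum_hom_rel (by simpa using algebraMap (ι := ι) 0) fun a _ _ => (h a).add

theorem univM_C {f : RatField ι} {c : ℂ} (hf : f - 𝔠 c ∈ infinitesimal ι) :
    HasLimit (univM ι f) (MvPolynomial.C c) where
  apply_mem u hu := C_mul_mem_infPoly ⟨c, hf⟩ hu
  apply_const_sub_mem v := by
    rw [univM_apply, map_mul, MvPolynomial.map_C, ← sub_mul, ← map_sub]
    exact C_mul_const_mem_infPoly hf v

theorem univD_X (i : ι) : HasLimit (univD i) (MvPolynomial.X i) where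
  apply_mem u hu := by
    rw [univD_apply]
    refine add_mem (fun β => ?_) (X_mul_mem_infPoly i hu)
    rw [coeff_coeffDeriv]
    exact theta_mem_infinitesimal i (hu β)
  apply_const_sub_mem v := by
    rw [univD_apply, coeffDeriv_map, zero_add, map_mul, MvPolynomial.map_X, sub_self]
    exact zero_mem _

theorem eval_univ (v : MvPolynomial ι ℂ) : HasLimit ((isConnection_univ ι).eval v) v := by
  induction v using MvPolynomial.induction_on with
  | C c =>
    rw [← MvPolynomial.algebraMap_eq, AlgHom.commutes]
    exact algebraMap c
  | add v w hv hw => simpa only [map_add] using hv.add hw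
  | mul_X v i hv =>
    rw [map_mul, (isConnection_univ ι).eval_X]
    exact hv.mul (univD_X i)

theorem normal_univ {u : MvPolynomial ι (RatField ι)} (hu : u - const v ∈ infPoly ι) :
    HasLimit ((isConnection_univ ι).normal u) v := by
  have normal_sub : HasLimit ((isConnection_univ ι).normal (u - const v)) 0 := by
    rw [(u - const v).as_sum, map_sum, ← Finset.sum_const_zero (s := (u - const v).support)]
    refine sum _ fun β => ?_
    have coeff_limit := univM_C (c := 0) (by simpa only [map_zero, sub_zero] using hu β)
    rw [IsConnection.normal_monomial, ← zero_mul (MvPolynomial.monomial β 1), ← map_zero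
      (MvPolynomial.C (σ := ι) (R := ℂ))]
    exact coeff_limit.mul (eval_univ _)
  rw [← sub_add_cancel u (const v), map_add, IsConnection.normal_map]
  simpa using normal_sub.add (eval_univ v)

theorem laxH_univ [DecidableEq ι] {D : ι → Module.End ℂ (MvPolynomial ι (RatField ι))}
    {d : ι → MvPolynomial ι ℂ} (hD : ∀ i, HasLimit (D i) (d i)) {k p q c : ℂ} {κ : ι → ℂ}
    (hc : laxV k p q κ - 𝔠 c ∈ infinitesimal ι) :
    HasLimit (laxH (univM ι) D k p q κ)
      (∑ i, MvPolynomial.C (κ i) * d i ^ 2 - MvPolynomial.C c) := by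
  refine (sum _ fun i => smul (κ i) ?_).sub (univM_C hc)
  rw [sq, sq]
  exact (hD i).mul (hD i)

end HasLimit

variable (ι) in
/-- The operators which have a limit at infinity. -/
def limiting : Subalgebra ℂ (Module.End ℂ (MvPolynomial ι (RatField ι))) where
  carrier := {Q | ∃ w, HasLimit Q w}
  mul_mem' := fun ⟨_, hP⟩ ⟨_, hQ⟩ => ⟨_, hP.mul hQ⟩
  add_mem' := fun ⟨_, hP⟩ ⟨_, hQ⟩ => ⟨_, hP.add hQ⟩
  algebraMap_mem' c := ⟨_, HasLimit.algebraMap c⟩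

theorem commutator_apply_one_mem_infPoly {P Q : Module.End ℂ (MvPolynomial ι (RatField ι))}
    (hP : P ∈ limiting ι) (hQ : Q ∈ limiting ι) : (P * Q - Q * P) 1 ∈ infPoly ι := by
  obtain ⟨v, hP⟩ := hP
  obtain ⟨w, hQ⟩ := hQ
  have limit := ((hP.mul hQ).sub (hQ.mul hP)).apply_const_sub_mem 1
  rwa [mul_comm w v, sub_self, zero_mul, map_zero, sub_zero, map_one] at limit

theorem laxIntegral_univ_mem_limiting [DecidableEq ι] (k p q : ℂ) (κ : ι → ℂ) (n : ℕ) :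
    laxIntegral (univM ι) univD k p q κ n ∈ limiting ι :=
  laxIntegral_mem (S := limiting ι)
    (fun a b => let ⟨_, hc⟩ := laxX_mem_regular k p q κ a b; ⟨_, HasLimit.univM_C hc⟩)
    (fun i => ⟨_, HasLimit.univD_X i⟩) n

/-- The exponent `γ` is the least exponent among the leading monomials of the coefficients. -/
theorem exists_xpow_neg_mul_coeff_mem_regular {u : MvPolynomial ι (RatField ι)} (hu : u ≠ 0) :
    ∃ γ : ι →₀ ℤ, (∀ β, xpow (-γ) * u.coeff β ∈ regular ι) ∧
      ∃ β, xpow (-γ) * u.coeff β ∉ infinitesimal ι := by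
  choose! γ c hc ε hε leading using fun (f : RatField ι) (hf : f ≠ 0) => exists_leading hf
  obtain ⟨β₀, hβ₀, hmin⟩ := Finset.exists_min_image u.support (fun β => lexExp (γ (u.coeff β)))
    (MvPolynomial.support_nonempty.2 hu)
  rw [MvPolynomial.mem_support_iff] at hβ₀
  refine ⟨γ (u.coeff β₀), fun β => ?_, β₀, fun h => ?_⟩
  · obtain hβ | hβ := eq_or_ne (u.coeff β) 0
    · rw [hβ, mul_zero]
      exact zero_mem _
    have regular_factor : 𝔠 (c (u.coeff β)) + ε (u.coeff β) ∈ regular ι :=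
      add_mem (algebraMap_mem _ _) (mem_regular_of_mem_infinitesimal (hε _ hβ))
    rw [leading _ hβ, ← mul_assoc, ← xpow_add]
    rcases (hmin β (MvPolynomial.mem_support_iff.2 hβ)).eq_or_lt with heq | hlt
    · rwa [lexExp_injective heq, neg_add_cancel, xpow_zero, one_mul]
    · refine mul_mem (mem_regular_of_mem_infinitesimal (xpow_mem_infinitesimal ?_)) regular_factor
      rwa [map_add, map_neg, lt_neg_add_iff_add_lt, add_zero]
  · nth_rewrite 2 [leading _ hβ₀] at h
    rw [← mul_assoc, ← xpow_add, neg_add_cancel, xpow_zero, one_mul] at h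
    have constant_mem := sub_mem h (hε _ hβ₀)
    rw [add_sub_cancel_right] at constant_mem
    exact hc _ hβ₀ (eq_zero_of_algebraMap_mem_infinitesimal constant_mem)

theorem exists_leading_poly {u : MvPolynomial ι (RatField ι)} (hu : u ≠ 0) :
    ∃ (γ : ι →₀ ℤ) (v : MvPolynomial ι ℂ) (u' : MvPolynomial ι (RatField ι)),
      v ≠ 0 ∧ u' - const v ∈ infPoly ι ∧ u = MvPolynomial.C (xpow γ) * u' := by
  classical
  obtain ⟨γ, mem_regular, β₀, not_infinitesimal⟩ := exists_xpow_neg_mul_coeff_mem_regular hu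
  choose r hr using mem_regular
  have limit_mem : MvPolynomial.C (xpow (-γ)) * u -
      const (∑ β ∈ u.support, MvPolynomial.monomial β (r β)) ∈ infPoly ι := by
    intro β
    simp only [MvPolynomial.coeff_sub, MvPolynomial.coeff_C_mul, MvPolynomial.coeff_map,
      MvPolynomial.coeff_sum, MvPolynomial.coeff_monomial, Finset.sum_ite_eq']
    split_ifs with h
    · exact hr β
    · rw [MvPolynomial.notMem_support_iff.1 h, mul_zero, map_zero, sub_zero]
      exact zero_mem _
  refine ⟨γ, _, _, fun limit_eq_zero => not_infinitesimal ?_, limit_mem, ?_⟩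
  · rw [limit_eq_zero, map_zero, sub_zero] at limit_mem
    simpa only [MvPolynomial.coeff_C_mul] using limit_mem β₀
  · rw [← mul_assoc, ← map_mul, xpow_mul_xpow_neg, map_one, one_mul]

theorem eq_zero_of_sum_C_mul_add_sq_eq {κ γ : ι → ℂ} (hκ : ∀ i, κ i ≠ 0)
    (h : ∑ i, MvPolynomial.C (κ i) * (MvPolynomial.X i + MvPolynomial.C (γ i)) ^ 2 =
      ∑ i, MvPolynomial.C (κ i) * MvPolynomial.X i ^ 2) : γ = 0 := by
  classical
  ext i
  have linear_coeff := congrArg (MvPolynomial.eval 0 ∘ MvPolynomial.pderiv i) h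
  simpa [MvPolynomial.pderiv_X, Pi.single_apply, hκ, Derivation.leibniz_pow,
    map_ofNat MvPolynomial.constantCoeff 2] using linear_coeff

variable [DecidableEq ι]

theorem IsConnection.semiconjBy_xpow_laxH {R : Type} [Ring R] [Algebra ℂ R]
    {m : RatField ι →ₐ[ℂ] R} {D : ι → R} (hD : IsConnection m D) (k p q : ℂ) (κ : ι → ℂ)
    (γ : ι →₀ ℤ) : SemiconjBy (m (xpow γ))
      (laxH m (fun i => D i + algebraMap ℂ R (γ i)) k p q κ) (laxH m D k p q κ) := by
  refine SemiconjBy.sub_right ?_ ?_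
  · simp only [SemiconjBy, Finset.mul_sum, Finset.sum_mul, mul_smul_comm, smul_mul_assoc,
      ((hD.semiconjBy_xpow γ _).pow_right 2).eq]
  · rw [SemiconjBy, ← map_mul, ← map_mul, mul_comm]

/-- If `u = x ^ γ * u'` with `u'` having the limit `v` at infinity, then comparing the leading terms
of both sides of the commutation relation gives `h(λ + γ) * v = v * h(λ)` for the quadratic form
`h(λ) = ∑ κ_i λ_i ^ 2`, hence `γ = 0`. -/
theorem eq_zero_of_normal_commute_laxH {k p q : ℂ} {κ : ι → ℂ} (hκ : ∀ i, κ i ≠ 0)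
    {u : MvPolynomial ι (RatField ι)} (hu : u ∈ infPoly ι)
    (normal_apply_one : (isConnection_univ ι).normal u 1 = u)
    (hc : Commute ((isConnection_univ ι).normal u) (laxH (univM ι) univD k p q κ)) : u = 0 := by
  by_contra hne
  obtain ⟨γ, v, u', hv, limit, rfl⟩ := exists_leading_poly hne
  obtain ⟨c, hV⟩ := laxV_mem_regular k p q κ
  have shifted_apply : laxH (univM ι) (fun i => univD i + algebraMap ℂ _ (γ i : ℂ)) k p q κ u' =
      (isConnection_univ ι).normal u' (laxH (univM ι) univD k p q κ 1) := by
    have commuted := LinearMap.congr_fun hc.eq 1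
    rw [Module.End.mul_apply, Module.End.mul_apply, normal_apply_one, IsConnection.normal_C_mul,
      Module.End.mul_apply, ← univM_apply, ← Module.End.mul_apply (laxH _ _ _ _ _ _),
      ← ((isConnection_univ ι).semiconjBy_xpow_laxH k p q κ γ).eq] at commuted
    exact (mul_left_cancel₀ (by simpa using xpow_ne_zero γ) commuted).symm
  have laxH_one := (HasLimit.laxH_univ HasLimit.univD_X hV).apply_const_sub_mem 1
  rw [map_one] at laxH_one
  have symbols_eq := HasLimit.eq_of_apply_eq
    (HasLimit.laxH_univ (fun i => (HasLimit.univD_X i).add (.algebraMap (γ i : ℂ))) hV)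
    (HasLimit.normal_univ limit) limit laxH_one shifted_apply
  rw [mul_one, mul_comm v] at symbols_eq
  have exponents_eq_zero :=
    eq_zero_of_sum_C_mul_add_sq_eq hκ (sub_left_injective (mul_right_cancel₀ hv symbols_eq))
  obtain rfl : γ = 0 := by
    ext i
    simpa using congrFun exponents_eq_zero i
  refine hv (eq_zero_of_const_mem_infPoly ?_)
  rw [xpow_zero, map_one, one_mul] at hu
  simpa only [sub_sub_cancel] using sub_mem hu limit

theorem laxIntegral_univ_commutator_apply_one {k : ℂ} {κ : ι → ℂ} (h : IsWeight k κ) (p q : ℂ)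
    (n n' : ℕ) : (laxIntegral (univM ι) univD k p q κ n * laxIntegral (univM ι) univD k p q κ n'
      - laxIntegral (univM ι) univD k p q κ n' * laxIntegral (univM ι) univD k p q κ n) 1 = 0 := by
  set P := laxIntegral (univM ι) univD k p q κ n
  set P' := laxIntegral (univM ι) univD k p q κ n'
  have hU := isConnection_univ ι
  have hP : Commute P _ := commute_laxIntegral_laxH (p := p) (q := q) h hU n
  have hP' : Commute P' _ := commute_laxIntegral_laxH (p := p) (q := q) h hU n'
  have normal_commutator : hU.normal ((P * P' - P' * P) 1) = P * P' - P' * P := by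
    simp only [P, P', LinearMap.sub_apply, Module.End.mul_apply, map_sub, hU.normal_laxIntegral,
      hU.normal_one, mul_one]
  refine eq_zero_of_normal_commute_laxH (k := k) (p := p) (q := q) h.ne_zero
    (commutator_apply_one_mem_infPoly (laxIntegral_univ_mem_limiting k p q κ n)
      (laxIntegral_univ_mem_limiting k p q κ n')) ?_ ?_
  · rw [normal_commutator]
  · rw [normal_commutator]
    exact (hP.mul_left hP').sub_left (hP'.mul_left hP)

theorem commute_laxIntegral {R : Type} [Ring R] [Algebra ℂ R] {m : RatField ι →ₐ[ℂ] R} {D : ι → R}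
    (hD : IsConnection m D) {k p q : ℂ} {κ : ι → ℂ} (h : IsWeight k κ) (n n' : ℕ) :
    Commute (laxIntegral m D k p q κ n) (laxIntegral m D k p q κ n') := by
  have normal_eq := congrArg hD.normal (laxIntegral_univ_commutator_apply_one h p q n n')
  simp only [LinearMap.sub_apply, Module.End.mul_apply, map_sub, hD.normal_laxIntegral,
    hD.normal_one, mul_one, map_zero] at normal_eq
  exact sub_eq_zero.1 normal_eq

end Commutativity

/-! ### The deformed system -/

section DeformedSystem

variable (ι : Type)

/-- The action of the rational functions on themselves by multiplication. -/
def mulHom : RatField ι →ₐ[ℂ] Module.End ℂ (RatField ι) := Algebra.lmul ℂ (RatField ι)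

theorem isConnection_theta : IsConnection (mulHom ι) thetaOp where
  comm i j := LinearMap.ext fun f => theta_comm i j f
  leibniz i f := by
    refine LinearMap.ext fun g => ?_
    change theta i (f * g) = f * theta i g + theta i f * g
    rw [Derivation.leibniz, smul_eq_mul, smul_eq_mul, mul_comm g]

variable {ι}

theorem mulOp_eq (f : RatField ι) : mulOp f = mulHom ι f := rfl

local notation "𝔠" => algebraMap ℂ (RatField ι)

theorem mulHom_algebraMap_mul (c : ℂ) (f : RatField ι) : mulHom ι (𝔠 c * f) = c • mulOp f := by
  rw [← Algebra.smul_def, map_smul, mulOp_eq]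

theorem coth_sq_sub_one {a b : ι ⊕ ι} (h : a ≠ b) :
    coth a b ^ 2 - 1 = 4 * (svar a * svar b / (svar a - svar b) ^ 2) := by
  have := svar_sub_ne_zero h
  rw [coth]
  field_simp
  ring

theorem coth_swap_sq_sub_one {a b : ι ⊕ ι} (h : a ≠ b.swap) :
    coth a b.swap ^ 2 - 1 = 4 * (svar a * svar b / (svar a * svar b - 1) ^ 2) := by
  have := svar_mul_sub_one_ne_zero h
  rw [coth_swap_right_eq]
  field_simp
  ring

theorem cothOne_sq_sub_one (a : ι ⊕ ι) :
    cothOne a ^ 2 - 1 = 4 * (svar a / (svar a - 1) ^ 2) := by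
  have := svar_sub_one_ne_zero a
  rw [cothOne]
  field_simp
  ring

/-- The potential `x_i x_j / (x_i - x_j) ^ 2 + x_i x_j / (x_i x_j - 1) ^ 2` of a pair of
variables. -/
def pairPot (i j : ι) : RatField ι :=
  var i * var j / (var i - var j) ^ 2 + var i * var j / (var i * var j - 1) ^ 2

theorem pairPot_comm (i j : ι) : pairPot i j = pairPot j i := by
  rw [pairPot, pairPot, mul_comm (var i), ← neg_sub (var i), neg_sq]

/-- The potential of a single variable with coefficients `c` and `c'` at its two terms. -/
def singlePot (c c' : ℂ) (i : ι) : RatField ι :=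
  𝔠 c * (var i / (var i - 1) ^ 2) + 𝔠 c' * (var i ^ 2 / (var i ^ 2 - 1) ^ 2)

theorem laxS_inl (p q : ℂ) (κ : ι → ℂ) (i : ι) :
    laxS p q κ (Sum.inl i) =
      𝔠 ((κ i)⁻¹ * (p / 2 + (q + (1 - κ i) / 2)) ^ 2)
      + singlePot ((κ i)⁻¹ * (p ^ 2 + 2 * p * (q + (1 - κ i) / 2)) + p)
          ((κ i)⁻¹ * (4 * (q + (1 - κ i) / 2) ^ 2) + 4 * (q + (1 - κ i) / 2)) i := by
  have cothOne_sq := cothOne_sq_sub_one (Sum.inl i : ι ⊕ ι)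
  have coth_sq := coth_swap_sq_sub_one (sum_swap_ne (Sum.inl i : ι ⊕ ι)).symm
  have duplication := coth_duplication_formula (Sum.inl i : ι ⊕ ι)
  rw [← sq] at coth_sq
  rw [laxS, laxZDeriv_eq, laxZ, singlePot]
  simp only [svar, sweight, Sum.elim_inl] at *
  set ν := q + (1 - κ i) / 2
  simp only [map_mul, map_add, map_pow, map_div₀, map_ofNat]
  linear_combination ((𝔠 (κ i)⁻¹) * ((𝔠 p / 2) ^ 2 + 𝔠 p / 2 * 𝔠 ν) + 𝔠 p / 4) * cothOne_sq
    + ((𝔠 (κ i)⁻¹) * (𝔠 ν) ^ 2 + 𝔠 ν) * coth_sq + (𝔠 (κ i)⁻¹) * (𝔠 p / 2 * 𝔠 ν) * duplication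

variable [DecidableEq ι]

theorem laxW_add_laxW_swap (k : ℂ) (κ : ι → ℂ) {i j : ι} (h : j ≠ i) :
    laxW k κ (Sum.inl i) (Sum.inl j) + laxW k κ (Sum.inl i) (Sum.inr j) =
      𝔠 (2 * k / κ j * (1 + k / κ i ^ 2)) * pairPot i j := by
  have difference := coth_sq_sub_one (Sum.inl_injective.ne h.symm : (Sum.inl i : ι ⊕ ι) ≠ Sum.inl j)
  have product := coth_swap_sq_sub_one (a := Sum.inl i) (b := Sum.inl j) Sum.inl_ne_inr
  rw [Sum.swap_inl] at product
  simp only [laxW, Sum.swap_inl, Sum.inl.injEq, Sum.inr.injEq, h, reduceCtorEq, if_false,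
    difference, product]
  rw [show 2 * k / κ j * (1 + k / κ i ^ 2) = 4 * (k / (2 * κ j) * (1 + k / κ i ^ 2)) by ring,
    pairPot, map_mul 𝔠 4, map_ofNat]
  simp only [svar, sweight, Sum.elim_inl, Sum.elim_inr]
  ring

theorem laxL_swap_swap {R : Type} [Ring R] [Algebra ℂ R] (m : RatField ι →ₐ[ℂ] R) (D : ι → R)
    (k p q : ℂ) (κ : ι → ℂ) (a b : ι ⊕ ι) :
    laxL m D k p q κ a.swap b.swap = -laxL m D k p q κ a b := by
  have signedOp_swap : signedOp D a.swap = -signedOp D a := by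
    rcases a with a | a <;> simp [signedOp]
  simp only [laxL, Matrix.of_apply, laxX, Sum.swap_leftInverse.injective.eq_iff, Sum.swap_swap,
    swap_eq_iff_eq_swap, sweight_swap, signedOp_swap, coth_swap_swap, laxZ_swap]
  split_ifs <;> simp [add_comm]

variable [Fintype ι]

theorem sum_laxW_inl (k : ℂ) (κ : ι → ℂ) (i : ι) :
    ∑ c, laxW k κ (Sum.inl i) c =
      ∑ j ∈ {i}ᶜ, 𝔠 (2 * k / κ j * (1 + k / κ i ^ 2)) * pairPot i j := by
  rw [Fintype.sum_sum_type, ← Finset.sum_add_distrib, ← Finset.sum_compl_add_sum {i},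
    Finset.sum_singleton]
  have diagonal : laxW k κ (Sum.inl i) (Sum.inl i) + laxW k κ (Sum.inl i) (Sum.inr i) = 0 := by
    simp [laxW]
  rw [diagonal, add_zero]
  exact Finset.sum_congr rfl fun j hj => laxW_add_laxW_swap k κ (by simpa using hj)

theorem laxV_eq (k p q : ℂ) (κ : ι → ℂ) :
    laxV k p q κ = 𝔠 (1 / 2) * ∑ i, ∑ j ∈ {i}ᶜ, 𝔠 (2 * k / κ j * (1 + k / κ i ^ 2)) * pairPot i j
      + ∑ i, laxS p q κ (Sum.inl i) := by
  have sum_S_inr : ∑ i, laxS p q κ (Sum.inr i) = ∑ i, laxS p q κ (Sum.inl i) :=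
    Finset.sum_congr rfl fun i _ => laxS_swap (Sum.inl i)
  have sum_W_inr (i : ι) : ∑ c, laxW k κ (Sum.inr i) c = ∑ c, laxW k κ (Sum.inl i) c := by
    rw [← sum_comp_swap]
    exact Finset.sum_congr rfl fun c _ => laxW_swap_swap (Sum.inl i) c
  rw [laxV, Fintype.sum_sum_type, Fintype.sum_sum_type, sum_S_inr]
  simp only [sum_W_inr, sum_laxW_inl, map_div₀, map_one, map_ofNat]
  ring

end DeformedSystem

section OffDiagonal

theorem sum_compl_singleton_comm {α M : Type*} [Fintype α] [LinearOrder α]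
    [LocallyFiniteOrderTop α] [LocallyFiniteOrderBot α] [AddCommMonoid M] (F : α → α → M)
    (hF : ∀ i j, F i j = F j i) :
    ∑ i, ∑ j ∈ {i}ᶜ, F i j = 2 • ∑ i, ∑ j ∈ Finset.Ioi i, F i j := by
  simp only [Finset.smul_sum, two_smul]
  rw [← Finset.sum_sum_Ioi_add_eq_sum_sum_off_diag fun j i => F i j]
  simp only [fun i j => hF j i]

variable {α β M : Type*} [Fintype α] [Fintype β] [DecidableEq α] [DecidableEq β] [AddCommMonoid M]

theorem sum_compl_inl (i : α) (F : α ⊕ β → M) :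
    ∑ j ∈ {Sum.inl i}ᶜ, F j = ∑ j ∈ {i}ᶜ, F (Sum.inl j) + ∑ j, F (Sum.inr j) := by
  rw [← Finset.sum_disjSum]
  congr 1
  ext (j | j) <;> simp

theorem sum_compl_inr (i : β) (F : α ⊕ β → M) :
    ∑ j ∈ {Sum.inr i}ᶜ, F j = ∑ j, F (Sum.inl j) + ∑ j ∈ {i}ᶜ, F (Sum.inr j) := by
  rw [← Finset.sum_disjSum]
  congr 1
  ext (j | j) <;> simp

end OffDiagonal

section Deformed

variable {n m : ℕ} {k p q r s : ℂ}

local notation "𝔠" => algebraMap ℂ (RatField (Idx n m))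

/-- The weights `k ^ p(i)` of the deformed system. -/
def parityWeight (n m : ℕ) (k : ℂ) (i : Idx n m) : ℂ := k ^ parity i

theorem parityWeight_inl (i : Fin n) : parityWeight n m k (Sum.inl i) = 1 := pow_zero k

theorem parityWeight_inr (j : Fin m) : parityWeight n m k (Sum.inr j) = k := pow_one k

theorem isWeight_parityWeight (hk : k ≠ 0) : IsWeight k (parityWeight n m k) where
  eq_or i := by rcases i with i | i <;> simp [parityWeight_inl, parityWeight_inr]
  ne_zero i := pow_ne_zero _ hk

theorem pow_one_sub_parity_div_two (hk : k ≠ 0) (j : Idx n m) :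
    k ^ (1 - parity j) / 2 = k / (2 * parityWeight n m k j) := by
  rcases j with j | j
  · simp [parity, parityWeight_inl]
  · rw [parityWeight_inr]
    simp only [parity, Sum.elim_inr]
    field_simp
    simp

theorem moserA_eq (hk : k ≠ 0) (i j : Idx n m) :
    moserA n m k i j =
      laxL (mulHom _) thetaOp k p q (parityWeight n m k) (Sum.inl i) (Sum.inl j) := by
  simp only [moserA, laxL, Matrix.of_apply, laxX, Sum.inl.injEq, Sum.swap_inl, reduceCtorEq,
    if_false, @eq_comm _ j i, pow_one_sub_parity_div_two hk]
  split_ifs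
  · rw [map_zero, add_zero]; rfl
  · rw [mulHom_algebraMap_mul, zero_add]; rfl

theorem moserB_eq (hk : k ≠ 0) (hp : p = k * r) (hq : 2 * q + 1 = k * (2 * s + 1))
    (i j : Idx n m) : moserB n m k p q r s i j =
      laxL (mulHom _) thetaOp k p q (parityWeight n m k) (Sum.inl i) (Sum.inr j) := by
  have weight_mul_μ : k ^ parity i * Sum.elim (fun _ => p) (fun _ => r) i / 2 = p / 2 := by
    rcases i with i | i <;> simp [parity, hp]
  have weight_mul_ν : k ^ parity i * Sum.elim (fun _ => q) (fun _ => s) i =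
      q + (1 - parityWeight n m k i) / 2 := by
    rcases i with i | i <;> simp only [parity, parityWeight, Sum.elim_inl, Sum.elim_inr]
    · ring
    · linear_combination -hq / 2
  simp only [moserB, laxL, Matrix.of_apply, laxX, Sum.inr.injEq, Sum.swap_inl, reduceCtorEq,
    if_false, @eq_comm _ j i, pow_one_sub_parity_div_two hk, zero_add, weight_mul_μ, weight_mul_ν]
  split_ifs
  · rw [laxZ, map_add, mulHom_algebraMap_mul, mulHom_algebraMap_mul, coth_swap_self]; rfl
  · rw [mulHom_algebraMap_mul]
    exact congrArg (_ • mulOp ·) (coth_swap_right_eq (Sum.inl i) (Sum.inl j)).symm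

theorem moser_eq (hk : k ≠ 0) (hp : p = k * r) (hq : 2 * q + 1 = k * (2 * s + 1)) :
    moser n m k p q r s = laxL (mulHom _) thetaOp k p q (parityWeight n m k) := by
  ext1 a b
  rcases a with i | i <;> rcases b with j | j
  · exact moserA_eq hk i j
  · exact moserB_eq hk hp hq i j
  · change -moserB n m k p q r s i j = _
    rw [moserB_eq hk hp hq, ← laxL_swap_swap]; rfl
  · change -moserA n m k i j = _
    rw [moserA_eq hk, ← laxL_swap_swap]; rfl

theorem deformedIntegral_eq (hk : k ≠ 0) (hp : p = k * r) (hq : 2 * q + 1 = k * (2 * s + 1))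
    (l : ℕ) : deformedIntegral n m k p q r s l =
      laxIntegral (mulHom _) thetaOp k p q (parityWeight n m k) (2 * l) := by
  have eStar_eq (a) : eStar n m k a = (sweight (parityWeight n m k) a)⁻¹ := by cases a <;> rfl
  simp only [deformedIntegral, moser_eq hk hp hq, laxIntegral, eStar_eq]

theorem sum_pairPot_parityWeight (hk : k ≠ 0) :
    ∑ i, ∑ j ∈ {i}ᶜ, 𝔠 (2 * k / parityWeight n m k j * (1 + k / parityWeight n m k i ^ 2)) *
        pairPot i j =
      2 * (𝔠 (2 * k * (k + 1)) * ∑ i : Fin n, ∑ j ∈ Finset.Ioi i, pairPot (Sum.inl i) (Sum.inl j)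
      + 𝔠 (2 * (k⁻¹ + 1)) * ∑ i : Fin m, ∑ j ∈ Finset.Ioi i, pairPot (Sum.inr i) (Sum.inr j)
      + 𝔠 (2 * (k + 1)) * ∑ i : Fin n, ∑ j : Fin m, pairPot (Sum.inl i) (Sum.inr j)) := by
  have coupling_xx : 2 * k / 1 * (1 + k / 1 ^ 2) = 2 * k * (k + 1) := by ring
  have coupling_xy : 2 * k / k * (1 + k / 1 ^ 2) = 2 * (k + 1) := by field_simp; ring
  have coupling_yx : 2 * k / 1 * (1 + k / k ^ 2) = 2 * (k + 1) := by field_simp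
  have coupling_yy : 2 * k / k * (1 + k / k ^ 2) = 2 * (k⁻¹ + 1) := by field_simp; ring
  have sum_xx := sum_compl_singleton_comm (fun i j : Fin n =>
    pairPot (Sum.inl i : Idx n m) (Sum.inl j)) fun i j => pairPot_comm _ _
  have sum_yy := sum_compl_singleton_comm (fun i j : Fin m =>
    pairPot (Sum.inr i : Idx n m) (Sum.inr j)) fun i j => pairPot_comm _ _
  have sum_yx : ∑ i : Fin m, ∑ j : Fin n, pairPot (Sum.inr i : Idx n m) (Sum.inl j) =
      ∑ i : Fin n, ∑ j : Fin m, pairPot (Sum.inl i) (Sum.inr j) := by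
    rw [Finset.sum_comm]
    exact Finset.sum_congr rfl fun i _ => Finset.sum_congr rfl fun j _ => pairPot_comm _ _
  rw [Fintype.sum_sum_type]
  simp only [sum_compl_inl, sum_compl_inr, parityWeight_inl, parityWeight_inr, coupling_xx,
    coupling_xy, coupling_yx, coupling_yy, ← Finset.mul_sum, Finset.sum_add_distrib, sum_xx,
    sum_yy, sum_yx, nsmul_eq_mul]
  push_cast
  ring

theorem laxS_parityWeight_inl (i : Fin n) :
    laxS p q (parityWeight n m k) (Sum.inl (Sum.inl i)) =
      𝔠 ((p / 2 + q) ^ 2) + singlePot (p * (p + 2 * q + 1)) (4 * q * (q + 1)) (Sum.inl i) := by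
  rw [laxS_inl, parityWeight_inl]
  congr 2 <;> ring

theorem laxS_parityWeight_inr (hk : k ≠ 0) (hp : p = k * r) (hq : 2 * q + 1 = k * (2 * s + 1))
    (j : Fin m) : laxS p q (parityWeight n m k) (Sum.inl (Sum.inr j)) =
      𝔠 (k * (r / 2 + s) ^ 2)
        + singlePot (k * r * (r + 2 * s + 1)) (4 * k * s * (s + 1)) (Sum.inr j) := by
  have multiplicity : q + (1 - k) / 2 = k * s := by linear_combination hq / 2
  rw [laxS_inl, parityWeight_inr, multiplicity, hp]
  congr 2 <;> field_simp

theorem laxV_parityWeight (hk : k ≠ 0) (hp : p = k * r) (hq : 2 * q + 1 = k * (2 * s + 1)) :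
    laxV k p q (parityWeight n m k) =
      𝔠 (2 * k * (k + 1)) * ∑ i : Fin n, ∑ j ∈ Finset.Ioi i, pairPot (Sum.inl i) (Sum.inl j)
      + 𝔠 (2 * (k⁻¹ + 1)) * ∑ i : Fin m, ∑ j ∈ Finset.Ioi i, pairPot (Sum.inr i) (Sum.inr j)
      + 𝔠 (2 * (k + 1)) * ∑ i : Fin n, ∑ j : Fin m, pairPot (Sum.inl i) (Sum.inr j)
      + ∑ i : Fin n, singlePot (p * (p + 2 * q + 1)) (4 * q * (q + 1)) (Sum.inl i)
      + ∑ j : Fin m, singlePot (k * r * (r + 2 * s + 1)) (4 * k * s * (s + 1)) (Sum.inr j)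
      + 𝔠 (n * (p / 2 + q) ^ 2 + m * (k * (r / 2 + s) ^ 2)) := by
  rw [laxV_eq, sum_pairPot_parityWeight hk, Fintype.sum_sum_type]
  simp only [laxS_parityWeight_inl, laxS_parityWeight_inr hk hp hq, Finset.sum_add_distrib,
    Finset.sum_const, Finset.card_univ, Fintype.card_fin, nsmul_eq_mul]
  simp only [map_add, map_mul, map_div₀, map_one, map_ofNat, map_natCast]
  ring

theorem sum_parityWeight_smul_thetaOp_sq :
    ∑ i, parityWeight n m k i • thetaOp i ^ 2 =
      ∑ i : Fin n, thetaOp (ι := Idx n m) (Sum.inl i) ^ 2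
        + k • ∑ j : Fin m, thetaOp (ι := Idx n m) (Sum.inr j) ^ 2 := by
  simp only [Fintype.sum_sum_type, Finset.smul_sum, parityWeight_inl, parityWeight_inr, one_smul]

theorem deformedCMS_eq (hk : k ≠ 0) (hp : p = k * r) (hq : 2 * q + 1 = k * (2 * s + 1)) :
    deformedCMS n m k p q r s = laxH (mulHom _) thetaOp k p q (parityWeight n m k)
      + algebraMap ℂ _ (n * (p / 2 + q) ^ 2 + m * (k * (r / 2 + s) ^ 2)) := by
  rw [laxH, laxV_parityWeight hk hp hq, deformedCMS, sum_parityWeight_smul_thetaOp_sq]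
  generalize (n * (p / 2 + q) ^ 2 + m * (k * (r / 2 + s) ^ 2) : ℂ) = c
  simp only [mulOp_eq, pairPot, singlePot, ← Algebra.smul_def, map_add, map_sum, map_smul,
    AlgHom.commutes]
  abel

theorem commute_deformedIntegral_deformedCMS (hk : k ≠ 0) (hp : p = k * r)
    (hq : 2 * q + 1 = k * (2 * s + 1)) (l : ℕ) :
    Commute (deformedIntegral n m k p q r s l) (deformedCMS n m k p q r s) := by
  rw [deformedIntegral_eq hk hp hq, deformedCMS_eq hk hp hq]
  exact (commute_laxIntegral_laxH (isWeight_parityWeight hk) (isConnection_theta _) _).add_right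
    (Algebra.commutes _ _).symm

theorem commute_deformedIntegral (hk : k ≠ 0) (hp : p = k * r)
    (hq : 2 * q + 1 = k * (2 * s + 1)) (l l' : ℕ) :
    Commute (deformedIntegral n m k p q r s l) (deformedIntegral n m k p q r s l') := by
  rw [deformedIntegral_eq hk hp hq, deformedIntegral_eq hk hp hq]
  exact commute_laxIntegral (isConnection_theta _) (isWeight_parityWeight hk) _ _

end Deformed

/-! ### Specialization of the operators at infinity to signed variables -/

section Specialization

theorem add_mul_pow_sub_pow {R : Type*} [CommRing R] (x y : R) {l : ℕ} (hl : 0 < l) :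
    (x + y) * (x ^ l - y ^ l) =
      (x - y) * (x ^ l + y ^ l + 2 * ∑ j ∈ Finset.Ico 1 l, y ^ j * x ^ (l - j)) := by
  have factor : ∑ j ∈ Finset.Ico 1 l, y ^ j * x ^ (l - j) =
      x * ∑ j ∈ Finset.Ico 1 l, y ^ j * x ^ (l - 1 - j) := by
    rw [Finset.mul_sum]
    refine Finset.sum_congr rfl fun j hj => ?_
    rw [Finset.mem_Ico] at hj
    rw [mul_left_comm, ← pow_succ']
    congr 2
    omega
  have geometric := (Commute.all y x).mul_geom_sum₂_Ico hl
  have pow_eq := mul_pow_sub_one hl.ne' x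
  rw [pow_one] at geometric
  rw [factor]
  linear_combination 2 * x * geometric - 2 * y * pow_eq

variable {N : ℕ}

theorem stheta_svar_zpow (a b : Fin N ⊕ Fin N) (l : ℤ) :
    stheta a (svar b ^ l) = ((l : ℂ) * spair a b) • svar b ^ l := by
  rw [Derivation.leibniz_zpow, stheta_svar, smul_comm _ (spair a b), smul_eq_mul,
    zpow_sub_one₀ (svar_ne_zero b), inv_mul_cancel_right₀ (svar_ne_zero b), mul_comm, mul_smul,
    Int.cast_smul_eq_zsmul, smul_comm]

variable (N) in
/-- The extension of `phi N` to `Λ̄[x, x⁻¹]` with `x ↦ svar a`. Thus `phiX N i` occurs for the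
positive sign, and the inversion `x ↦ x⁻¹` turns into the exchange of the two signs. -/
def phiAt (a : Fin N ⊕ Fin N) : LambdaBarX →+* RatField (Fin N) :=
  LaurentPolynomial.eval₂ (phi N).toRingHom (Units.mk0 (svar a) (svar_ne_zero a))

theorem phiAt_C (a : Fin N ⊕ Fin N) (c : LambdaBar) :
    phiAt N a (LaurentPolynomial.C c) = phi N c :=
  LaurentPolynomial.eval₂_C _ _ _

theorem phiAt_T (a : Fin N ⊕ Fin N) (l : ℤ) :
    phiAt N a (LaurentPolynomial.T l) = svar a ^ l := by
  rw [phiAt, LaurentPolynomial.eval₂_T, Units.val_zpow_eq_zpow_val, Units.val_mk0]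

theorem phiAt_single (a : Fin N ⊕ Fin N) (l : ℤ) (c : LambdaBar) :
    phiAt N a (AddMonoidAlgebra.single l c) = phi N c * svar a ^ l := by
  rw [LaurentPolynomial.single_eq_C_mul_T, map_mul, phiAt_C, phiAt_T]

theorem phiAt_smul (a : Fin N ⊕ Fin N) (c : LambdaBar) (F : LambdaBarX) :
    phiAt N a (c • F) = phi N c * phiAt N a F := by
  rw [LaurentPolynomial.smul_eq_C_mul, map_mul, phiAt_C]

theorem phiAt_complex_smul (a : Fin N ⊕ Fin N) (c : ℂ) (F : LambdaBarX) :
    phiAt N a (c • F) = c • phiAt N a F := by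
  rw [← algebraMap_smul LambdaBar c F, phiAt_smul, AlgHom.commutes, Algebra.smul_def]

theorem phiAt_invert (a : Fin N ⊕ Fin N) (F : LambdaBarX) :
    phiAt N a (LaurentPolynomial.invert F) = phiAt N a.swap F := by
  induction F using AddMonoidAlgebra.induction_linear with
  | zero => simp
  | add F G hF hG => rw [map_add, map_add, map_add, hF, hG]
  | single l c =>
    rw [LaurentPolynomial.single_eq_C_mul_T, map_mul, map_mul, map_mul,
      LaurentPolynomial.invert_C, LaurentPolynomial.invert_T, phiAt_C, phiAt_C, phiAt_T, phiAt_T,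
      svar_swap, inv_zpow']

theorem phi_pgen_natCast (l : ℕ) : phi N (pgen l) = ∑ a : Fin N ⊕ Fin N, svar a ^ l := by
  rw [pgen, phi, MvPolynomial.aeval_X, Fintype.sum_sum_type, Finset.sum_add_distrib]
  rfl

theorem phi_pgen (j : ℤ) : phi N (pgen j) = ∑ a : Fin N ⊕ Fin N, svar a ^ j := by
  obtain ⟨l, rfl | rfl⟩ := j.eq_nat_or_neg
  · simp only [phi_pgen_natCast, zpow_natCast]
  · rw [pgen, Int.natAbs_neg, ← pgen, phi_pgen_natCast, ← sum_comp_swap]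
    simp only [svar_swap, inv_pow, zpow_neg, zpow_natCast]

theorem phi_traceE (F : LambdaBarX) : phi N (traceE F) = ∑ a, phiAt N a F := by
  induction F using AddMonoidAlgebra.induction_linear with
  | zero => simp
  | add F G hF hG => simp only [map_add, hF, hG, Finset.sum_add_distrib]
  | single l c =>
    simp only [traceE, onPowers_single, smul_eq_mul, map_mul, phi_pgen, phiAt_single,
      Finset.mul_sum]

theorem stheta_phi_X (a : Fin N ⊕ Fin N) (l : ℕ) :
    stheta a (phi N (MvPolynomial.X l)) = phiAt N a (derivP (MvPolynomial.X l)) := by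
  have phi_X : phi N (MvPolynomial.X l) = ∑ b : Fin N ⊕ Fin N, svar b ^ (l : ℤ) := phi_pgen l
  rw [phi_X, derivP, MvPolynomial.mkDerivation_X, phiAt_complex_smul, map_sub, phiAt_T, phiAt_T,
    map_sum]
  simp only [stheta_svar_zpow, mul_smul, ← Finset.smul_sum, sum_spair_smul, svar_swap, inv_zpow',
    Int.cast_natCast]

theorem stheta_phi (a : Fin N ⊕ Fin N) (f : LambdaBar) :
    stheta a (phi N f) = phiAt N a (derivP f) := by
  induction f using MvPolynomial.induction_on with
  | C c =>
    rw [← MvPolynomial.algebraMap_eq, AlgHom.commutes, Derivation.map_algebraMap,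
      Derivation.map_algebraMap, map_zero]
  | add f g hf hg => simp only [map_add, hf, hg]
  | mul_X f l hf =>
    simp only [map_mul, Derivation.leibniz, map_add, phiAt_smul, hf, stheta_phi_X, smul_eq_mul]

theorem phiAt_derivInf (a : Fin N ⊕ Fin N) (F : LambdaBarX) :
    phiAt N a (derivInf F) = stheta a (phiAt N a F) := by
  induction F using AddMonoidAlgebra.induction_linear with
  | zero => simp
  | add F G hF hG => simp only [map_add, hF, hG]
  | single l c =>
    change phiAt N a (derivLin _) = _
    rw [derivLin_single, phiAt_single, map_mul, map_add, phiAt_complex_smul, phiAt_C, phiAt_T,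
      Derivation.leibniz, stheta_svar_zpow, stheta_phi, spair_self]
    simp only [smul_eq_mul, Algebra.smul_def, mul_one]
    ring

theorem coth_mul_pow_sub_pow {a b : Fin N ⊕ Fin N} (h : a ≠ b) {l : ℕ} (hl : 0 < l) :
    coth a b * (svar a ^ l - svar b ^ l) = svar a ^ l + svar b ^ l
      + 2 * ∑ j ∈ Finset.Ico 1 l, svar b ^ j * svar a ^ (l - j) := by
  rw [coth, div_mul_eq_mul_div, add_mul_pow_sub_pow _ _ hl,
    mul_div_cancel_left₀ _ (svar_sub_ne_zero h)]

theorem sum_coth_mul_pow_sub_pow (a : Fin N ⊕ Fin N) {l : ℕ} (hl : 0 < l) :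
    ∑ b, coth a b * (svar a ^ l - svar b ^ l) =
      (phi N (pgen 0) - 2 * l) * svar a ^ l + phi N (pgen l)
        + 2 * ∑ j ∈ Finset.Ico 1 l, phi N (pgen j) * svar a ^ (l - j) := by
  have diagonal : ∑ j ∈ Finset.Ico 1 l, svar a ^ j * svar a ^ (l - j) =
      ((l : RatField (Fin N)) - 1) * svar a ^ l := by
    rw [← Nat.cast_pred hl, ← nsmul_eq_mul, ← Nat.card_Ico, ← Finset.sum_const]
    refine Finset.sum_congr rfl fun j hj => ?_
    rw [← pow_add, Nat.add_sub_cancel' (Finset.mem_Ico.1 hj).2.le]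
  have summand (b : Fin N ⊕ Fin N) : coth a b * (svar a ^ l - svar b ^ l) =
      (svar a ^ l + svar b ^ l + 2 * ∑ j ∈ Finset.Ico 1 l, svar b ^ j * svar a ^ (l - j))
      - if b = a then 2 * l * svar a ^ l else 0 := by
    split_ifs with h
    · rw [h, coth_self, diagonal]
      ring
    · rw [coth_mul_pow_sub_pow (Ne.symm h) hl, sub_zero]
  have phi_pgen_zero : phi N (pgen 0) = (Fintype.card (Fin N ⊕ Fin N) : RatField (Fin N)) := by
    rw [phi_pgen]
    simp
  simp only [summand, Finset.sum_sub_distrib, Finset.sum_add_distrib, Finset.sum_const,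
    Finset.card_univ, nsmul_eq_mul, ← phi_pgen_zero, ← phi_pgen_natCast, Finset.sum_ite_eq',
    Finset.mem_univ, if_true, ← Finset.mul_sum]
  rw [Finset.sum_comm]
  simp only [← Finset.sum_mul, ← phi_pgen_natCast]
  ring

theorem phiAt_deltaPos (a : Fin N ⊕ Fin N) {l : ℕ} (hl : 0 < l) :
    phiAt N a (deltaPos l) = ∑ b, coth a b * (svar a ^ l - svar b ^ l)
      - coth a a.swap * (svar a ^ l - svar a.swap ^ l) := by
  have powers_sub_two_mul : ∑ j ∈ Finset.Ico 1 l, svar a ^ ((l : ℤ) - 2 * j) =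
      ∑ j ∈ Finset.Ico 1 l, svar a.swap ^ j * svar a ^ (l - j) := by
    refine Finset.sum_congr rfl fun j hj => ?_
    rw [Finset.mem_Ico] at hj
    rw [svar_swap, ← zpow_natCast, ← zpow_natCast, inv_zpow', ← zpow_add₀ (svar_ne_zero a)]
    congr 1
    omega
  have powers_sub : ∑ j ∈ Finset.Ico 1 l, phi N (pgen j) * svar a ^ ((l : ℤ) - j) =
      ∑ j ∈ Finset.Ico 1 l, phi N (pgen j) * svar a ^ (l - j) := by
    refine Finset.sum_congr rfl fun j hj => ?_
    rw [← zpow_natCast, Nat.cast_sub (Finset.mem_Ico.1 hj).2.le]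
  rw [sum_coth_mul_pow_sub_pow a hl, coth_mul_pow_sub_pow (sum_swap_ne a).symm hl,
    ← powers_sub_two_mul, ← powers_sub]
  simp only [deltaPos, map_add, map_sub, map_mul, map_sum, phiAt_C, phiAt_T, map_ofNat,
    map_natCast, map_one, zpow_natCast, svar_swap, zpow_neg, inv_pow]
  ring

theorem deltaNeg_eq (l : ℕ) : deltaNeg l = -LaurentPolynomial.invert (deltaPos l) := by
  have reflect : ∑ j ∈ Finset.Ico 1 l, (LaurentPolynomial.T ((l : ℤ) - 2 * j) : LambdaBarX) =
      ∑ j ∈ Finset.Ico 1 l, LaurentPolynomial.T (2 * (j : ℤ) - l) := by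
    refine Finset.sum_nbij' (fun j => l - j) (fun j => l - j) ?_ ?_ ?_ ?_ ?_ <;>
      intro j hj <;> simp only [Finset.mem_Ico] at hj ⊢
    case refine_5 => congr 1; omega
    all_goals omega
  simp only [deltaNeg, deltaPos, map_add, map_sub, map_mul, map_sum, LaurentPolynomial.invert_C,
    LaurentPolynomial.invert_T, map_ofNat, map_natCast, map_one, neg_neg, reflect, neg_sub,
    neg_add_eq_sub]
  ring

theorem phiAt_Delta_T (a : Fin N ⊕ Fin N) (l : ℤ) :
    phiAt N a (Delta (LaurentPolynomial.T l)) = ∑ b, coth a b * (svar a ^ l - svar b ^ l)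
      - coth a a.swap * (svar a ^ l - svar a.swap ^ l) := by
  rw [LaurentPolynomial.T, Delta, onPowers_single, one_smul]
  obtain h | rfl | h := lt_trichotomy l 0
  · have zpow_eq (b : Fin N ⊕ Fin N) : svar b ^ l = svar b.swap ^ l.natAbs := by
      rw [svar_swap, ← zpow_natCast, inv_zpow']
      congr 1
      omega
    rw [if_neg h.not_gt, if_pos h, deltaNeg_eq, map_neg, phiAt_invert,
      phiAt_deltaPos _ (by omega), ← sum_comp_swap]
    simp only [zpow_eq, coth_swap_swap, Sum.swap_swap, coth_comm a, neg_mul,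
      Finset.sum_neg_distrib]
    ring
  · simp
  · have zpow_eq (b : Fin N ⊕ Fin N) : svar b ^ l = svar b ^ l.natAbs := by
      rw [← zpow_natCast, Int.natAbs_of_nonneg h.le]
    rw [if_pos h, phiAt_deltaPos _ (by omega)]
    simp only [zpow_eq]

theorem phiAt_Delta (a : Fin N ⊕ Fin N) (F : LambdaBarX) :
    phiAt N a (Delta F) = ∑ b, coth a b * (phiAt N a F - phiAt N b F)
      - coth a a.swap * (phiAt N a F - phiAt N a.swap F) := by
  induction F using AddMonoidAlgebra.induction_linear with
  | zero => simp
  | add F G hF hG =>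
    simp only [map_add, hF, hG, add_sub_add_comm, mul_add, Finset.sum_add_distrib]
  | single l c =>
    rw [LaurentPolynomial.single_eq_C_mul_T, ← LaurentPolynomial.smul_eq_C_mul, map_smul,
      phiAt_smul, phiAt_Delta_T]
    simp only [phiAt_smul, phiAt_T, ← mul_sub, mul_left_comm _ (phi N c), ← Finset.mul_sum]

theorem phiAt_reflOne (a : Fin N ⊕ Fin N) (F : LambdaBarX) :
    phiAt N a (reflOne F) = cothOne a * (phiAt N a F - phiAt N a.swap F) := by
  have spec := congrArg (phiAt N a) (reflOne_spec F)
  simp only [map_mul, map_sub, map_add, map_one, phiAt_T, zpow_one, phiAt_invert] at spec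
  rw [cothOne, div_mul_eq_mul_div, ← spec, mul_div_cancel_left₀ _ (svar_sub_one_ne_zero a)]

theorem phiAt_reflTwo (a : Fin N ⊕ Fin N) (F : LambdaBarX) :
    phiAt N a (reflTwo F) = coth a a.swap * (phiAt N a F - phiAt N a.swap F) := by
  have spec := congrArg (phiAt N a) (reflTwo_spec F)
  simp only [map_mul, map_sub, map_add, map_one, phiAt_T, zpow_ofNat, phiAt_invert] at spec
  rw [coth_swap_self, div_mul_eq_mul_div, ← spec,
    mul_div_cancel_left₀ _ (svar_sq_sub_one_ne_zero a)]

variable {k p q : ℂ}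

theorem phiAt_dunklInf (a : Fin N ⊕ Fin N) (F : LambdaBarX) :
    phiAt N a (dunklInf k p q F) = stheta a (phiAt N a F)
      - (k / 2) • (∑ b, coth a b * (phiAt N a F - phiAt N b F)
          - coth a a.swap * (phiAt N a F - phiAt N a.swap F))
      - (p / 2) • (cothOne a * (phiAt N a F - phiAt N a.swap F))
      - q • (coth a a.swap * (phiAt N a F - phiAt N a.swap F)) := by
  rw [← phiAt_derivInf, ← phiAt_Delta, ← phiAt_reflOne, ← phiAt_reflTwo, ← phiAt_complex_smul,
    ← phiAt_complex_smul, ← phiAt_complex_smul, ← map_sub, ← map_sub, ← map_sub]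
  rfl

theorem phiAt_swap_dunklInf {F G : LambdaBarX} (h : ∀ b, phiAt N b.swap F = phiAt N b G)
    (a : Fin N ⊕ Fin N) :
    phiAt N a.swap (dunklInf k p q F) = -phiAt N a (dunklInf k p q G) := by
  have h' (b : Fin N ⊕ Fin N) : phiAt N b F = phiAt N b.swap G := by rw [← h, Sum.swap_swap]
  have sum_eq : ∑ b, coth a.swap b * (phiAt N a.swap F - phiAt N b F) =
      -∑ b, coth a b * (phiAt N a G - phiAt N b G) := by
    rw [← sum_comp_swap, ← Finset.sum_neg_distrib]
    simp only [coth_swap_swap, h, neg_mul]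
  rw [phiAt_dunklInf, phiAt_dunklInf, sum_eq, stheta_swap, Derivation.neg_apply, Sum.swap_swap,
    coth_comm a, cothOne_swap, h, h']
  simp only [Algebra.smul_def]
  ring

theorem phiAt_swap_dunklInf_pow (f : LambdaBar) (n : ℕ) (a : Fin N ⊕ Fin N) :
    phiAt N a.swap ((dunklInf k p q ^ n) (LaurentPolynomial.C f)) =
      (-1 : ℂ) ^ n • phiAt N a ((dunklInf k p q ^ n) (LaurentPolynomial.C f)) := by
  induction n generalizing a with
  | zero => simp [phiAt_C]
  | succ n ih =>
    simp only [← phiAt_complex_smul] at ih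
    rw [pow_succ', Module.End.mul_apply, phiAt_swap_dunklInf ih, map_smul, phiAt_complex_smul,
      pow_succ, mul_neg_one, neg_smul]

end Specialization

/-! ### Heckman's integrals -/

section Heckman

section Automorphisms

variable {ι : Type}

theorem ratAut_xpow (e : (ι →₀ ℤ) ≃+ (ι →₀ ℤ)) (γ : ι →₀ ℤ) : ratAut e (xpow γ) = xpow (e γ) := by
  rw [ratAut, xpow, IsFractionRing.algEquivOfAlgEquiv_algebraMap,
    AddMonoidAlgebra.domCongr_single, xpow]

theorem algEquiv_derivation {w : RatField ι ≃ₐ[ℂ] RatField ι}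
    {d d' : Derivation ℂ (RatField ι) (RatField ι)}
    (h : ∀ γ, w (d (xpow γ)) = d' (w (xpow γ))) (f : RatField ι) : w (d f) = d' (w f) := by
  let conjugate : Derivation ℂ (RatField ι) (RatField ι) :=
    Derivation.mk' (w.symm.toLinearMap ∘ₗ d'.toLinearMap ∘ₗ w.toLinearMap) fun f g => by
      simp
  have eq_conjugate : d = conjugate :=
    derivation_ext_xpow fun γ => w.injective <| (h γ).trans (w.apply_symm_apply _).symm
  rw [eq_conjugate]
  exact w.apply_symm_apply _

theorem ratAut_smul_xpow (e : (ι →₀ ℤ) ≃+ (ι →₀ ℤ)) (c : ℂ) (γ : ι →₀ ℤ) :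
    ratAut e (c • xpow γ) = c • xpow (e γ) :=
  (map_smul (ratAut e).toLinearMap c _).trans (congrArg _ (ratAut_xpow e γ))

theorem ratAut_theta {e : (ι →₀ ℤ) ≃+ (ι →₀ ℤ)} {i j : ι} {ε : ℤ} (h : ∀ γ, γ i = ε * e γ j)
    (f : RatField ι) : ratAut e (theta i f) = ε • theta j (ratAut e f) :=
  algEquiv_derivation (d' := ε • theta j) (fun γ => by
    rw [Derivation.smul_apply, theta_xpow, ratAut_smul_xpow, ratAut_xpow, theta_xpow, h,
      Int.cast_mul, mul_smul, Int.cast_smul_eq_zsmul]) f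

theorem tInv_theta_self (i : ι) (f : RatField ι) : tInv i (theta i f) = -theta i (tInv i f) := by
  rw [tInv, ratAut_theta (j := i) (ε := -1) fun γ => by simp [negExponent]; ring, neg_one_smul]

theorem tInv_theta_of_ne {i j : ι} (h : i ≠ j) (f : RatField ι) :
    tInv i (theta j f) = theta j (tInv i f) := by
  rw [tInv, ratAut_theta (j := j) (ε := 1) fun γ => by simp [negExponent, h], one_smul]

variable [DecidableEq ι]

theorem sPlus_theta (i j : ι) (f : RatField ι) : sPlus i j (theta i f) = theta j (sPlus i j f) := by
  rw [sPlus, ratAut_theta (j := j) (ε := 1) fun γ => by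
    simp [Finsupp.domCongr_apply, Finsupp.equivMapDomain_apply], one_smul]

theorem sMinus_theta {i j : ι} (h : i ≠ j) (f : RatField ι) :
    sMinus i j (theta i f) = -theta j (sMinus i j f) := by
  change tInv j (tInv i (sPlus i j (theta i f))) = _
  rw [sPlus_theta, tInv_theta_of_ne h, tInv_theta_self]
  rfl

/-- The permutation of the signed indices by which `sPlus i j` acts on the signed variables. -/
def swapPlus (i j : ι) : Equiv.Perm (ι ⊕ ι) := Equiv.sumCongr (Equiv.swap i j) (Equiv.swap i j)

/-- The permutation of the signed indices by which `tInv i` acts on the signed variables. -/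
def swapSign (i : ι) : Equiv.Perm (ι ⊕ ι) := Equiv.swap (Sum.inl i) (Sum.inr i)

/-- The permutation of the signed indices by which `sMinus i j` acts on the signed variables. -/
def swapMinus (i j : ι) : Equiv.Perm (ι ⊕ ι) :=
  (swapPlus i j).trans ((swapSign i).trans (swapSign j))

theorem sPlus_svar (i j : ι) (a : ι ⊕ ι) : sPlus i j (svar a) = svar (swapPlus i j a) := by
  cases a <;> simp [svar, swapPlus, sPlus_var]

theorem tInv_svar (i : ι) (a : ι ⊕ ι) : tInv i (svar a) = svar (swapSign i a) := by
  obtain b | b := a <;> by_cases h : b = i <;>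
    simp [svar, swapSign, Equiv.swap_apply_def, tInv_var, h, eq_comm (a := i)]

theorem sMinus_svar (i j : ι) (a : ι ⊕ ι) : sMinus i j (svar a) = svar (swapMinus i j a) := by
  change tInv j (tInv i (sPlus i j (svar a))) = _
  rw [sPlus_svar, tInv_svar, tInv_svar]
  rfl

theorem swapPlus_inl (i j : ι) : swapPlus i j (Sum.inl i) = Sum.inl j := by simp [swapPlus]

theorem swapSign_inl (i : ι) : swapSign i (Sum.inl i) = Sum.inr i := by simp [swapSign]

theorem swapMinus_inl {i j : ι} (h : i ≠ j) : swapMinus i j (Sum.inl i) = Sum.inr j := by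
  simp [swapMinus, swapPlus, swapSign, Equiv.swap_apply_def, h.symm]

end Automorphisms

variable {N : ℕ}

section SignedPermutations

variable {F : Type*} [FunLike F (RatField (Fin N)) (RatField (Fin N))]
  [AlgHomClass F ℂ (RatField (Fin N)) (RatField (Fin N))] {w : F}
  {π : Equiv.Perm (Fin N ⊕ Fin N)}

theorem map_phi_of_map_svar (h : ∀ a, w (svar a) = svar (π a)) (f : LambdaBar) :
    w (phi N f) = phi N f := by
  have comp_eq : (AlgHomClass.toAlgHom w).comp (phi N) = phi N := by
    refine MvPolynomial.algHom_ext fun l => ?_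
    have phi_X : phi N (MvPolynomial.X l) = ∑ a : Fin N ⊕ Fin N, svar a ^ l := phi_pgen_natCast l
    rw [AlgHom.comp_apply, phi_X, AlgHom.coe_coe, map_sum]
    simp only [map_pow, h]
    exact Equiv.sum_comp π fun a => svar a ^ l
  exact DFunLike.congr_fun comp_eq f

theorem map_phiAt_of_map_svar (h : ∀ a, w (svar a) = svar (π a)) (a : Fin N ⊕ Fin N)
    (f : LambdaBarX) : w (phiAt N a f) = phiAt N (π a) f := by
  induction f using AddMonoidAlgebra.induction_linear with
  | zero => simp
  | add f g hf hg => rw [map_add, map_add, map_add, hf, hg]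
  | single l c => rw [phiAt_single, phiAt_single, map_mul, map_zpow₀, map_phi_of_map_svar h, h]

end SignedPermutations

variable (N) in
/-- The homomorphism `phi N` with values in Laurent polynomials. -/
def phiLaurent : LambdaBar →ₐ[ℂ] LaurentRing (Fin N) :=
  MvPolynomial.aeval fun l : ℕ => ∑ a, AddMonoidAlgebra.single (svarExp a) 1 ^ l

theorem algebraMap_phiLaurent (f : LambdaBar) :
    algebraMap (LaurentRing (Fin N)) (RatField (Fin N)) (phiLaurent N f) = phi N f := by
  have comp_eq : (IsScalarTower.toAlgHom ℂ (LaurentRing (Fin N)) (RatField (Fin N))).comp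
      (phiLaurent N) = phi N := by
    refine MvPolynomial.algHom_ext fun l => ?_
    have phi_X : phi N (MvPolynomial.X l) = ∑ a : Fin N ⊕ Fin N, svar a ^ l := phi_pgen_natCast l
    rw [AlgHom.comp_apply, phiLaurent, MvPolynomial.aeval_X, phi_X, map_sum]
    simp only [map_pow, svar_eq_xpow]
    rfl
  exact DFunLike.congr_fun comp_eq f

theorem phi_mem_invariants (f : LambdaBar) : phi N f ∈ invariants N :=
  ⟨⟨phiLaurent N f, algebraMap_phiLaurent f⟩,
    fun i j _ => ⟨map_phi_of_map_svar (sPlus_svar i j) f, map_phi_of_map_svar (sMinus_svar i j) f⟩,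
    fun i => map_phi_of_map_svar (tInv_svar i) f⟩

variable {k p q : ℂ}

theorem dunkl_apply (i : Fin N) (g : RatField (Fin N)) :
    dunkl N k p q i g = theta i g
      - (k / 2) • ∑ j ∈ {i}ᶜ, (coth (Sum.inl i) (Sum.inl j) * (g - sPlus i j g)
          + coth (Sum.inl i) (Sum.inr j) * (g - sMinus i j g))
      - (p / 2) • (cothOne (Sum.inl i) * (g - tInv i g))
      - q • (coth (Sum.inl i) (Sum.inr i) * (g - tInv i g)) := by
  have coth_inr (j : Fin N) : coth (Sum.inl i : Fin N ⊕ Fin N) (Sum.inr j) =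
      (var i * var j + 1) / (var i * var j - 1) := coth_swap_right_eq (Sum.inl i) (Sum.inl j)
  rw [dunkl, ← Finset.compl_singleton]
  simp only [coth_inr, ← sq, LinearMap.sub_apply, LinearMap.smul_apply, LinearMap.sum_apply,
    LinearMap.add_apply, Module.End.mul_apply]
  rfl

theorem sum_sub_inr_eq_sum_compl {α M : Type*} [Fintype α] [DecidableEq α] [AddCommGroup M]
    {f : α ⊕ α → M} {i : α} (h : f (Sum.inl i) = 0) :
    ∑ b, f b - f (Sum.inr i) = ∑ j ∈ {i}ᶜ, (f (Sum.inl j) + f (Sum.inr j)) := by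
  rw [Fintype.sum_sum_type, ← Finset.sum_add_distrib,
    ← Finset.sum_compl_add_sum {i} fun j => f (Sum.inl j) + f (Sum.inr j),
    Finset.sum_singleton, h, zero_add, add_sub_cancel_right]

theorem phiAt_inl_dunklInf (i : Fin N) (F : LambdaBarX) :
    phiAt N (Sum.inl i) (dunklInf k p q F) = dunkl N k p q i (phiAt N (Sum.inl i) F) := by
  rw [phiAt_dunklInf, dunkl_apply, map_phiAt_of_map_svar (tInv_svar i), swapSign_inl, Sum.swap_inl]
  congr 4
  rw [sum_sub_inr_eq_sum_compl
    (f := fun b => coth (Sum.inl i) b * (phiAt N (Sum.inl i) F - phiAt N b F)) (by simp)]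
  refine Finset.sum_congr rfl fun j hj => ?_
  have ne : i ≠ j := by simpa [eq_comm] using hj
  rw [map_phiAt_of_map_svar (sPlus_svar i j), map_phiAt_of_map_svar (sMinus_svar i j),
    swapPlus_inl, swapMinus_inl ne]

theorem phiAt_inl_dunklInf_pow (i : Fin N) (n : ℕ) (F : LambdaBarX) :
    phiAt N (Sum.inl i) ((dunklInf k p q ^ n) F) =
      (dunkl N k p q i ^ n) (phiAt N (Sum.inl i) F) := by
  induction n with
  | zero => simp
  | succ n ih =>
    rw [pow_succ', pow_succ', Module.End.mul_apply, Module.End.mul_apply, phiAt_inl_dunklInf, ih]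

theorem phi_cmsInf (r : ℕ) (f : LambdaBar) :
    phi N (cmsInf k p q r f) =
      ∑ a, phiAt N a ((dunklInf k p q ^ (2 * r)) (LaurentPolynomial.C f)) :=
  phi_traceE _

theorem phi_cmsInf_eq_heckman (r : ℕ) (f : LambdaBar) :
    phi N (cmsInf k p q r f) = 2 * heckman N k p q r (phi N f) := by
  have phiAt_inr (i : Fin N) :
      phiAt N (Sum.inr i) ((dunklInf k p q ^ (2 * r)) (LaurentPolynomial.C f)) =
        phiAt N (Sum.inl i) ((dunklInf k p q ^ (2 * r)) (LaurentPolynomial.C f)) := by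
    have key := phiAt_swap_dunklInf_pow (k := k) (p := p) (q := q) f (2 * r) (Sum.inl i)
    rwa [(even_two_mul r).neg_one_pow, one_smul] at key
  rw [phi_cmsInf, Fintype.sum_sum_type, heckman, LinearMap.sum_apply, two_mul (Finset.sum _ _)]
  simp only [phiAt_inr, phiAt_inl_dunklInf_pow, phiAt_C]

theorem dunkl_apply_of_mem_invariants {g : RatField (Fin N)} (hg : g ∈ invariants N) (i : Fin N) :
    dunkl N k p q i g = theta i g := by
  obtain ⟨-, hs, ht⟩ := hg
  have reflections_vanish : ∑ j ∈ {i}ᶜ, (coth (Sum.inl i) (Sum.inl j) * (g - sPlus i j g)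
      + coth (Sum.inl i) (Sum.inr j) * (g - sMinus i j g)) = 0 := by
    refine Finset.sum_eq_zero fun j hj => ?_
    have ne : i ≠ j := by simpa [eq_comm] using hj
    rw [(hs i j ne).1, (hs i j ne).2, sub_self, mul_zero, mul_zero, add_zero]
  rw [dunkl_apply, reflections_vanish, ht]
  simp only [sub_self, mul_zero, smul_zero, sub_zero]

theorem dunkl_theta_of_mem_invariants {g : RatField (Fin N)} (hg : g ∈ invariants N) (i : Fin N) :
    dunkl N k p q i (theta i g) = theta i (theta i g)
      - (k / 2) • ∑ j ∈ {i}ᶜ, (coth (Sum.inl i) (Sum.inl j) * (theta i g - theta j g)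
          + coth (Sum.inl i) (Sum.inr j) * (theta i g + theta j g))
      - (p • (cothOne (Sum.inl i) * theta i g)
        + (2 * q) • (coth (Sum.inl i) (Sum.inr i) * theta i g)) := by
  obtain ⟨-, hs, ht⟩ := hg
  have reflections : ∑ j ∈ {i}ᶜ, (coth (Sum.inl i) (Sum.inl j) * (theta i g - sPlus i j (theta i g))
        + coth (Sum.inl i) (Sum.inr j) * (theta i g - sMinus i j (theta i g))) =
      ∑ j ∈ {i}ᶜ, (coth (Sum.inl i) (Sum.inl j) * (theta i g - theta j g)
        + coth (Sum.inl i) (Sum.inr j) * (theta i g + theta j g)) := by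
    refine Finset.sum_congr rfl fun j hj => ?_
    have ne : i ≠ j := by simpa [eq_comm] using hj
    rw [sPlus_theta, sMinus_theta ne, (hs i j ne).1, (hs i j ne).2, sub_neg_eq_add]
  rw [dunkl_apply, reflections, tInv_theta_self, ht, sub_neg_eq_add, ← two_mul]
  simp only [Algebra.smul_def, map_mul, map_div₀, map_ofNat]
  ring

theorem gaugedCMS_apply (g : RatField (Fin N)) :
    gaugedCMS N k p q g = ∑ i, theta i (theta i g)
      - k • ∑ i, ∑ j ∈ Finset.Ioi i, (coth (Sum.inl i) (Sum.inl j) * (theta i g - theta j g)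
          + coth (Sum.inl i) (Sum.inr j) * (theta i g + theta j g))
      - ∑ i, (p • (cothOne (Sum.inl i) * theta i g)
        + (2 * q) • (coth (Sum.inl i) (Sum.inr i) * theta i g)) := by
  have coth_inr (i j : Fin N) : coth (Sum.inl i : Fin N ⊕ Fin N) (Sum.inr j) =
      (var i * var j + 1) / (var i * var j - 1) := coth_swap_right_eq (Sum.inl i) (Sum.inl j)
  simp only [gaugedCMS, sq, coth_inr, Finset.sum_add_distrib, smul_add, LinearMap.sub_apply,
    LinearMap.sum_apply, LinearMap.smul_apply, LinearMap.add_apply, Module.End.mul_apply, ← sub_sub]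
  rfl

theorem heckman_one {g : RatField (Fin N)} (hg : g ∈ invariants N) :
    heckman N k p q 1 g = gaugedCMS N k p q g := by
  have interaction_comm (i j : Fin N) :
      coth (Sum.inl i) (Sum.inl j) * (theta i g - theta j g)
          + coth (Sum.inl i) (Sum.inr j) * (theta i g + theta j g) =
        coth (Sum.inl j) (Sum.inl i) * (theta j g - theta i g)
          + coth (Sum.inl j) (Sum.inr i) * (theta j g + theta i g) := by
    have coth_inr_comm : coth (Sum.inl j : Fin N ⊕ Fin N) (Sum.inr i) =
        coth (Sum.inl i) (Sum.inr j) := coth_swap_right_comm (Sum.inl j) (Sum.inl i)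
    rw [coth_comm (Sum.inl i), coth_inr_comm]
    ring
  have dunkl_sq (i : Fin N) :
      (dunkl N k p q i ^ (2 * 1)) g = dunkl N k p q i (theta i g) := by
    rw [mul_one, sq, Module.End.mul_apply, dunkl_apply_of_mem_invariants hg]
  rw [heckman, LinearMap.sum_apply, gaugedCMS_apply]
  simp only [dunkl_sq, dunkl_theta_of_mem_invariants hg, Finset.sum_sub_distrib,
    ← Finset.smul_sum (r := k / 2)]
  rw [sum_compl_singleton_comm _ interaction_comm, ← Nat.cast_smul_eq_nsmul ℂ, smul_smul,
    Nat.cast_ofNat, div_mul_cancel₀ k two_ne_zero]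

end Heckman

/-! ### The gauge transformation to the Lax matrix -/

section Gauge

theorem sweight_one {ι : Type} (a : ι ⊕ ι) : sweight (fun _ => 1) a = 1 := by cases a <;> rfl

theorem isWeight_one (ι : Type) (k : ℂ) : IsWeight k fun _ : ι => 1 :=
  ⟨fun _ => Or.inl rfl, fun _ => one_ne_zero⟩

theorem IsConnection.add_map {ι : Type} {R : Type} [Ring R] [Algebra ℂ R]
    {m : RatField ι →ₐ[ℂ] R} {D : ι → R} (hD : IsConnection m D) {g : ι → RatField ι}
    (hg : ∀ i j, theta i (g j) = theta j (g i)) : IsConnection m fun i => D i + m (g i) where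
  comm i j := by
    simp only [add_mul, mul_add, hD.comm i j, hD.leibniz, hg i j, ← map_mul, mul_comm (g i)]
    abel
  leibniz i f := by
    simp only [add_mul, mul_add, hD.leibniz, ← map_mul, mul_comm (g i)]
    abel

theorem laxX_one {ι : Type} [DecidableEq ι] (k p q : ℂ) (a b : ι ⊕ ι) :
    laxX k p q (fun _ => 1) a b = (k / 2) • coth a b +
      if b = a.swap then (p / 2) • cothOne a + (q - k / 2) • coth a a.swap else 0 := by
  simp only [laxX, laxZ, sweight_one, sub_self, zero_div, add_zero, mul_one,
    ← Algebra.smul_def]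
  split_ifs with h h' h'
  · exact absurd (h.symm.trans h') (sum_swap_ne a).symm
  · rw [h, coth_self, smul_zero, add_zero]
  · rw [h']
    module
  · rw [add_zero]

section Ground

variable {ι : Type} [Fintype ι] {k p q : ℂ}

variable (k p q) in
/-- The logarithmic derivative of the ground state of the `BC` system in the direction of a signed
variable: conjugation by the ground state turns `stheta a` into `stheta a + gauge k p q a`. -/
def gauge (a : ι ⊕ ι) : RatField ι :=
  -((k / 2) • ((∑ b, coth a b) - coth a a.swap) + (p / 2) • cothOne a + q • coth a a.swap)

theorem gauge_swap (a : ι ⊕ ι) : gauge k p q a.swap = -gauge k p q a := by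
  have sum_swap : ∑ b, coth a.swap b = -∑ b, coth a b := by
    rw [← sum_comp_swap, ← Finset.sum_neg_distrib]
    exact Finset.sum_congr rfl fun b _ => coth_swap_swap a b
  rw [gauge, gauge, sum_swap, coth_swap_swap, cothOne_swap]
  module

theorem stheta_gauge {a c : ι ⊕ ι} (h : a ≠ c) (h' : a ≠ c.swap) :
    stheta c (gauge k p q a) = (k / 4) • (coth a c.swap ^ 2 - coth a c ^ 2) := by
  classical
  have spair_self_zero : spair c a = 0 := spair_eq_zero h h'
  have stheta_term (b : ι ⊕ ι) :
      stheta c (coth a b) = spair c b • ((1 / 2 : ℂ) • (coth a b ^ 2 - 1)) := by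
    rcases eq_or_ne a b with rfl | hab
    · rw [coth_self, map_zero, spair_self_zero, zero_smul]
    · rw [stheta_coth c hab, spair_self_zero]
      module
  rw [gauge, map_neg, map_add, map_add, Derivation.map_smul, Derivation.map_smul,
    Derivation.map_smul, map_sub, map_sum, stheta_cothOne, Finset.sum_congr rfl fun b _ =>
    stheta_term b, sum_spair_smul, stheta_term, spair_swap_right, spair_self_zero]
  module

theorem theta_gauge_comm (i j : ι) :
    theta i (gauge k p q (Sum.inl j)) = theta j (gauge k p q (Sum.inl i)) := by
  rcases eq_or_ne i j with rfl | hij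
  · rfl
  have stheta_gauge_comm : stheta (Sum.inl i) (gauge k p q (Sum.inl j)) =
      stheta (Sum.inl j) (gauge k p q (Sum.inl i)) := by
    rw [stheta_gauge (by simpa using hij.symm) (by simp), stheta_gauge (by simpa using hij)
      (by simp), coth_swap_right_comm, coth_comm (Sum.inl i), neg_sq]
  exact stheta_gauge_comm

variable (k p q) in
/-- The operators `∂_i` conjugated by the ground state. -/
def gaugedOp (i : ι) : Module.End ℂ (RatField ι) := thetaOp i + mulHom ι (gauge k p q (Sum.inl i))

theorem isConnection_gaugedOp : IsConnection (mulHom ι) (gaugedOp k p q) :=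
  (isConnection_theta ι).add_map theta_gauge_comm

theorem signedOp_gaugedOp (a : ι ⊕ ι) (f : RatField ι) :
    signedOp (gaugedOp k p q) a f = stheta a f + gauge k p q a * f := by
  rcases a with i | i
  · rfl
  · rw [← Sum.swap_inl, gauge_swap, Sum.swap_inl]
    change -(theta i f + gauge k p q (Sum.inl i) * f) = -theta i f + _
    ring

variable [DecidableEq ι]

variable (k p q) in
/-- The Lax matrix of the undeformed `BC` system in the gauge of the ground state. -/
abbrev gaugedLax : Matrix (ι ⊕ ι) (ι ⊕ ι) (Module.End ℂ (RatField ι)) :=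
  laxL (mulHom ι) (gaugedOp k p q) k p q fun _ => 1

theorem sum_gaugedLax_apply (a : ι ⊕ ι) (F : ι ⊕ ι → RatField ι) :
    ∑ b, gaugedLax k p q a b (F b) = stheta a (F a) + gauge k p q a * F a +
      (k / 2) • ∑ b, coth a b * F b +
      ((p / 2) • cothOne a + (q - k / 2) • coth a a.swap) * F a.swap := by
  have gaugedLax_apply (b : ι ⊕ ι) : gaugedLax k p q a b (F b) =
      (if a = b then stheta a (F b) + gauge k p q a * F b else 0) + (k / 2) • (coth a b * F b) +
      if b = a.swap then ((p / 2) • cothOne a + (q - k / 2) • coth a a.swap) * F b else 0 := by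
    have diagonal : (if a = b then sweight (fun _ => 1) a • signedOp (gaugedOp k p q) a else 0 :
        Module.End ℂ (RatField ι)) (F b) =
        if a = b then stheta a (F b) + gauge k p q a * F b else 0 := by
      split_ifs
      · rw [sweight_one, one_smul, signedOp_gaugedOp]
      · rfl
    rw [gaugedLax, laxL, Matrix.of_apply, LinearMap.add_apply, diagonal, laxX_one, add_assoc,
      ← smul_mul_assoc, ← zero_mul (F b), ← ite_mul, ← add_mul, zero_mul]
    rfl
  simp only [gaugedLax_apply, Finset.sum_add_distrib, Finset.sum_ite_eq, Finset.sum_ite_eq',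
    Finset.mem_univ, if_true, Finset.smul_sum]

end Ground

variable {N : ℕ} {k p q : ℂ}

theorem phiAt_dunklInf_eq_gaugedLax (a : Fin N ⊕ Fin N) (F : LambdaBarX) :
    phiAt N a (dunklInf k p q F) = ∑ b, gaugedLax k p q a b (phiAt N b F) := by
  rw [phiAt_dunklInf, sum_gaugedLax_apply, gauge]
  simp only [mul_sub, Finset.sum_sub_distrib, ← Finset.sum_mul, Algebra.smul_def, map_sub]
  ring

theorem phiAt_dunklInf_pow (f : LambdaBar) (n : ℕ) (a : Fin N ⊕ Fin N) :
    phiAt N a ((dunklInf k p q ^ n) (LaurentPolynomial.C f)) =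
      ∑ b, (gaugedLax k p q ^ n) a b (phi N f) := by
  induction n generalizing a with
  | zero => simp [phiAt_C, Matrix.one_apply,
    apply_ite (fun T : Module.End ℂ (RatField (Fin N)) => T (phi N f))]
  | succ n ih =>
    rw [pow_succ', pow_succ', Module.End.mul_apply, phiAt_dunklInf_eq_gaugedLax]
    simp only [ih, Matrix.mul_apply, map_sum, LinearMap.sum_apply, Module.End.mul_apply]
    rw [Finset.sum_comm]

theorem phi_cmsInf_eq_laxIntegral (r : ℕ) (f : LambdaBar) :
    phi N (cmsInf k p q r f) =
      laxIntegral (mulHom (Fin N)) (gaugedOp k p q) k p q (fun _ => 1) (2 * r) (phi N f) := by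
  simp only [phi_cmsInf, phiAt_dunklInf_pow, laxIntegral, sweight_one, inv_one, one_smul,
    LinearMap.sum_apply]

theorem phi_cmsInf_comm (r s : ℕ) (f : LambdaBar) :
    phi N (cmsInf k p q r (cmsInf k p q s f)) = phi N (cmsInf k p q s (cmsInf k p q r f)) := by
  simp only [phi_cmsInf_eq_laxIntegral]
  exact DFunLike.congr_fun
    (commute_laxIntegral isConnection_gaugedOp (isWeight_one (Fin N) k) (2 * r) (2 * s)).eq _

end Gauge

/-! ### Joint injectivity of the specializations -/

section Injectivity

section PowerSums

variable {K : Type*} [Field K]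

/-- The sequence `l ↦ ξ ^ l + ξ ^ (-l)` of the values of the generators `p_l` at one variable. -/
def powerVec (ξ : Kˣ) (l : ℕ) : K := ((ξ ^ (l : ℤ) : Kˣ) : K) + ((ξ ^ (-l : ℤ) : Kˣ) : K)

variable [CharZero K]

variable (K) in
theorem linearIndependent_zpow :
    LinearIndependent K fun (l : ℤ) (ξ : Kˣ) => ((ξ ^ l : Kˣ) : K) := by
  let character (l : ℤ) : Kˣ →* K := (Units.coeHom K).comp (zpowGroupHom l)
  have character_injective : Function.Injective character := fun l l' h => by
    have h2 := DFunLike.congr_fun h (Units.mk0 2 two_ne_zero)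
    have h2 : (2 : K) ^ l = 2 ^ l' := by simpa [character] using h2
    exact zpow_right_injective₀ (a := (2 : ℚ)) two_pos (by norm_num)
      (Rat.cast_injective (α := K) (by push_cast; exact h2))
  exact (linearIndependent_monoidHom Kˣ K).comp character character_injective

variable (K) in
theorem linearIndependent_powerVec :
    LinearIndependent K fun (l : ℕ) (ξ : Kˣ) => powerVec ξ l := by
  let exponents (l : ℕ) : ℤ →₀ K := Finsupp.single (l : ℤ) 1 + Finsupp.single (-l : ℤ) 1
  have hexponents : LinearIndependent K exponents := by
    let restrict : (ℤ →₀ K) →ₗ[K] ℕ →₀ K := Finsupp.lcomapDomain (↑) Nat.cast_injective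
    have restrict_exponents : restrict ∘ exponents =
        fun l => Finsupp.single l (if l = 0 then 2 else 1) := by
      funext l
      ext j
      rcases eq_or_ne l 0 with rfl | hl
      · rcases eq_or_ne j 0 with rfl | hj
        · simp [restrict, exponents, Finsupp.lcomapDomain, one_add_one_eq_two]
        · simp [restrict, exponents, Finsupp.lcomapDomain, hj]
      · simp [restrict, exponents, Finsupp.lcomapDomain, Finsupp.single_apply, hl]
    refine LinearIndependent.of_comp restrict (restrict_exponents ▸ ?_)
    exact Finsupp.linearIndependent_single_of_ne_zero fun l => by split_ifs <;> simp
  have powerVec_eq : (fun (l : ℕ) (ξ : Kˣ) => powerVec ξ l) =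
      Finsupp.linearCombination K (fun (l : ℤ) (ξ : Kˣ) => ((ξ ^ l : Kˣ) : K)) ∘ exponents := by
    funext l
    simp only [exponents, Function.comp_apply, map_add, Finsupp.linearCombination_single, one_smul]
    rfl
  rw [powerVec_eq]
  exact hexponents.map' _ (linearIndependent_iff_ker.1 (linearIndependent_zpow K))

theorem exists_linearCombination_powerVec (s : Finset ℕ) (x : ℕ → K) :
    ∃ c : Kˣ →₀ K, ∀ l ∈ s, Finsupp.linearCombination K powerVec c l = x l := by
  have span_eq_top : Submodule.span K (Set.range fun (ξ : Kˣ) (l : s) => powerVec ξ (l : ℕ)) = ⊤ :=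
    span_flip_eq_top_iff_linearIndependent.2
      ((linearIndependent_powerVec K).comp _ Subtype.val_injective)
  obtain ⟨c, hc⟩ := Finsupp.mem_span_range_iff_exists_finsupp.1
    (span_eq_top ▸ Submodule.mem_top (x := fun l : s => x l))
  refine ⟨c, fun l hl => (?_ : _ = _).trans (congrFun hc ⟨l, hl⟩)⟩
  simp [Finsupp.linearCombination_apply, Finsupp.sum]

end PowerSums

section Vanishing

variable {σ K : Type*} [CommRing K] [IsDomain K] [CharZero K] {f : MvPolynomial σ K}

theorem eval_add_smul_eq_zero_of_natCast {a v : σ → K}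
    (h : ∀ n : ℕ, MvPolynomial.eval (a + (n : K) • v) f = 0) (t : K) :
    MvPolynomial.eval (a + t • v) f = 0 := by
  let restriction : Polynomial K :=
    MvPolynomial.aeval (fun l => Polynomial.C (a l) + Polynomial.X * Polynomial.C (v l)) f
  have eval_restriction (t : K) : restriction.eval t = MvPolynomial.eval (a + t • v) f := by
    have comp_eq : (Polynomial.aeval t).comp (MvPolynomial.aeval fun l =>
        Polynomial.C (a l) + Polynomial.X * Polynomial.C (v l)) =
        (MvPolynomial.aeval (a + t • v) : MvPolynomial σ K →ₐ[K] K) :=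
      MvPolynomial.algHom_ext fun l => by simp [mul_comm t]
    exact DFunLike.congr_fun comp_eq f
  have restriction_eq_zero : restriction = 0 := by
    refine Polynomial.eq_zero_of_infinite_isRoot restriction
      ((Set.infinite_range_of_injective (Nat.cast_injective (R := K))).mono ?_)
    rintro _ ⟨n, rfl⟩
    exact (eval_restriction n).trans (h n)
  rw [← eval_restriction, restriction_eq_zero, Polynomial.eval_zero]

theorem eval_linearCombination_eq_zero {α : Type*} {v : α → σ → K}
    (h : ∀ s : Multiset α, MvPolynomial.eval (s.map v).sum f = 0) (c : α →₀ K) :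
    MvPolynomial.eval (Finsupp.linearCombination K v c) f = 0 := by
  suffices add_eq_zero : ∀ s : Multiset α,
      MvPolynomial.eval ((s.map v).sum + Finsupp.linearCombination K v c) f = 0 by
    simpa using add_eq_zero 0
  induction c using Finsupp.induction with
  | zero => simpa using h
  | single_add ξ t c _ _ ih =>
    intro s
    rw [map_add, Finsupp.linearCombination_single, add_left_comm, add_comm]
    refine eval_add_smul_eq_zero_of_natCast (fun n => ?_) t
    have := ih (Multiset.replicate n ξ + s)
    rwa [Multiset.map_add, Multiset.sum_add, Multiset.map_replicate, Multiset.sum_replicate,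
      ← Nat.cast_smul_eq_nsmul K, add_assoc, add_comm] at this

end Vanishing

section Torus

variable {ι : Type}

/-- Evaluation of Laurent polynomials at a point of the torus. -/
def torusEval (z : ι → ℂˣ) : LaurentRing ι →ₐ[ℂ] ℂ :=
  AddMonoidAlgebra.lift ℂ ℂ (ι →₀ ℤ)
    { toFun := fun γ => ((γ.toAdd.prod fun i l => z i ^ l : ℂˣ) : ℂ)
      map_one' := by simp
      map_mul' := fun γ γ' => by
        rw [toAdd_mul, Finsupp.prod_add_index' (fun i => zpow_zero _) fun i => zpow_add _,
          Units.val_mul] }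

theorem torusEval_svarExp (z : ι → ℂˣ) (a : ι ⊕ ι) :
    torusEval z (AddMonoidAlgebra.single (svarExp a) 1) =
      ((Sum.elim z (fun i => (z i)⁻¹) a : ℂˣ) : ℂ) := by
  rw [torusEval, AddMonoidAlgebra.lift_single, one_smul]
  change (((svarExp a).prod fun i l => z i ^ l : ℂˣ) : ℂ) = _
  rcases a with i | i <;> simp [svarExp, Finsupp.prod_neg_index]

theorem torusEval_phiLaurent {N : ℕ} (z : Fin N → ℂˣ) (f : LambdaBar) :
    torusEval z (phiLaurent N f) = MvPolynomial.eval (∑ i, powerVec (z i)) f := by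
  have comp_eq : (torusEval z).comp (phiLaurent N) = MvPolynomial.aeval (∑ i, powerVec (z i)) := by
    refine MvPolynomial.algHom_ext fun l => ?_
    rw [AlgHom.comp_apply, phiLaurent, MvPolynomial.aeval_X, MvPolynomial.aeval_X, map_sum]
    simp only [map_pow, torusEval_svarExp]
    simp [powerVec, Finset.sum_add_distrib]
  exact DFunLike.congr_fun comp_eq f

end Torus

theorem eval_sum_powerVec_eq_zero {f : LambdaBar} (hf : ∀ N, phi N f = 0) (s : Multiset ℂˣ) :
    MvPolynomial.eval (s.map powerVec).sum f = 0 := by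
  induction s using Quotient.inductionOn with | h s =>
  have phiLaurent_eq_zero : phiLaurent s.length f = 0 := by
    apply IsFractionRing.injective (LaurentRing (Fin s.length)) (RatField (Fin s.length))
    rw [algebraMap_phiLaurent, hf, map_zero]
  rw [Multiset.quot_mk_to_coe, Multiset.map_coe, Multiset.sum_coe, ← Fin.sum_univ_fun_getElem,
    ← torusEval_phiLaurent, phiLaurent_eq_zero, map_zero]

theorem eq_zero_of_phi_eq_zero {f : LambdaBar} (hf : ∀ N, phi N f = 0) : f = 0 := by
  refine MvPolynomial.funext fun x => ?_
  obtain ⟨c, hc⟩ := exists_linearCombination_powerVec f.vars x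
  have eval_eq : MvPolynomial.eval (Finsupp.linearCombination ℂ powerVec c) f =
      MvPolynomial.eval x f :=
    MvPolynomial.eval₂Hom_congr' rfl (fun l hl _ => hc l hl) rfl
  rw [map_zero, ← eval_eq]
  exact eval_linearCombination_eq_zero (eval_sum_powerVec_eq_zero hf) c

theorem commute_cmsInf (k p q : ℂ) (r s : ℕ) : Commute (cmsInf k p q r) (cmsInf k p q s) := by
  refine LinearMap.ext fun f => sub_eq_zero.1 (eq_zero_of_phi_eq_zero fun N => ?_)
  rw [map_sub, sub_eq_zero, Module.End.mul_apply, Module.End.mul_apply]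
  exact phi_cmsInf_comm r s f

end Injectivity

/-! ### The second order integral at infinity -/

section SecondOrder

open LaurentPolynomial (T C)
open MvPolynomial (pderiv)

theorem vars_pderiv_subset {σ R : Type*} [CommSemiring R] (i : σ) (f : MvPolynomial σ R) :
    (pderiv i f).vars ⊆ f.vars := by
  intro j hj
  obtain ⟨d, hd, hjd⟩ := (MvPolynomial.mem_vars_iff_mem_support j).1 hj
  rw [MvPolynomial.mem_support_iff, MvPolynomial.coeff_pderiv] at hd
  refine (MvPolynomial.mem_vars_iff_mem_support j).2 ⟨d + Finsupp.single i 1,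
    MvPolynomial.mem_support_iff.2 (left_ne_zero_of_mul hd), ?_⟩
  rw [Finsupp.mem_support_iff] at hjd ⊢
  rw [Finsupp.add_apply]
  lia

theorem vars_partialP_subset (a : ℕ) (f : LambdaBar) : (partialP a f).vars ⊆ f.vars := by
  refine subset_trans (fun j hj => ?_) (vars_pderiv_subset a f)
  obtain ⟨d, hd, hjd⟩ := (MvPolynomial.mem_vars_iff_mem_support j).1 hj
  exact (MvPolynomial.mem_vars_iff_mem_support j).2 ⟨d, MvPolynomial.support_smul hd, hjd⟩

theorem derivation_eq_sum_pderiv {σ R A : Type*} [CommSemiring R] [AddCommMonoid A] [Module R A]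
    [Module (MvPolynomial σ R) A] [IsScalarTower R (MvPolynomial σ R) A]
    (D : Derivation R (MvPolynomial σ R) A) {f : MvPolynomial σ R} {s : Finset σ}
    (hs : f.vars ⊆ s) : D f = ∑ i ∈ s, pderiv i f • D (MvPolynomial.X i) := by
  classical
  let D' : Derivation R (MvPolynomial σ R) A :=
    ∑ i ∈ s, (LinearMap.toSpanSingleton _ A (D (MvPolynomial.X i))).compDer (pderiv i)
  have apply_D' (g : MvPolynomial σ R) : D' g = ∑ i ∈ s, pderiv i g • D (MvPolynomial.X i) := by
    simp only [D', ← Derivation.coeFnAddMonoidHom_apply, map_sum, Finset.sum_apply]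
    rfl
  rw [← apply_D']
  refine MvPolynomial.derivation_eq_of_forall_mem_vars fun j hj => ?_
  rw [apply_D', Finset.sum_eq_single_of_mem j (hs hj), MvPolynomial.pderiv_X_self, one_smul]
  intro i _ hij
  rw [MvPolynomial.pderiv_X_of_ne hij.symm, zero_smul]

theorem onPowers_T {M : Type} [AddCommGroup M] [Module LambdaBar M] (g : ℤ → M) (l : ℤ) :
    onPowers g (T l) = g l := by
  rw [T, onPowers_single, one_smul]

theorem onPowers_C {M : Type} [AddCommGroup M] [Module LambdaBar M] (g : ℤ → M)
    (c : LambdaBar) : onPowers g (C c) = c • g 0 :=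
  onPowers_single g 0 c

theorem pgen_neg (j : ℤ) : pgen (-j) = pgen j := by rw [pgen, pgen, Int.natAbs_neg]

theorem traceE_T (l : ℤ) : traceE (T l) = pgen l := onPowers_T pgen l

theorem traceE_C (c : LambdaBar) : traceE (C c) = c * pgen 0 := onPowers_C pgen c

theorem traceE_C_mul (c : LambdaBar) (F : LambdaBarX) : traceE (C c * F) = c * traceE F := by
  rw [← LaurentPolynomial.smul_eq_C_mul, map_smul, smul_eq_mul]

theorem traceE_two_mul (F : LambdaBarX) : traceE (2 * F) = 2 * traceE F := by
  rw [two_mul, map_add, two_mul]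

theorem traceE_complex_smul (z : ℂ) (F : LambdaBarX) :
    traceE (z • F) = MvPolynomial.C z * traceE F := by
  rw [← MvPolynomial.smul_eq_C_mul]
  exact (traceE.restrictScalars ℂ).map_smul z F

theorem traceE_invert (F : LambdaBarX) : traceE (LaurentPolynomial.invert F) = traceE F := by
  induction F using AddMonoidAlgebra.induction_linear with
  | zero => simp only [map_zero]
  | add F G hF hG => rw [map_add, map_add, map_add, hF, hG]
  | single l c =>
    rw [LaurentPolynomial.single_eq_C_mul_T, map_mul, LaurentPolynomial.invert_C,
      LaurentPolynomial.invert_T, traceE_C_mul, traceE_C_mul, traceE_T, traceE_T, pgen_neg]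

/-- The odd Laurent polynomial `x ^ a - x ^ (-a)`, which is `∂ p_a` up to the factor `a`. -/
def oddT (a : ℕ) : LambdaBarX := T a - T (-a)

theorem derivP_eq_sum {f : LambdaBar} {M : ℕ} (hM : ∀ a ∈ f.vars, a ≤ M) :
    derivP f = ∑ a ∈ Finset.Icc 1 M, partialP a f • oddT a := by
  have h_vars : f.vars ⊆ insert 0 (Finset.Icc 1 M) := by
    intro a ha
    have := hM a ha
    simp only [Finset.mem_insert, Finset.mem_Icc]
    lia
  have derivP_X (a : ℕ) : derivP (MvPolynomial.X a) = (a : ℂ) • oddT a :=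
    MvPolynomial.mkDerivation_X ..
  rw [derivation_eq_sum_pderiv derivP h_vars, Finset.sum_insert (by simp)]
  simp only [derivP_X, Nat.cast_zero, zero_smul, smul_zero, zero_add]
  exact Finset.sum_congr rfl fun a _ => by rw [partialP, smul_assoc, smul_comm]

theorem derivInf_C_mul_T (c : LambdaBar) (l : ℤ) :
    derivInf (C c * T l) = derivP c * T l + (l : ℂ) • (C c * T l) := by
  rw [← LaurentPolynomial.single_eq_C_mul_T]
  refine (derivLin_single l c).trans ?_
  rw [LaurentPolynomial.single_eq_C_mul_T, add_mul, smul_mul_assoc]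

theorem dunklInf_apply (k p q : ℂ) (F : LambdaBarX) :
    dunklInf k p q F =
      derivInf F - (k / 2) • Delta F - (p / 2) • reflOne F - q • reflTwo F := rfl

theorem dunklInf_C (k p q : ℂ) (f : LambdaBar) : dunklInf k p q (C f) = derivP f := by
  have h_deriv : derivInf (C f) = derivP f := by
    simpa using derivInf_C_mul_T f 0
  have h_Delta : Delta (C f) = 0 := by simp [Delta, onPowers_C]
  have h_reflOne : reflOne (C f) = 0 := by simp [reflOne, onPowers_C]
  have h_reflTwo : reflTwo (C f) = 0 := by simp [reflTwo, onPowers_C]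
  simp only [dunklInf_apply, h_deriv, h_Delta, h_reflOne, h_reflTwo, smul_zero, sub_zero]

theorem traceE_deltaPos (a : ℕ) :
    traceE (deltaPos a) = (pgen 0 - 2 * (a : LambdaBar) - 1) * pgen a
      - 2 * ∑ j ∈ Finset.Ico 1 a, pgen ((a : ℤ) - 2 * j) - pgen a
      + 2 * ∑ j ∈ Finset.Ico 1 a, pgen j * pgen ((a : ℤ) - j) + pgen a * pgen 0 := by
  simp only [deltaPos, map_add traceE, map_sub traceE, map_sum traceE, traceE_two_mul,
    traceE_C_mul, traceE_T, traceE_C, pgen_neg]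

theorem traceE_Delta_oddT {a : ℕ} (ha : 0 < a) :
    traceE (Delta (oddT a)) = 2 * traceE (deltaPos a) := by
  have Delta_oddT : Delta (oddT a) = deltaPos a + LaurentPolynomial.invert (deltaPos a) := by
    rw [oddT, map_sub, Delta, onPowers_T, onPowers_T, if_pos (by lia), if_neg (by lia),
      if_pos (by lia), Int.natAbs_neg, Int.natAbs_natCast, deltaNeg_eq, sub_neg_eq_add]
  rw [Delta_oddT, map_add, traceE_invert, two_mul]

theorem onPowers_sign_mul_oddT {a : ℕ} (ha : 0 < a) (G : ℤ → LambdaBarX) :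
    onPowers (fun l => (l.sign : LambdaBarX) * G l) (oddT a) = G a + G (-a) := by
  rw [oddT, map_sub, onPowers_T, onPowers_T, Int.sign_neg, Int.sign_eq_one_of_pos (by lia)]
  push_cast
  ring

theorem traceE_reflOne_oddT {a : ℕ} (ha : 0 < a) :
    traceE (reflOne (oddT a)) =
      4 * (pgen a + ∑ j ∈ Finset.Ico 1 (2 * a), pgen ((a : ℤ) - j)) := by
  simp only [reflOne, onPowers_sign_mul_oddT ha, map_add, map_sum, traceE_two_mul, traceE_T,
    neg_neg, pgen_neg, Int.natAbs_neg, Int.natAbs_natCast]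
  ring

theorem traceE_reflTwo_oddT {a : ℕ} (ha : 0 < a) :
    traceE (reflTwo (oddT a)) =
      4 * (pgen a + ∑ j ∈ Finset.Ico 1 a, pgen ((a : ℤ) - 2 * j)) := by
  simp only [reflTwo, onPowers_sign_mul_oddT ha, map_add, map_sum, traceE_two_mul, traceE_T,
    neg_neg, pgen_neg, Int.natAbs_neg, Int.natAbs_natCast]
  ring

theorem traceE_derivInf_smul_oddT (c : LambdaBar) (a : ℕ) :
    traceE (derivInf (c • oddT a)) = traceE (derivP c * oddT a) + 2 * a * pgen a * c := by
  rw [oddT, LaurentPolynomial.smul_eq_C_mul, mul_sub, map_sub, derivInf_C_mul_T,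
    derivInf_C_mul_T, mul_sub]
  simp only [map_sub, map_add, traceE_complex_smul, traceE_C_mul, traceE_T, pgen_neg,
    Int.cast_neg, Int.cast_natCast, map_neg, map_natCast]
  ring

theorem traceE_oddT_mul (a b : ℕ) :
    traceE (oddT b * oddT a) = 2 * (pgen ((a : ℤ) + b) - pgen ((a : ℤ) - b)) := by
  have h : oddT b * oddT a = T (a + b) - T (a - b) - T (-(a - b)) + T (-(a + b)) := by
    simp only [oddT, sub_mul, mul_sub, ← LaurentPolynomial.T_add]
    ring_nf
  simp only [h, map_add traceE, map_sub traceE, traceE_T, pgen_neg]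
  ring

theorem traceE_dunklInf_smul_oddT (k p q : ℂ) (c : LambdaBar) {a : ℕ} (ha : 0 < a) :
    traceE (dunklInf k p q (c • oddT a)) =
      traceE (derivP c * oddT a)
      + 2 * ((MvPolynomial.C (a * k + a + k - p - 2 * q) - MvPolynomial.C k * pgen 0) *
            pgen a * c)
      + MvPolynomial.C (2 * (k - 2 * q)) *
          ((∑ j ∈ Finset.Ico 1 a, pgen ((a : ℤ) - 2 * j)) * c)
      - MvPolynomial.C (2 * p) *
          ((∑ j ∈ Finset.Ico 1 (2 * a), pgen ((a : ℤ) - j)) * c)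
      - MvPolynomial.C (2 * k) *
          ((∑ j ∈ Finset.Ico 1 a, pgen j * pgen ((a : ℤ) - j)) * c) := by
  have C_eq_two_mul (z : ℂ) : (MvPolynomial.C z : LambdaBar) = 2 * MvPolynomial.C (z / 2) := by
    rw [← map_ofNat MvPolynomial.C 2, ← map_mul]; congr 1; ring
  simp only [dunklInf_apply, map_sub traceE, traceE_complex_smul, map_smul Delta,
    map_smul reflOne, map_smul reflTwo, map_smul traceE, smul_eq_mul, traceE_derivInf_smul_oddT,
    traceE_Delta_oddT ha, traceE_deltaPos, traceE_reflOne_oddT ha, traceE_reflTwo_oddT ha,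
    map_mul, map_add, map_sub, map_natCast, map_ofNat]
  rw [C_eq_two_mul k, C_eq_two_mul p]
  ring

theorem cmsInf_one (k p q : ℂ) {f : LambdaBar} {M : ℕ} (hM : ∀ a ∈ f.vars, a ≤ M) :
    cmsInf k p q 1 f =
      2 * ∑ a ∈ Finset.Icc 1 M, ∑ b ∈ Finset.Icc 1 M,
          (pgen ((a : ℤ) + b) - pgen ((a : ℤ) - b)) * partialP a (partialP b f)
      + 2 * ∑ a ∈ Finset.Icc 1 M,
          (MvPolynomial.C (a * k + a + k - p - 2 * q) - MvPolynomial.C k * pgen 0) *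
            pgen a * partialP a f
      + MvPolynomial.C (2 * (k - 2 * q)) * ∑ a ∈ Finset.Icc 1 M,
          (∑ j ∈ Finset.Ico 1 a, pgen ((a : ℤ) - 2 * j)) * partialP a f
      - MvPolynomial.C (2 * p) * ∑ a ∈ Finset.Icc 1 M,
          (∑ j ∈ Finset.Ico 1 (2 * a), pgen ((a : ℤ) - j)) * partialP a f
      - MvPolynomial.C (2 * k) * ∑ a ∈ Finset.Icc 1 M,
          (∑ j ∈ Finset.Ico 1 a, pgen j * pgen ((a : ℤ) - j)) * partialP a f := by
  have h_trace : cmsInf k p q 1 f = ∑ a ∈ Finset.Icc 1 M,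
      traceE (dunklInf k p q (partialP a f • oddT a)) := by
    rw [← map_sum, ← map_sum, ← derivP_eq_sum hM, ← dunklInf_C k p q]
    rfl
  have h_second : ∑ a ∈ Finset.Icc 1 M, traceE (derivP (partialP a f) * oddT a) =
      2 * ∑ a ∈ Finset.Icc 1 M, ∑ b ∈ Finset.Icc 1 M,
        (pgen ((a : ℤ) + b) - pgen ((a : ℤ) - b)) * partialP a (partialP b f) := by
    rw [Finset.sum_comm, Finset.mul_sum]
    refine Finset.sum_congr rfl fun a _ => ?_
    rw [derivP_eq_sum fun b hb => hM b (vars_partialP_subset a f hb), Finset.sum_mul, map_sum,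
      Finset.mul_sum]
    refine Finset.sum_congr rfl fun b _ => ?_
    rw [smul_mul_assoc, map_smul, mul_comm (oddT b), traceE_oddT_mul, smul_eq_mul]
    ring
  rw [h_trace, Finset.sum_congr rfl fun a ha =>
    traceE_dunklInf_smul_oddT k p q (partialP a f) (Finset.mem_Icc.1 ha).1]
  simp only [Finset.sum_add_distrib, Finset.sum_sub_distrib, ← Finset.mul_sum, h_second]

end SecondOrder

end BCCMS

end

theorem mainTheorem9 :
    (∀ k p q : ℂ,
      -- the operator at infinity restricts to the `BC_N` Dunkl–Heckman operators
      (∀ (N : ℕ) (i : Fin N) (F : BCCMS.LambdaBarX),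
        BCCMS.phiX N i (BCCMS.dunklInf k p q F) =
          BCCMS.dunkl N k p q i (BCCMS.phiX N i F)) ∧
      -- `𝓛^(2r)` restricts to twice Heckman's integral of the `BC_N` system
      (∀ (N r : ℕ) (f : BCCMS.LambdaBar),
        BCCMS.phi N f ∈ BCCMS.invariants N ∧
        BCCMS.phi N (BCCMS.cmsInf k p q r f) =
          2 * BCCMS.heckman N k p q r (BCCMS.phi N f)) ∧
      -- the first of Heckman's integrals is the `BC_N` CMS operator
      (∀ (N : ℕ), ∀ g ∈ BCCMS.invariants N,
        BCCMS.heckman N k p q 1 g = BCCMS.gaugedCMS N k p q g) ∧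
      -- the integrals at infinity commute
      (∀ r s : ℕ, Commute (BCCMS.cmsInf k p q r) (BCCMS.cmsInf k p q s)) ∧
      -- the explicit form of `𝓛^(2)`; `M` bounds the indices of the generators occurring in `f`
      (∀ (f : BCCMS.LambdaBar) (M : ℕ), (∀ a ∈ f.vars, a ≤ M) →
        BCCMS.cmsInf k p q 1 f =
          2 * ∑ a ∈ Finset.Icc 1 M, ∑ b ∈ Finset.Icc 1 M,
              (BCCMS.pgen ((a : ℤ) + b) - BCCMS.pgen ((a : ℤ) - b)) *
                BCCMS.partialP a (BCCMS.partialP b f)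
          + 2 * ∑ a ∈ Finset.Icc 1 M,
              (MvPolynomial.C (a * k + a + k - p - 2 * q) - MvPolynomial.C k * BCCMS.pgen 0) *
                BCCMS.pgen a * BCCMS.partialP a f
          + MvPolynomial.C (2 * (k - 2 * q)) * ∑ a ∈ Finset.Icc 1 M,
              (∑ j ∈ Finset.Ico 1 a, BCCMS.pgen ((a : ℤ) - 2 * j)) * BCCMS.partialP a f
          - MvPolynomial.C (2 * p) * ∑ a ∈ Finset.Icc 1 M,
              (∑ j ∈ Finset.Ico 1 (2 * a), BCCMS.pgen ((a : ℤ) - j)) * BCCMS.partialP a f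
          - MvPolynomial.C (2 * k) * ∑ a ∈ Finset.Icc 1 M,
              (∑ j ∈ Finset.Ico 1 a, BCCMS.pgen j * BCCMS.pgen ((a : ℤ) - j)) *
                BCCMS.partialP a f)) ∧
    -- the deformed system
    (∀ (n m : ℕ) (k p q r s : ℂ), k ≠ 0 → p = k * r → 2 * q + 1 = k * (2 * s + 1) →
      (∀ l : ℕ, Commute (BCCMS.deformedIntegral n m k p q r s l)
        (BCCMS.deformedCMS n m k p q r s)) ∧
      (∀ l l' : ℕ, Commute (BCCMS.deformedIntegral n m k p q r s l)
        (BCCMS.deformedIntegral n m k p q r s l'))) := by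
  refine ⟨fun k p q => ⟨?_, ?_, ?_, ?_, ?_⟩, fun n m k p q r s hk hp hq => ⟨?_, ?_⟩⟩
  · exact fun _ i F => BCCMS.phiAt_inl_dunklInf i F
  · exact fun _ r f => ⟨BCCMS.phi_mem_invariants f, BCCMS.phi_cmsInf_eq_heckman r f⟩
  · exact fun _ _ hg => BCCMS.heckman_one hg
  · exact BCCMS.commute_cmsInf k p q
  · exact fun _ _ hM => BCCMS.cmsInf_one k p q hM
  · exact BCCMS.commute_deformedIntegral_deformedCMS hk hp hq
  · exact BCCMS.commute_deformedIntegral hk hp hq
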